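/- **Conventions.** All Hilbert spaces are complex; $[Y]$ is the closed linear span of $Y$, and products of sets of operators are formed elementwise. *Bases and factorizations.* A *$C^*$-base* is a triple $\mathfrak b=(\mathfrak B,\mathfrak H,\mathfrak B^\dagger)$ of a Hilbert space $\mathfrak H$ and two commuting nondegenerate $C^*$-algebras $\mathfrak B,\mathfrak B^\dagger\subseteq\mathcal L(\mathfrak H)$; put $\mathfrak b^{op}=(\mathfrak B^\dagger,\mathfrak H,\mathfrak B)$. A *$C^*$-factorization* of a Hilbert space $H$ with respect to $\mathfrak b$ is a closed subspace $\alpha\subseteq\mathcal L(\mathfrak H,H)$ with $[\alpha^*\alpha]=\mathfrak B$, $[\alpha\mathfrak B]=\alpha$, $[\alpha\mathfrak H]=H$; it defines a representation $\rho_\alpha$ of $\mathfrak B^\dagger$ on $H$ by $\rho_\alpha(x)\xi\zeta=\xi x\zeta$ ($\xi\in\alpha$, $\zeta\in\mathfrak H$). Factorizations $\alpha,\beta$ of $H$ with respect to $(\mathfrak B,\mathfrak H,\mathfrak B^\dagger)$ and $(\mathfrak C,\mathfrak K,\mathfrak C^\dagger)$ are *compatible* if $[\rho_\alpha(\mathfrak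 B^\dagger)\beta]=\beta$ and $[\rho_\beta(\mathfrak C^\dagger)\alpha]=\alpha$. For factorizations $\alpha$ of $H$ and $\beta$ of $K$ with respect to the same base, $\mathcal L(H_\alpha,K_\beta)=\{T: T\alpha\subseteq\beta,\ T^*\beta\subseteq\alpha\}$. *Relative tensor products.* For factorizations $\alpha$ of $H$ w.r.t. $\mathfrak b$ and $\beta$ of $K$ w.r.t. $\mathfrak b^{op}$, the Hilbert space $H\,{}_\alpha\!\otimes_\beta K$ is the completion of the span of elementary tensors $\xi\otimes\zeta\otimes\eta$ ($\xi\in\alpha$, $\zeta\in\mathfrak H$, $\eta\in\beta$) for $\langle\xi\otimes\zeta\otimes\eta|\xi'\otimes\zeta'\otimes\eta'\rangle=\langle\zeta|\xi^*\xi'\eta^*\eta'\zeta'\rangle$. Let $|\xi\rangle_1\colon K\to H\,{}_\alpha\!\otimes_\beta K$, $\eta\zeta\mapsto\xi\otimes\zeta\otimes\eta$, and $|\eta\rangle_2\colon H\to H\,{}_\alpha\!\otimes_\beta K$, $\xi\zeta\mapsto\xi\otimes\zeta\otimes\eta$; $\langle\xi|_1$, $\langle\eta|_2$ are the adjoints,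 and $|\alpha\rangle_1$, $\langle\alpha|_1$, $|\beta\rangle_2$, $\langle\beta|_2$ the corresponding sets. Write $\xi\otimes k=|\xi\rangle_1k$ and $h\otimes\eta=|\eta\rangle_2h$. For spaces $\gamma,\delta$ of operators into $H,K$ put $\gamma\triangleleft\beta=[|\beta\rangle_2\gamma]$ and $\alpha\triangleright\delta=[|\alpha\rangle_1\delta]$. The operator $S\otimes T\colon H\,{}_\alpha\!\otimes_\beta K\to L\,{}_\gamma\!\otimes_\delta M$ is $\xi\otimes k\mapsto S\xi\otimes Tk$ if $S\in\mathcal L(H_\alpha,L_\gamma)$ and $T$ intertwines $\rho_\beta,\rho_\delta$, and it is $h\otimes\eta\mapsto Sh\otimes T\eta$ if $T\in\mathcal L(K_\beta,M_\delta)$ and $S$ intertwines $\rho_\alpha,\rho_\gamma$. $\Sigma$ is the flip $\xi\otimes\zeta\otimes\eta\mapsto\eta\otimes\zeta\otimes\xi$. One identifies $(H\,{}_\alpha\!\otimes_\beta K)\,{}_{\alpha\triangleright\gamma}\!\otimes_\delta L$ with $H\,{}_\alpha\!\otimes_{\beta\triangleleft\delta}(K\,{}_\gamma\!\otimes_\delta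 L)$ via $(\xi\otimes k)\otimes\eta\leftrightarrow\xi\otimes(k\otimes\eta)$. Leg notation: $V_{12}=V\otimes1$, $V_{23}=1\otimes V$, $V_{13}=(1\otimes\Sigma)V_{12}\Sigma_{23}$, with $\Sigma_{23}\colon(h\otimes\xi)\otimes\eta\mapsto(h\otimes\eta)\otimes\xi$. *Concrete Hopf $C^*$-bimodules.* A nondegenerate *concrete $C^*$-$\mathfrak b$-algebra* $(H,A,\alpha)$ is a nondegenerate $C^*$-algebra $A\subseteq\mathcal L(H)$ with a factorization $\alpha$ of $H$ w.r.t. $\mathfrak b$ such that $\rho_\alpha(\mathfrak B^\dagger)A\subseteq A$. For $(H,A,\alpha)$ over $\mathfrak b$ and $(K,B,\beta)$ over $\mathfrak b^{op}$, $A*B$ is the set of $T\in\mathcal L(H\,{}_\alpha\!\otimes_\beta K)$ with $T|\alpha\rangle_1,T^*|\alpha\rangle_1\subseteq[|\alpha\rangle_1B]$ and $T|\beta\rangle_2,T^*|\beta\rangle_2\subseteq[|\beta\rangle_2A]$. For a $*$-homomorphism $\pi\colon A\to B$ of concrete algebras $(H,A,\alpha)$, $(K,B,\beta)$ over one base, $\mathcal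 L^\pi(H,K)=\{T: Ta=\pi(a)T\ \forall a\in A\}$, $\mathcal L^\pi(H_\alpha,K_\beta)=\mathcal L^\pi(H,K)\cap\mathcal L(H_\alpha,K_\beta)$, and $\pi$ is a *morphism* if $\beta=[\mathcal L^\pi(H_\alpha,K_\beta)\alpha]$. For morphisms $\varphi$ from $(H,A,\alpha)$ to $(L,C,\gamma)$ over $\mathfrak b$ and $\psi$ from $(K,B,\beta)$ to $(M,D,\delta)$ over $\mathfrak b^{op}$ and $T\in A*B$, $(\varphi*\psi)(T)$ is the unique operator with $(\varphi*\psi)(T)(X\otimes Y)=(X\otimes Y)T$ whenever $X\in\mathcal L^\varphi(H,L)$, $Y\in\mathcal L^\psi(K_\beta,M_\delta)$, or $X\in\mathcal L^\varphi(H_\alpha,L_\gamma)$, $Y\in\mathcal L^\psi(K,M)$. A *concrete Hopf $C^*$-bimodule* $(\mathfrak b,H,A,\alpha,\beta,\Delta)$ consists of nondegenerate concrete algebras $(H,A,\alpha)$ over $\mathfrak b$ and $(H,A,\beta)$ over $\mathfrak b^{op}$ with $\alpha,\beta$ compatible, and a $*$-homomorphism $\Delta\colon A\to A*A$ that is a morphism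 from $(H,A,\alpha)$ to $(H\,{}_\alpha\!\otimes_\beta H,A*A,\alpha\triangleright\alpha)$ and from $(H,A,\beta)$ to $(H\,{}_\alpha\!\otimes_\beta H,A*A,\beta\triangleleft\beta)$ and satisfies $(\Delta*\mathrm{id})\Delta=(\mathrm{id}*\Delta)\Delta$. *$C^*$-pseudo-multiplicative unitaries.* Let $\alpha$ be a factorization of $H$ w.r.t. $\mathfrak b$ and $\beta,\hat\beta$ factorizations of $H$ w.r.t. $\mathfrak b^{op}$, pairwise compatible. A unitary $V\colon H\,{}_{\hat\beta}\!\otimes_\alpha H\to H\,{}_\alpha\!\otimes_\beta H$ is a *$C^*$-pseudo-multiplicative unitary* over $\mathfrak b$ (for $(\hat\beta,\alpha,\beta)$) if $$V(\alpha\triangleleft\alpha)=\alpha\triangleright\alpha,\quad V(\hat\beta\triangleright\beta)=\hat\beta\triangleleft\beta,\quad V(\hat\beta\triangleright\hat\beta)=\alpha\triangleright\hat\beta,\quad V(\beta\triangleleft\alpha)=\beta\triangleleft\beta$$ and $V_{12}V_{13}V_{23}=V_{23}V_{12}$. Put $\hat A(V)=[\langle\beta|_2V|\alpha\rangle_2]$,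 $A(V)=[\langle\alpha|_1V|\hat\beta\rangle_1]$, $\hat\Delta_V(y)=V^*(1\otimes y)V$ for $y\in\hat A(V)$ and $\Delta_V(z)=V(z\otimes1)V^*$ for $z\in A(V)$. $V$ is *well-behaved* if $(\mathfrak b^{op},H,\hat A(V),\hat\beta,\alpha,\hat\Delta_V)$ and $(\mathfrak b,H,A(V),\alpha,\beta,\Delta_V)$ are concrete Hopf $C^*$-bimodules, and *regular* if $[\langle\alpha|_1V|\alpha\rangle_2]=[\alpha\alpha^*]$. *Balanced unitaries and pseudo-Kac systems.* Let $\alpha,\hat\alpha$ be factorizations of $H$ w.r.t. $\mathfrak b$ and $\beta,\hat\beta$ w.r.t. $\mathfrak b^{op}$, all four pairwise compatible, let $U\in\mathcal L(H)$ be a self-adjoint unitary with $U\alpha=\hat\alpha$, $U\beta=\hat\beta$, and let $V\colon H\,{}_{\hat\beta}\!\otimes_\alpha H\to H\,{}_\alpha\!\otimes_\beta H$ be a $C^*$-pseudo-multiplicative unitary over $\mathfrak b$. Put $$\check V=\Sigma(1\otimes U)V(1\otimes U)\Sigma\colon H\,{}_{\hat\alpha}\!\otimes_{\hat\beta}H\to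 H\,{}_{\hat\beta}\!\otimes_\alpha H,\qquad \hat V=\Sigma(U\otimes1)V(U\otimes1)\Sigma\colon H\,{}_\alpha\!\otimes_\beta H\to H\,{}_\beta\!\otimes_{\hat\alpha}H .$$ The tuple $(\alpha,\hat\alpha,\beta,\hat\beta,U,V)$ is a *balanced $C^*$-pseudo-multiplicative unitary* if $\check V$ and $\hat V$ are $C^*$-pseudo-multiplicative unitaries over $\mathfrak b^{op}$ (for $(\hat\alpha,\hat\beta,\alpha)$ and $(\alpha,\beta,\hat\alpha)$ in place of $(\hat\beta,\alpha,\beta)$, respectively). A balanced $C^*$-pseudo-multiplicative unitary is a *$C^*$-pseudo-Kac system* if $V,\check V,\hat V$ are regular and $(\Sigma(1\otimes U)V)^3=1$ in $\mathcal L(H\,{}_{\hat\beta}\!\otimes_\alpha H)$. It is a *weak $C^*$-pseudo-Kac system* if $V$ is well-behaved and $$V_{23}\hat V_{12}=\hat V_{12}V_{23}\ \text{ as maps } H\,{}_\alpha\!\otimes_\beta H\,{}_{\hat\beta}\!\otimes_\alpha H\to H\,{}_\beta\!\otimes_{\hat\alpha}H\,{}_\alpha\!\otimes_\beta H,$$ $$\check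 V_{23}V_{12}=V_{12}\check V_{23}\ \text{ as maps } H\,{}_{\hat\beta}\!\otimes_\alpha H\,{}_{\hat\alpha}\!\otimes_{\hat\beta}H\to H\,{}_\alpha\!\otimes_\beta H\,{}_{\hat\beta}\!\otimes_\alpha H.$$ **Proposition.** Every $C^*$-pseudo-Kac system is a weak $C^*$-pseudo-Kac system. -/

import Mathlib

noncomputable section

namespace PseudoKac

open ContinuousLinearMap

/-! ### Closed linear spans of products of sets of operators -/

/-- The closed linear span `[Y]` of a subset of a normed space. -/
def cspan {X : Type*} [NormedAddCommGroup X] [NormedSpace ℂ X] (Y : Set X) : Submodule ℂ X :=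
  (Submodule.span ℂ Y).topologicalClosure

/-- The closed linear span `[S T]` of all compositions of elements of two sets of operators. -/
def opProd {H K L : Type*} [NormedAddCommGroup H] [InnerProductSpace ℂ H]
    [NormedAddCommGroup K] [InnerProductSpace ℂ K] [NormedAddCommGroup L] [InnerProductSpace ℂ L]
    (S : Set (K →L[ℂ] L)) (T : Set (H →L[ℂ] K)) : Submodule ℂ (H →L[ℂ] L) :=
  cspan (Set.image2 (fun s t => s ∘L t) S T)

/-- The closed linear span `[S H]` of the vectors obtained by applying the operators in `S`. -/
def vecSpan {H K : Type*} [NormedAddCommGroup H] [InnerProductSpace ℂ H]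
    [NormedAddCommGroup K] [InnerProductSpace ℂ K] (S : Set (H →L[ℂ] K)) : Submodule ℂ K :=
  cspan (Set.image2 (fun s h => s h) S Set.univ)

/-- The set `S* = {s* | s ∈ S}`. -/
def adjSet {H K : Type*} [NormedAddCommGroup H] [InnerProductSpace ℂ H] [CompleteSpace H]
    [NormedAddCommGroup K] [InnerProductSpace ℂ K] [CompleteSpace K]
    (S : Set (H →L[ℂ] K)) : Set (K →L[ℂ] H) :=
  (fun s => adjoint s) '' S

/-- The set `T S = {T s | s ∈ S}`. -/
def leftMul {H K L : Type*} [NormedAddCommGroup H] [InnerProductSpace ℂ H]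
    [NormedAddCommGroup K] [InnerProductSpace ℂ K] [NormedAddCommGroup L] [InnerProductSpace ℂ L]
    (T : K →L[ℂ] L) (S : Set (H →L[ℂ] K)) : Set (H →L[ℂ] L) :=
  (fun s => T ∘L s) '' S

open Classical in
/-- The bounded operator prescribed by a set `G` of pairs (vector, image of that vector); it is
uniquely determined by `G` whenever the first entries of the pairs in `G` span a dense subspace,
which is the case in all uses below. (It is `0` if no bounded operator fits the prescription.) -/
def opOf {X Y : Type*} [NormedAddCommGroup X] [InnerProductSpace ℂ X]
    [NormedAddCommGroup Y] [InnerProductSpace ℂ Y] (G : Set (X × Y)) : X →L[ℂ] Y :=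
  if h : ∃ T : X →L[ℂ] Y, ∀ p ∈ G, T p.1 = p.2 then h.choose else 0

theorem opOf_apply {X Y : Type*} [NormedAddCommGroup X] [InnerProductSpace ℂ X]
    [NormedAddCommGroup Y] [InnerProductSpace ℂ Y] {G : Set (X × Y)} (T : X →L[ℂ] Y)
    (hT : ∀ p ∈ G, T p.1 = p.2) {x : X} {y : Y} (hp : (x, y) ∈ G) : opOf G x = y := by
  have h : ∃ T : X →L[ℂ] Y, ∀ p ∈ G, T p.1 = p.2 := ⟨T, hT⟩
  rw [opOf, dif_pos h]
  exact h.choose_spec _ hp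

theorem opOf_eq {X Y : Type*} [NormedAddCommGroup X] [InnerProductSpace ℂ X]
    [NormedAddCommGroup Y] [InnerProductSpace ℂ Y] {G : Set (X × Y)} (T : X →L[ℂ] Y)
    (hT : ∀ p ∈ G, T p.1 = p.2) (hG : cspan (Prod.fst '' G) = ⊤) : opOf G = T := by
  refine ContinuousLinearMap.ext_on (s := Prod.fst '' G) ?_ ?_
  · exact Submodule.dense_iff_topologicalClosure_eq_top.mpr hG
  · rintro _ ⟨p, hp, rfl⟩
    rw [hT p hp]
    exact opOf_apply T hT hp

/-! ### C*-bases and C*-factorizations -/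

/-- A C*-base `(𝔅, 𝔥, 𝔅†)`: two commuting nondegenerate C*-algebras of operators on `𝔥`. -/
structure CStarBase (𝔥 : Type*) [NormedAddCommGroup 𝔥] [InnerProductSpace ℂ 𝔥]
    [CompleteSpace 𝔥] where
  B : NonUnitalStarSubalgebra ℂ (𝔥 →L[ℂ] 𝔥)
  Bd : NonUnitalStarSubalgebra ℂ (𝔥 →L[ℂ] 𝔥)
  closed_B : IsClosed (B : Set (𝔥 →L[ℂ] 𝔥))
  closed_Bd : IsClosed (Bd : Set (𝔥 →L[ℂ] 𝔥))
  nondeg_B : vecSpan (B : Set (𝔥 →L[ℂ] 𝔥)) = ⊤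
  nondeg_Bd : vecSpan (Bd : Set (𝔥 →L[ℂ] 𝔥)) = ⊤
  comm : ∀ x ∈ B, ∀ y ∈ Bd, x ∘L y = y ∘L x

/-- The opposite C*-base `(𝔅†, 𝔥, 𝔅)`. -/
def CStarBase.op {𝔥 : Type*} [NormedAddCommGroup 𝔥] [InnerProductSpace ℂ 𝔥] [CompleteSpace 𝔥]
    (b : CStarBase 𝔥) : CStarBase 𝔥 where
  B := b.Bd
  Bd := b.B
  closed_B := b.closed_Bd
  closed_Bd := b.closed_B
  nondeg_B := b.nondeg_Bd
  nondeg_Bd := b.nondeg_B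
  comm := fun x hx y hy => (b.comm y hy x hx).symm

section Factorizations

variable {𝔥 𝔨 H K L M : Type*}
  [NormedAddCommGroup 𝔥] [InnerProductSpace ℂ 𝔥] [CompleteSpace 𝔥]
  [NormedAddCommGroup 𝔨] [InnerProductSpace ℂ 𝔨] [CompleteSpace 𝔨]
  [NormedAddCommGroup H] [InnerProductSpace ℂ H] [CompleteSpace H]
  [NormedAddCommGroup K] [InnerProductSpace ℂ K] [CompleteSpace K]
  [NormedAddCommGroup L] [InnerProductSpace ℂ L] [CompleteSpace L]
  [NormedAddCommGroup M] [InnerProductSpace ℂ M] [CompleteSpace M]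

/-- `α` is a C*-factorization of `H` with respect to the C*-base `b`: a closed subspace
`α ⊆ L(𝔥, H)` with `[α* α] = 𝔅`, `[α 𝔅] = α` and `[α 𝔥] = H`. -/
structure IsFactorization (b : CStarBase 𝔥) (α : Submodule ℂ (𝔥 →L[ℂ] H)) : Prop where
  closed : IsClosed (α : Set (𝔥 →L[ℂ] H))
  inner_eq : (opProd (adjSet (α : Set (𝔥 →L[ℂ] H))) (α : Set (𝔥 →L[ℂ] H)) :
    Set (𝔥 →L[ℂ] 𝔥)) = b.B
  mul_eq : opProd (α : Set (𝔥 →L[ℂ] H)) (b.B : Set (𝔥 →L[ℂ] 𝔥)) = α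
  vec_eq : vecSpan (α : Set (𝔥 →L[ℂ] H)) = ⊤

/-- The operator `ρ_α(x)` on `H`, for `x ∈ 𝔅†`: `ρ_α(x) ξ ζ = ξ x ζ` for `ξ ∈ α`, `ζ ∈ 𝔥`. -/
def rho (α : Submodule ℂ (𝔥 →L[ℂ] H)) (x : 𝔥 →L[ℂ] 𝔥) : H →L[ℂ] H :=
  opOf {p | ∃ ξ ∈ α, ∃ ζ : 𝔥, p = (ξ ζ, ξ (x ζ))}

/-- Compatibility `α ⊥ β` of C*-factorizations `α`, `β` of `H` with respect to `b` and `c`: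
`[ρ_α(𝔅†) β] = β` and `[ρ_β(ℭ†) α] = α`. -/
def Compatible (b : CStarBase 𝔥) (c : CStarBase 𝔨)
    (α : Submodule ℂ (𝔥 →L[ℂ] H)) (β : Submodule ℂ (𝔨 →L[ℂ] H)) : Prop :=
  opProd (rho α '' (b.Bd : Set (𝔥 →L[ℂ] 𝔥))) (β : Set (𝔨 →L[ℂ] H)) = β ∧
  opProd (rho β '' (c.Bd : Set (𝔨 →L[ℂ] 𝔨))) (α : Set (𝔥 →L[ℂ] H)) = α

/-- The space `L(H_α, K_β)` of all `T` with `T α ⊆ β` and `T* β ⊆ α`. -/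
def factHom (α : Submodule ℂ (𝔥 →L[ℂ] H)) (β : Submodule ℂ (𝔥 →L[ℂ] K)) : Set (H →L[ℂ] K) :=
  {T | (∀ ξ ∈ α, T ∘L ξ ∈ β) ∧ ∀ η ∈ β, adjoint T ∘L η ∈ α}

/-! ### The C*-relative tensor product -/

/-- All inner products `ξ* ξ'` of `α` commute with all inner products `η* η'` of `β`. This holds
whenever `α` and `β` are C*-factorizations with respect to a C*-base and its opposite. -/
def InnerCommute (α : Submodule ℂ (𝔥 →L[ℂ] H)) (β : Submodule ℂ (𝔥 →L[ℂ] K)) : Prop :=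
  ∀ ξ ∈ α, ∀ ξ' ∈ α, ∀ η ∈ β, ∀ η' ∈ β,
    (adjoint ξ ∘L ξ') ∘L (adjoint η ∘L η') = (adjoint η ∘L η') ∘L (adjoint ξ ∘L ξ')

open Classical in
/-- The scalar `⟨ξ ⊗ ζ ⊗ η | ξ' ⊗ ζ' ⊗ η'⟩ = ⟨ζ | (ξ* ξ') (η* η') ζ'⟩`. -/
def tripleKernel (α : Submodule ℂ (𝔥 →L[ℂ] H)) (β : Submodule ℂ (𝔥 →L[ℂ] K))
    (p q : α × 𝔥 × β) : ℂ :=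
  if InnerCommute α β then
    inner ℂ p.2.1 ((adjoint (p.1 : 𝔥 →L[ℂ] H) ∘L (q.1 : 𝔥 →L[ℂ] H))
      ((adjoint (p.2.2 : 𝔥 →L[ℂ] K) ∘L (q.2.2 : 𝔥 →L[ℂ] K)) q.2.1))
  else 0

/-- The Gram matrix of the elementary tensors is positive semidefinite. -/
theorem gram_nonneg {n : Type*} [Fintype n] (ξ : n → 𝔥 →L[ℂ] H) (η : n → 𝔥 →L[ℂ] K) (ζ : n → 𝔥)
    (hc : ∀ i j k l, (adjoint (ξ i) ∘L ξ j) ∘L (adjoint (η k) ∘L η l) =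
      (adjoint (η k) ∘L η l) ∘L (adjoint (ξ i) ∘L ξ j)) :
    0 ≤ (∑ i, ∑ j, inner ℂ (ζ i)
      ((adjoint (ξ i) ∘L ξ j) ((adjoint (η i) ∘L η j) (ζ j)))).re := by
  classical
  let E := PiLp 2 (fun _ : n => 𝔥)
  let pr : n → E →L[ℂ] 𝔥 := fun i => PiLp.proj 2 (fun _ : n => 𝔥) i
  have hpr : ∀ i (v : E), pr i v = v i := fun _ _ => rfl
  have hin : ∀ u v : E, inner ℂ u v = ∑ k, inner ℂ (pr k u) (pr k v) := fun u v =>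
    PiLp.inner_apply u v
  have hemb : ∀ (i : n) (x : 𝔥), adjoint (pr i) x = PiLp.single 2 i x := by
    intro i x
    refine ext_inner_left ℂ fun v => ?_
    rw [adjoint_inner_right, PiLp.inner_apply]
    rw [Finset.sum_eq_single i]
    · simp [hpr]
    · intro j _ hj
      simp [hj]
    · simp
  have hpe : ∀ (i j : n) (x : 𝔥), pr i (adjoint (pr j) x) = if i = j then x else 0 := by
    intro i j x
    rw [hemb, hpr]
    by_cases h : i = j
    · subst h; simp
    · simp [h]
  let Ξ : E →L[ℂ] H := ∑ j, ξ j ∘L pr j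
  let P : E →L[ℂ] E := adjoint Ξ ∘L Ξ
  have hP : 0 ≤ P := (nonneg_iff_isPositive _).2 (isPositive_adjoint_comp_self Ξ)
  let D : (𝔥 →L[ℂ] 𝔥) → E →L[ℂ] E := fun T => ∑ k, adjoint (pr k) ∘L T ∘L pr k
  have hD : ∀ T k v, pr k (D T v) = T (pr k v) := by
    intro T k v
    simp only [D, sum_apply, map_sum, comp_apply, hpe]
    simp
  have hprP : ∀ k v, pr k (P v) = ∑ j, (adjoint (ξ k) ∘L ξ j) (pr j v) := by
    intro k v
    have hΞ : adjoint Ξ = ∑ j, adjoint (pr j) ∘L adjoint (ξ j) := by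
      simp only [Ξ, map_sum, adjoint_comp]
    simp only [P, comp_apply, hΞ]
    simp only [sum_apply, map_sum, comp_apply, hpe, Ξ]
    simp
  have hext : ∀ u v : E, (∀ k, pr k u = pr k v) → u = v := by
    intro u v h
    refine ext_inner_left ℂ fun w => ?_
    rw [hin, hin]
    simp [h]
  have hcomm : ∀ i j, Commute P (D (adjoint (η i) ∘L η j)) := by
    intro i j
    refine ContinuousLinearMap.ext fun v => hext _ _ fun k => ?_
    change pr k (P (D (adjoint (η i) ∘L η j) v)) = pr k (D (adjoint (η i) ∘L η j) (P v))
    rw [hprP, hD, hprP, map_sum]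
    refine Finset.sum_congr rfl fun l _ => ?_
    rw [hD]
    exact DFunLike.congr_fun (hc k l i j) _
  let R : E →L[ℂ] E := CFC.sqrt P
  have hRR : R * R = P := CFC.sqrt_mul_sqrt_self P hP
  have hRsa : adjoint R = R := by
    have h0 : 0 ≤ R := CFC.sqrt_nonneg P
    have h1 : IsSelfAdjoint R := ((nonneg_iff_isPositive _).1 h0).isSelfAdjoint
    exact h1.adjoint_eq
  have hRcomm : ∀ i j, Commute R (D (adjoint (η i) ∘L η j)) := by
    intro i j
    have := (hcomm i j).cfcₙ_nnreal NNReal.sqrt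
    exact this
  have key : ∀ i j, inner ℂ (ζ i) ((adjoint (ξ i) ∘L ξ j) ((adjoint (η i) ∘L η j) (ζ j))) =
      ∑ k, inner ℂ (η i (pr k (R (adjoint (pr i) (ζ i)))))
        (η j (pr k (R (adjoint (pr j) (ζ j))))) := by
    intro i j
    have h1 : (adjoint (ξ i) ∘L ξ j) ((adjoint (η i) ∘L η j) (ζ j)) =
        pr i (P (D (adjoint (η i) ∘L η j) (adjoint (pr j) (ζ j)))) := by
      rw [hprP, Finset.sum_eq_single j]
      · rw [hD, hpe, if_pos rfl]
      · intro l _ hl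
        rw [hD, hpe, if_neg hl, map_zero, map_zero]
      · simp
    have h3 : ∀ v, P v = R (R v) := fun v => (DFunLike.congr_fun hRR v).symm
    rw [h1, ← adjoint_inner_left, h3, ← adjoint_inner_left R, hRsa]
    have h2 : R (D (adjoint (η i) ∘L η j) (adjoint (pr j) (ζ j))) =
        D (adjoint (η i) ∘L η j) (R (adjoint (pr j) (ζ j))) :=
      DFunLike.congr_fun (hRcomm i j) _
    rw [h2, hin]
    refine Finset.sum_congr rfl fun k _ => ?_
    rw [hD, comp_apply, adjoint_inner_right]
  have hsum : (∑ i, ∑ j, inner ℂ (ζ i)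
      ((adjoint (ξ i) ∘L ξ j) ((adjoint (η i) ∘L η j) (ζ j)))) =
      ∑ k, inner ℂ (∑ i, η i (pr k (R (adjoint (pr i) (ζ i)))))
        (∑ j, η j (pr k (R (adjoint (pr j) (ζ j))))) := by
    simp only [sum_inner, inner_sum, key]
    calc _ = ∑ i, ∑ k, ∑ j, inner ℂ (η i (pr k (R (adjoint (pr i) (ζ i)))))
          (η j (pr k (R (adjoint (pr j) (ζ j))))) :=
          Finset.sum_congr rfl fun i _ => Finset.sum_comm
      _ = _ := Finset.sum_comm
      _ = _ := by
          refine Finset.sum_congr rfl fun k _ => ?_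
          first | rfl | exact Finset.sum_comm
  rw [hsum, Complex.re_sum]
  exact Finset.sum_nonneg fun k _ => inner_self_nonneg (𝕜 := ℂ)

theorem tripleKernel_conj (α : Submodule ℂ (𝔥 →L[ℂ] H)) (β : Submodule ℂ (𝔥 →L[ℂ] K))
    (p q : α × 𝔥 × β) :
    (starRingEnd ℂ) (tripleKernel α β q p) = tripleKernel α β p q := by
  unfold tripleKernel
  split_ifs with h
  · have hc := DFunLike.congr_fun (h p.1 p.1.2 q.1 q.1.2 p.2.2 p.2.2.2 q.2.2 q.2.2.2) q.2.1
    rw [comp_apply, comp_apply (adjoint _ ∘L _) (adjoint _ ∘L _)] at hc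
    rw [inner_conj_symm, hc]
    simp only [comp_apply]
    rw [adjoint_inner_right, ← adjoint_inner_left, adjoint_inner_right, ← adjoint_inner_left]
  · simp

/-- The sesquilinear form on finite formal sums of elementary tensors `ξ ⊗ ζ ⊗ η` determined by
`⟨ξ ⊗ ζ ⊗ η | ξ' ⊗ ζ' ⊗ η'⟩ = ⟨ζ | (ξ* ξ') (η* η') ζ'⟩`. -/
def tripleForm (α : Submodule ℂ (𝔥 →L[ℂ] H)) (β : Submodule ℂ (𝔥 →L[ℂ] K))
    (f g : (α × 𝔥 × β) →₀ ℂ) : ℂ :=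
  f.sum fun p c => g.sum fun q d => (starRingEnd ℂ) c * d * tripleKernel α β p q

theorem tripleForm_conj (α : Submodule ℂ (𝔥 →L[ℂ] H)) (β : Submodule ℂ (𝔥 →L[ℂ] K))
    (f g : (α × 𝔥 × β) →₀ ℂ) :
    (starRingEnd ℂ) (tripleForm α β g f) = tripleForm α β f g := by
  simp only [tripleForm, Finsupp.sum, map_sum, map_mul, tripleKernel_conj, Complex.conj_conj]
  rw [Finset.sum_comm]
  refine Finset.sum_congr rfl fun p _ => Finset.sum_congr rfl fun q _ => ?_
  ring

theorem tripleForm_nonneg (α : Submodule ℂ (𝔥 →L[ℂ] H)) (β : Submodule ℂ (𝔥 →L[ℂ] K))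
    (f : (α × 𝔥 × β) →₀ ℂ) : 0 ≤ (tripleForm α β f f).re := by
  by_cases h : InnerCommute α β
  · have := gram_nonneg (n := f.support) (fun i => (i.1.1 : 𝔥 →L[ℂ] H))
      (fun i => (i.1.2.2 : 𝔥 →L[ℂ] K)) (fun i => f i.1 • i.1.2.1)
      (fun i j k l => h _ i.1.1.2 _ j.1.1.2 _ k.1.2.2.2 _ l.1.2.2.2)
    have e : tripleForm α β f f = ∑ p : f.support, ∑ q : f.support,
        (starRingEnd ℂ) (f p) * f q * tripleKernel α β p q :=
      Eq.trans (Finset.sum_coe_sort f.support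
        (fun p => f.sum fun q d => (starRingEnd ℂ) (f p) * d * tripleKernel α β p q)).symm
        (Finset.sum_congr rfl fun p _ => (Finset.sum_coe_sort f.support
          (fun q => (starRingEnd ℂ) (f p) * f q * tripleKernel α β p q)).symm)
    rw [e]
    refine this.trans_eq (congrArg Complex.re ?_)
    refine Finset.sum_congr rfl fun i _ => Finset.sum_congr rfl fun j _ => ?_
    rw [tripleKernel, if_pos h]
    simp only [map_smul, inner_smul_left, inner_smul_right]
    ring
  · simp [tripleForm, Finsupp.sum, tripleKernel, h]

theorem tripleForm_add (α : Submodule ℂ (𝔥 →L[ℂ] H)) (β : Submodule ℂ (𝔥 →L[ℂ] K))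
    (f g k : (α × 𝔥 × β) →₀ ℂ) :
    tripleForm α β (f + g) k = tripleForm α β f k + tripleForm α β g k := by
  classical
  refine Finsupp.sum_add_index' (fun p => ?_) (fun p c d => ?_)
  · simp [Finsupp.sum]
  · simp [add_mul, Finsupp.sum, Finset.sum_add_distrib]

theorem tripleForm_smul (α : Submodule ℂ (𝔥 →L[ℂ] H)) (β : Submodule ℂ (𝔥 →L[ℂ] K))
    (f g : (α × 𝔥 × β) →₀ ℂ) (c : ℂ) :
    tripleForm α β (c • f) g = (starRingEnd ℂ) c * tripleForm α β f g := by
  rw [tripleForm, Finsupp.sum_smul_index' (fun p => by simp [Finsupp.sum])]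
  simp [tripleForm, Finsupp.sum, Finset.mul_sum, mul_assoc]

/-- The space of finite formal sums of elementary tensors `ξ ⊗ ζ ⊗ η` with `ξ ∈ α`, `ζ ∈ 𝔥`,
`η ∈ β`, with the semi-inner product `tripleForm`. (Formal sums that vanish in the algebraic
tensor product are null vectors and disappear in the completion.) -/
def PreTensor (α : Submodule ℂ (𝔥 →L[ℂ] H)) (β : Submodule ℂ (𝔥 →L[ℂ] K)) : Type _ :=
  (α × 𝔥 × β) →₀ ℂ

instance (α : Submodule ℂ (𝔥 →L[ℂ] H)) (β : Submodule ℂ (𝔥 →L[ℂ] K)) :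
    AddCommGroup (PreTensor α β) :=
  inferInstanceAs (AddCommGroup ((α × 𝔥 × β) →₀ ℂ))

instance (α : Submodule ℂ (𝔥 →L[ℂ] H)) (β : Submodule ℂ (𝔥 →L[ℂ] K)) :
    Module ℂ (PreTensor α β) :=
  inferInstanceAs (Module ℂ ((α × 𝔥 × β) →₀ ℂ))

/-- A formal sum, as an element of `PreTensor α β`. -/
def toPre (α : Submodule ℂ (𝔥 →L[ℂ] H)) (β : Submodule ℂ (𝔥 →L[ℂ] K)) :
    ((α × 𝔥 × β) →₀ ℂ) ≃ₗ[ℂ] PreTensor α β :=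
  LinearEquiv.refl ℂ _

/-- The semi-inner product on `PreTensor α β`. -/
abbrev preCore (α : Submodule ℂ (𝔥 →L[ℂ] H)) (β : Submodule ℂ (𝔥 →L[ℂ] K)) :
    PreInnerProductSpace.Core ℂ (PreTensor α β) where
  inner f g := tripleForm α β ((toPre α β).symm f) ((toPre α β).symm g)
  conj_inner_symm _ _ := tripleForm_conj α β _ _
  re_inner_nonneg _ := tripleForm_nonneg α β _
  add_left _ _ _ := tripleForm_add α β _ _ _
  smul_left _ _ _ := tripleForm_smul α β _ _ _

instance (α : Submodule ℂ (𝔥 →L[ℂ] H)) (β : Submodule ℂ (𝔥 →L[ℂ] K)) :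
    SeminormedAddCommGroup (PreTensor α β) :=
  InnerProductSpace.Core.toSeminormedAddCommGroup (c := preCore α β)

instance (α : Submodule ℂ (𝔥 →L[ℂ] H)) (β : Submodule ℂ (𝔥 →L[ℂ] K)) :
    InnerProductSpace ℂ (PreTensor α β) :=
  InnerProductSpace.ofCore (preCore α β)

/-- The C*-relative tensor product `H_α ⊗_β K = α ⊗ 𝔥 ⊗ β`: the (Hausdorff) completion of the space
of finite formal sums of elementary tensors. -/
abbrev RelTensor (α : Submodule ℂ (𝔥 →L[ℂ] H)) (β : Submodule ℂ (𝔥 →L[ℂ] K)) : Type _ :=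
  UniformSpace.Completion (PreTensor α β)

/-- The elementary tensor `ξ ⊗ ζ ⊗ η`. -/
def tmul (α : Submodule ℂ (𝔥 →L[ℂ] H)) (β : Submodule ℂ (𝔥 →L[ℂ] K))
    (ξ : α) (ζ : 𝔥) (η : β) : RelTensor α β :=
  (toPre α β (Finsupp.single (ξ, ζ, η) 1) : UniformSpace.Completion (PreTensor α β))

theorem inner_tmul {α : Submodule ℂ (𝔥 →L[ℂ] H)} {β : Submodule ℂ (𝔥 →L[ℂ] K)}
    (h : InnerCommute α β) (ξ ξ' : α) (ζ ζ' : 𝔥) (η η' : β) :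
    inner ℂ (tmul α β ξ ζ η) (tmul α β ξ' ζ' η') =
      inner ℂ ζ ((adjoint (ξ : 𝔥 →L[ℂ] H) ∘L (ξ' : 𝔥 →L[ℂ] H))
        ((adjoint (η : 𝔥 →L[ℂ] K) ∘L (η' : 𝔥 →L[ℂ] K)) ζ')) := by
  rw [tmul, tmul, UniformSpace.Completion.inner_coe]
  change tripleForm α β (Finsupp.single _ _) (Finsupp.single _ _) = _
  rw [tripleForm, Finsupp.sum_single_index (by simp [Finsupp.sum]),
    Finsupp.sum_single_index (by simp)]
  simp [tripleKernel, h]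

/-- `|ξ⟩₁ : K → H_α ⊗_β K`, `η ζ ↦ ξ ⊗ ζ ⊗ η`, for `ξ ∈ α`. -/
def ketOne (α : Submodule ℂ (𝔥 →L[ℂ] H)) (β : Submodule ℂ (𝔥 →L[ℂ] K)) (ξ : α) :
    K →L[ℂ] RelTensor α β :=
  opOf {p | ∃ (ζ : 𝔥) (η : β), p = ((η : 𝔥 →L[ℂ] K) ζ, tmul α β ξ ζ η)}

/-- `|η⟩₂ : H → H_α ⊗_β K`, `ξ ζ ↦ ξ ⊗ ζ ⊗ η`, for `η ∈ β`. -/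
def ketTwo (α : Submodule ℂ (𝔥 →L[ℂ] H)) (β : Submodule ℂ (𝔥 →L[ℂ] K)) (η : β) :
    H →L[ℂ] RelTensor α β :=
  opOf {p | ∃ (ξ : α) (ζ : 𝔥), p = ((ξ : 𝔥 →L[ℂ] H) ζ, tmul α β ξ ζ η)}

/-- The set `|α⟩₁ = {|ξ⟩₁ | ξ ∈ α}`. -/
def ketsOne (α : Submodule ℂ (𝔥 →L[ℂ] H)) (β : Submodule ℂ (𝔥 →L[ℂ] K)) :
    Set (K →L[ℂ] RelTensor α β) :=
  Set.range (ketOne α β)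

/-- The set `|β⟩₂ = {|η⟩₂ | η ∈ β}`. -/
def ketsTwo (α : Submodule ℂ (𝔥 →L[ℂ] H)) (β : Submodule ℂ (𝔥 →L[ℂ] K)) :
    Set (H →L[ℂ] RelTensor α β) :=
  Set.range (ketTwo α β)

/-- `γ ◁ β = [|β⟩₂ γ]`, a space of operators into `H_α ⊗_β K`, for `γ` acting into `H`. -/
def leftTri (α : Submodule ℂ (𝔥 →L[ℂ] H)) (β : Submodule ℂ (𝔥 →L[ℂ] K))
    (γ : Submodule ℂ (𝔨 →L[ℂ] H)) : Submodule ℂ (𝔨 →L[ℂ] RelTensor α β) :=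
  opProd (ketsTwo α β) (γ : Set (𝔨 →L[ℂ] H))

/-- `α ▷ δ = [|α⟩₁ δ]`, a space of operators into `H_α ⊗_β K`, for `δ` acting into `K`. -/
def rightTri (α : Submodule ℂ (𝔥 →L[ℂ] H)) (β : Submodule ℂ (𝔥 →L[ℂ] K))
    (δ : Submodule ℂ (𝔨 →L[ℂ] K)) : Submodule ℂ (𝔨 →L[ℂ] RelTensor α β) :=
  opProd (ketsOne α β) (δ : Set (𝔨 →L[ℂ] K))

/-- `S ⊗ T : H_α ⊗_β K → L_γ ⊗_δ M` in the case where `S ∈ L(H_α, L_γ)` and `T` intertwines `ρ_β`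
and `ρ_δ`: it maps `ξ ⊗ k ∈ α ⊗ K` to `S ξ ⊗ T k`. -/
def tensorLeft (α : Submodule ℂ (𝔥 →L[ℂ] H)) (β : Submodule ℂ (𝔥 →L[ℂ] K))
    (γ : Submodule ℂ (𝔥 →L[ℂ] L)) (δ : Submodule ℂ (𝔥 →L[ℂ] M))
    (S : H →L[ℂ] L) (T : K →L[ℂ] M) : RelTensor α β →L[ℂ] RelTensor γ δ :=
  opOf {p | ∃ (ξ : α) (ξ' : γ) (k : K), (ξ' : 𝔥 →L[ℂ] L) = S ∘L (ξ : 𝔥 →L[ℂ] H) ∧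
    p = (ketOne α β ξ k, ketOne γ δ ξ' (T k))}

/-- `S ⊗ T : H_α ⊗_β K → L_γ ⊗_δ M` in the case where `T ∈ L(K_β, M_δ)` and `S` intertwines `ρ_α`
and `ρ_γ`: it maps `h ⊗ η ∈ H ⊗ β` to `S h ⊗ T η`. -/
def tensorRight (α : Submodule ℂ (𝔥 →L[ℂ] H)) (β : Submodule ℂ (𝔥 →L[ℂ] K))
    (γ : Submodule ℂ (𝔥 →L[ℂ] L)) (δ : Submodule ℂ (𝔥 →L[ℂ] M))
    (S : H →L[ℂ] L) (T : K →L[ℂ] M) : RelTensor α β →L[ℂ] RelTensor γ δ :=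
  opOf {p | ∃ (η : β) (η' : δ) (h : H), (η' : 𝔥 →L[ℂ] M) = T ∘L (η : 𝔥 →L[ℂ] K) ∧
    p = (ketTwo α β η h, ketTwo γ δ η' (S h))}

/-- `S₁ = S ⊗ 1 : H_α ⊗_β K → L_γ ⊗_β K`, for `S` intertwining `ρ_α` and `ρ_γ`. -/
def legOne (α : Submodule ℂ (𝔥 →L[ℂ] H)) (γ : Submodule ℂ (𝔥 →L[ℂ] L))
    (β : Submodule ℂ (𝔥 →L[ℂ] K)) (S : H →L[ℂ] L) : RelTensor α β →L[ℂ] RelTensor γ β :=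
  tensorRight α β γ β S (ContinuousLinearMap.id ℂ K)

/-- `T₂ = 1 ⊗ T : H_α ⊗_β K → H_α ⊗_δ M`, for `T` intertwining `ρ_β` and `ρ_δ`. -/
def legTwo (α : Submodule ℂ (𝔥 →L[ℂ] H)) (β : Submodule ℂ (𝔥 →L[ℂ] K))
    (δ : Submodule ℂ (𝔥 →L[ℂ] M)) (T : K →L[ℂ] M) : RelTensor α β →L[ℂ] RelTensor α δ :=
  tensorLeft α β α δ (ContinuousLinearMap.id ℂ H) T

/-- The flip `Σ : H_α ⊗_β K → K_β ⊗_α H`, `ξ ⊗ ζ ⊗ η ↦ η ⊗ ζ ⊗ ξ`. -/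
def flip (α : Submodule ℂ (𝔥 →L[ℂ] H)) (β : Submodule ℂ (𝔥 →L[ℂ] K)) :
    RelTensor α β →L[ℂ] RelTensor β α :=
  opOf {p | ∃ (ξ : α) (ζ : 𝔥) (η : β), p = (tmul α β ξ ζ η, tmul β α η ζ ξ)}

/-- The canonical identification
`(H_α ⊗_β K)_{α ▷ γ} ⊗_δ L → H_α ⊗_{β ◁ δ} (K_γ ⊗_δ L)`, `(ξ ⊗ k) ⊗ η ↦ ξ ⊗ (k ⊗ η)`,
for `ξ ∈ α`, `k ∈ K`, `η ∈ δ`. -/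
def assoc (α : Submodule ℂ (𝔥 →L[ℂ] H)) (β : Submodule ℂ (𝔥 →L[ℂ] K))
    (γ : Submodule ℂ (𝔨 →L[ℂ] K)) (δ : Submodule ℂ (𝔨 →L[ℂ] L)) :
    RelTensor (rightTri α β γ) δ →L[ℂ] RelTensor α (leftTri γ δ β) :=
  opOf {p | ∃ (ξ : α) (k : K) (η : δ),
    p = (ketTwo (rightTri α β γ) δ η (ketOne α β ξ k),
      ketOne α (leftTri γ δ β) ξ (ketTwo γ δ η k))}

/-- The inverse `H_α ⊗_{β ◁ δ} (K_γ ⊗_δ L) → (H_α ⊗_β K)_{α ▷ γ} ⊗_δ L` of `assoc`. -/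
def assocInv (α : Submodule ℂ (𝔥 →L[ℂ] H)) (β : Submodule ℂ (𝔥 →L[ℂ] K))
    (γ : Submodule ℂ (𝔨 →L[ℂ] K)) (δ : Submodule ℂ (𝔨 →L[ℂ] L)) :
    RelTensor α (leftTri γ δ β) →L[ℂ] RelTensor (rightTri α β γ) δ :=
  opOf {p | ∃ (ξ : α) (k : K) (η : δ),
    p = (ketOne α (leftTri γ δ β) ξ (ketTwo γ δ η k),
      ketTwo (rightTri α β γ) δ η (ketOne α β ξ k))}

/-- The isomorphism `Σ₂₃ : (H_α ⊗_β K)_{γ ◁ β} ⊗_δ L → (H_γ ⊗_δ L)_{α ◁ δ} ⊗_β K`,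
`(h ⊗ ξ) ⊗ η ↦ (h ⊗ η) ⊗ ξ`, for `h ∈ H`, `ξ ∈ β`, `η ∈ δ`. -/
def flipLast (α : Submodule ℂ (𝔥 →L[ℂ] H)) (β : Submodule ℂ (𝔥 →L[ℂ] K))
    (γ : Submodule ℂ (𝔨 →L[ℂ] H)) (δ : Submodule ℂ (𝔨 →L[ℂ] L)) :
    RelTensor (leftTri α β γ) δ →L[ℂ] RelTensor (leftTri γ δ α) β :=
  opOf {p | ∃ (h : H) (ξ : β) (η : δ),
    p = (ketTwo (leftTri α β γ) δ η (ketTwo α β ξ h),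
      ketTwo (leftTri γ δ α) β ξ (ketTwo γ δ η h))}

/-! ### Fiber products, morphisms and concrete Hopf C*-bimodules -/

/-- A nondegenerate C*-algebra of operators on `H`. -/
structure IsNondegCStarAlg (A : Submodule ℂ (H →L[ℂ] H)) : Prop where
  closed : IsClosed (A : Set (H →L[ℂ] H))
  mul_mem : ∀ x ∈ A, ∀ y ∈ A, x ∘L y ∈ A
  adjoint_mem : ∀ x ∈ A, adjoint x ∈ A
  nondeg : vecSpan (A : Set (H →L[ℂ] H)) = ⊤

/-- `(H, A, α)` is a nondegenerate concrete C*-algebra over the C*-base `b`. -/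
structure IsConcreteAlg (b : CStarBase 𝔥) (A : Submodule ℂ (H →L[ℂ] H))
    (α : Submodule ℂ (𝔥 →L[ℂ] H)) : Prop where
  alg : IsNondegCStarAlg A
  fact : IsFactorization b α
  rho_mul : ∀ x ∈ b.Bd, ∀ a ∈ A, rho α x ∘L a ∈ A

/-- The fiber product `A ∗ B ⊆ L(H_α ⊗_β K)` of `(H, A, α)` and `(K, B, β)`. -/
def fiberProd (A : Set (H →L[ℂ] H)) (α : Submodule ℂ (𝔥 →L[ℂ] H))
    (B : Set (K →L[ℂ] K)) (β : Submodule ℂ (𝔥 →L[ℂ] K)) :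
    Set (RelTensor α β →L[ℂ] RelTensor α β) :=
  {T | (∀ S ∈ ketsOne α β,
      T ∘L S ∈ opProd (ketsOne α β) B ∧ adjoint T ∘L S ∈ opProd (ketsOne α β) B) ∧
    (∀ S ∈ ketsTwo α β,
      T ∘L S ∈ opProd (ketsTwo α β) A ∧ adjoint T ∘L S ∈ opProd (ketsTwo α β) A)}

/-- `π` restricts to a `*`-homomorphism on the `*`-algebra `A` of operators with values in `B`. -/
structure IsStarHomOn (A : Submodule ℂ (H →L[ℂ] H)) (B : Set (K →L[ℂ] K))
    (π : (H →L[ℂ] H) → (K →L[ℂ] K)) : Prop where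
  mapsTo : ∀ x ∈ A, π x ∈ B
  map_add : ∀ x ∈ A, ∀ y ∈ A, π (x + y) = π x + π y
  map_smul : ∀ (c : ℂ), ∀ x ∈ A, π (c • x) = c • π x
  map_mul : ∀ x ∈ A, ∀ y ∈ A, π (x ∘L y) = π x ∘L π y
  map_adjoint : ∀ x ∈ A, π (adjoint x) = adjoint (π x)

/-- The space `L^π(H, K)` of all `T` with `T a = π(a) T` for all `a ∈ A`. -/
def intertwiners (A : Submodule ℂ (H →L[ℂ] H)) (π : (H →L[ℂ] H) → (K →L[ℂ] K)) :
    Set (H →L[ℂ] K) :=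
  {T | ∀ a ∈ A, T ∘L a = π a ∘L T}

/-- `π` is a morphism from `(H, A, α)` to `(K, B, β)`: a `*`-homomorphism `A → B` such that
`β = [L^π(H_α, K_β) α]`. -/
def IsMorphism (A : Submodule ℂ (H →L[ℂ] H)) (α : Submodule ℂ (𝔥 →L[ℂ] H))
    (B : Set (K →L[ℂ] K)) (β : Submodule ℂ (𝔥 →L[ℂ] K))
    (π : (H →L[ℂ] H) → (K →L[ℂ] K)) : Prop :=
  IsStarHomOn A B π ∧
    opProd (factHom α β ∩ intertwiners A π) (α : Set (𝔥 →L[ℂ] H)) = β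

open Classical in
/-- The operator `(φ ∗ ψ)(T)` on `L_γ ⊗_δ M`, where `φ` is a morphism from `(H, A, α)` to an algebra
over `(L, γ)`, `ψ` is a morphism from `(K, B, β)` to an algebra over `(M, δ)`, and `T ∈ A ∗ B`: the
unique operator `R` such that `R (X ⊗ Y) = (X ⊗ Y) T` whenever
(i) `X ∈ L^φ(H, L)` and `Y ∈ L^ψ(K_β, M_δ)`, or (ii) `X ∈ L^φ(H_α, L_γ)` and `Y ∈ L^ψ(K, M)`. -/
def fiberMap (A : Submodule ℂ (H →L[ℂ] H)) (α : Submodule ℂ (𝔥 →L[ℂ] H))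
    (B : Submodule ℂ (K →L[ℂ] K)) (β : Submodule ℂ (𝔥 →L[ℂ] K))
    (γ : Submodule ℂ (𝔥 →L[ℂ] L)) (δ : Submodule ℂ (𝔥 →L[ℂ] M))
    (φ : (H →L[ℂ] H) → (L →L[ℂ] L)) (ψ : (K →L[ℂ] K) → (M →L[ℂ] M))
    (T : RelTensor α β →L[ℂ] RelTensor α β) : RelTensor γ δ →L[ℂ] RelTensor γ δ :=
  if h : ∃ R : RelTensor γ δ →L[ℂ] RelTensor γ δ,
      (∀ X ∈ intertwiners A φ, ∀ Y ∈ factHom β δ ∩ intertwiners B ψ,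
        R ∘L tensorRight α β γ δ X Y = tensorRight α β γ δ X Y ∘L T) ∧
      (∀ X ∈ factHom α γ ∩ intertwiners A φ, ∀ Y ∈ intertwiners B ψ,
        R ∘L tensorLeft α β γ δ X Y = tensorLeft α β γ δ X Y ∘L T)
  then h.choose else 0

/-- `(b, H, A, α, β, Δ)` is a concrete Hopf C*-bimodule; only the values of `Δ` on `A` matter. -/
structure IsConcreteHopf (b : CStarBase 𝔥) (A : Submodule ℂ (H →L[ℂ] H))
    (α β : Submodule ℂ (𝔥 →L[ℂ] H))
    (Δ : (H →L[ℂ] H) → (RelTensor α β →L[ℂ] RelTensor α β)) : Prop where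
  alg_left : IsConcreteAlg b A α
  alg_right : IsConcreteAlg b.op A β
  compatible : Compatible b b.op α β
  mor_left : IsMorphism A α (fiberProd (A : Set (H →L[ℂ] H)) α (A : Set (H →L[ℂ] H)) β)
    (rightTri α β α) Δ
  mor_right : IsMorphism A β (fiberProd (A : Set (H →L[ℂ] H)) α (A : Set (H →L[ℂ] H)) β)
    (leftTri α β β) Δ
  /-- `(Δ ∗ id) ∘ Δ = (id ∗ Δ) ∘ Δ` as maps into `L(H_α ⊗_β H_α ⊗_β H)`. -/
  coassoc : ∀ a ∈ A,
    assoc α β α β ∘L fiberMap A α A β (rightTri α β α) β Δ _root_.id (Δ a) =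
      fiberMap A α A β α (leftTri α β β) _root_.id Δ (Δ a) ∘L assoc α β α β

/-! ### C*-pseudo-multiplicative unitaries -/

/-- `V` is unitary. -/
def IsUnitaryMap (V : H →L[ℂ] K) : Prop :=
  adjoint V ∘L V = ContinuousLinearMap.id ℂ H ∧ V ∘L adjoint V = ContinuousLinearMap.id ℂ K

/-- The pentagon equation `V₂₃ V₁₂ = V₁₂ V₁₃ V₂₃`, where `V₁₃ = (1 ⊗ Σ) V₁₂ Σ₂₃` is written out
along the pentagon diagram. Here `βh` stands for `β̂`, the map `V` goes from `H_β̂ ⊗_α H` to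
`H_α ⊗_β H`, and both sides go from `(H_β̂ ⊗_α H)_{β̂ ▷ β̂} ⊗_α H` to
`H_α ⊗_{β ◁ β} (H_α ⊗_β H)`. -/
def Pentagon (α βh β : Submodule ℂ (𝔥 →L[ℂ] H))
    (V : RelTensor βh α →L[ℂ] RelTensor α β) : Prop :=
  legTwo α (leftTri βh α β) (leftTri α β β) V ∘L
    assoc α β βh α ∘L
    legOne (rightTri βh α βh) (rightTri α β βh) α V =
  assoc α β α β ∘L
    legOne (leftTri βh α α) (rightTri α β α) β V ∘L
    flipLast α β βh α ∘L
    legOne (rightTri βh α β) (leftTri α β βh) α V ∘L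
    assocInv βh α β α ∘L
    legTwo βh (rightTri α β α) (leftTri β α α) (flip α β) ∘L
    legTwo βh (leftTri βh α α) (rightTri α β α) V ∘L
    assoc βh α βh α

/-- `V : H_β̂ ⊗_α H → H_α ⊗_β H` is a C*-pseudo-multiplicative unitary over the C*-base `b`. -/
structure IsPMU (b : CStarBase 𝔥) (α βh β : Submodule ℂ (𝔥 →L[ℂ] H))
    (V : RelTensor βh α →L[ℂ] RelTensor α β) : Prop where
  fact_α : IsFactorization b α
  fact_βh : IsFactorization b.op βh
  fact_β : IsFactorization b.op β
  compat_α_β : Compatible b b.op α β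
  compat_α_βh : Compatible b b.op α βh
  compat_β_βh : Compatible b.op b.op β βh
  unitary : IsUnitaryMap V
  map_one : leftMul V (leftTri βh α α : Set (𝔥 →L[ℂ] RelTensor βh α)) = rightTri α β α
  map_two : leftMul V (rightTri βh α β : Set (𝔥 →L[ℂ] RelTensor βh α)) = leftTri α β βh
  map_three : leftMul V (rightTri βh α βh : Set (𝔥 →L[ℂ] RelTensor βh α)) = rightTri α β βh
  map_four : leftMul V (leftTri βh α β : Set (𝔥 →L[ℂ] RelTensor βh α)) = leftTri α β β
  pentagon : Pentagon α βh β V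

/-- The left leg `Â(V) = [⟨β|₂ V |α⟩₂]`. -/
def legHat (α βh β : Submodule ℂ (𝔥 →L[ℂ] H)) (V : RelTensor βh α →L[ℂ] RelTensor α β) :
    Submodule ℂ (H →L[ℂ] H) :=
  opProd (adjSet (ketsTwo α β)) (leftMul V (ketsTwo βh α))

/-- The right leg `A(V) = [⟨α|₁ V |β̂⟩₁]`. -/
def leg (α βh β : Submodule ℂ (𝔥 →L[ℂ] H)) (V : RelTensor βh α →L[ℂ] RelTensor α β) :
    Submodule ℂ (H →L[ℂ] H) :=
  opProd (adjSet (ketsOne α β)) (leftMul V (ketsOne βh α))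

/-- `Δ̂_V : y ↦ V* (1 ⊗ y) V`. -/
def comulHat (α βh β : Submodule ℂ (𝔥 →L[ℂ] H)) (V : RelTensor βh α →L[ℂ] RelTensor α β)
    (y : H →L[ℂ] H) : RelTensor βh α →L[ℂ] RelTensor βh α :=
  adjoint V ∘L legTwo α β β y ∘L V

/-- `Δ_V : z ↦ V (z ⊗ 1) V*`. -/
def comul (α βh β : Submodule ℂ (𝔥 →L[ℂ] H)) (V : RelTensor βh α →L[ℂ] RelTensor α β)
    (z : H →L[ℂ] H) : RelTensor α β →L[ℂ] RelTensor α β :=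
  V ∘L legOne βh βh α z ∘L adjoint V

/-- `V` is well-behaved: both legs are concrete Hopf C*-bimodules. -/
def IsWellBehaved (b : CStarBase 𝔥) (α βh β : Submodule ℂ (𝔥 →L[ℂ] H))
    (V : RelTensor βh α →L[ℂ] RelTensor α β) : Prop :=
  IsConcreteHopf b.op (legHat α βh β V) βh α (comulHat α βh β V) ∧
  IsConcreteHopf b (leg α βh β V) α β (comul α βh β V)

/-- `V` is regular: `[⟨α|₁ V |α⟩₂] = [α α*]`. -/
def IsRegular (α βh β : Submodule ℂ (𝔥 →L[ℂ] H)) (V : RelTensor βh α →L[ℂ] RelTensor α β) :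
    Prop :=
  opProd (adjSet (ketsOne α β)) (leftMul V (ketsTwo βh α)) =
    opProd (α : Set (𝔥 →L[ℂ] H)) (adjSet (α : Set (𝔥 →L[ℂ] H)))

/-! ### C*-pseudo-Kac systems -/

/-- `V̌ = Σ (1 ⊗ U) V (1 ⊗ U) Σ : H_α̂ ⊗_β̂ H → H_β̂ ⊗_α H`. -/
def check (α αh β βh : Submodule ℂ (𝔥 →L[ℂ] H)) (U : H →L[ℂ] H)
    (V : RelTensor βh α →L[ℂ] RelTensor α β) : RelTensor αh βh →L[ℂ] RelTensor βh α :=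
  flip α βh ∘L legTwo α β βh U ∘L V ∘L legTwo βh αh α U ∘L flip αh βh

/-- `V̂ = Σ (U ⊗ 1) V (U ⊗ 1) Σ : H_α ⊗_β H → H_β ⊗_α̂ H`. -/
def hat (α αh β βh : Submodule ℂ (𝔥 →L[ℂ] H)) (U : H →L[ℂ] H)
    (V : RelTensor βh α →L[ℂ] RelTensor α β) : RelTensor α β →L[ℂ] RelTensor β αh :=
  flip αh β ∘L legOne α αh β U ∘L V ∘L legOne β βh α U ∘L flip α β

/-- `(α, α̂, β, β̂, U, V)` is a balanced C*-pseudo-multiplicative unitary. -/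
structure IsBalanced (b : CStarBase 𝔥) (α αh β βh : Submodule ℂ (𝔥 →L[ℂ] H)) (U : H →L[ℂ] H)
    (V : RelTensor βh α →L[ℂ] RelTensor α β) : Prop where
  fact_α : IsFactorization b α
  fact_αh : IsFactorization b αh
  fact_β : IsFactorization b.op β
  fact_βh : IsFactorization b.op βh
  compat_α_αh : Compatible b b α αh
  compat_α_β : Compatible b b.op α β
  compat_α_βh : Compatible b b.op α βh
  compat_αh_β : Compatible b b.op αh β
  compat_αh_βh : Compatible b b.op αh βh
  compat_β_βh : Compatible b.op b.op β βh
  selfAdjoint : IsSelfAdjoint U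
  unitary : IsUnitaryMap U
  map_α : leftMul U (α : Set (𝔥 →L[ℂ] H)) = αh
  map_β : leftMul U (β : Set (𝔥 →L[ℂ] H)) = βh
  pmu : IsPMU b α βh β V
  pmu_check : IsPMU b.op βh αh α (check α αh β βh U V)
  pmu_hat : IsPMU b.op β α αh (hat α αh β βh U V)

/-- The diagram `V₂₃ V̂₁₂ = V̂₁₂ V₂₃`, from `(H_α ⊗_β H)_{α ▷ β̂} ⊗_α H` to
`H_β ⊗_{α̂ ◁ β} (H_α ⊗_β H)`. -/
def HatCommutes (α αh β βh : Submodule ℂ (𝔥 →L[ℂ] H)) (U : H →L[ℂ] H)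
    (V : RelTensor βh α →L[ℂ] RelTensor α β) : Prop :=
  legTwo β (leftTri βh α αh) (leftTri α β αh) V ∘L
    assoc β αh βh α ∘L
    legOne (rightTri α β βh) (rightTri β αh βh) α (hat α αh β βh U V) =
  assoc β αh α β ∘L
    legOne (rightTri α β α) (rightTri β αh α) β (hat α αh β βh U V) ∘L
    assocInv α β α β ∘L
    legTwo α (leftTri βh α β) (leftTri α β β) V ∘L
    assoc α β βh α

/-- The diagram `V̌₂₃ V₁₂ = V₁₂ V̌₂₃`, from `(H_β̂ ⊗_α H)_{β̂ ▷ α̂} ⊗_β̂ H` to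
`H_α ⊗_{β ◁ α} (H_β̂ ⊗_α H)`. -/
def CheckCommutes (α αh β βh : Submodule ℂ (𝔥 →L[ℂ] H)) (U : H →L[ℂ] H)
    (V : RelTensor βh α →L[ℂ] RelTensor α β) : Prop :=
  legTwo α (leftTri αh βh β) (leftTri βh α β) (check α αh β βh U V) ∘L
    assoc α β αh βh ∘L
    legOne (rightTri βh α αh) (rightTri α β αh) βh V =
  assoc α β βh α ∘L
    legOne (rightTri βh α βh) (rightTri α β βh) α V ∘L
    assocInv βh α βh α ∘L
    legTwo βh (leftTri αh βh α) (leftTri βh α α) (check α αh β βh U V) ∘L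
    assoc βh α αh βh

/-- `(α, α̂, β, β̂, U, V)` is a weak C*-pseudo-Kac system. -/
structure IsWeakPseudoKac (b : CStarBase 𝔥) (α αh β βh : Submodule ℂ (𝔥 →L[ℂ] H))
    (U : H →L[ℂ] H) (V : RelTensor βh α →L[ℂ] RelTensor α β) : Prop where
  balanced : IsBalanced b α αh β βh U V
  wellBehaved : IsWellBehaved b α βh β V
  hat_commutes : HatCommutes α αh β βh U V
  check_commutes : CheckCommutes α αh β βh U V

/-- `(α, α̂, β, β̂, U, V)` is a C*-pseudo-Kac system: it is balanced, the unitaries `V`, `V̌`, `V̂`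
are regular, and `(Σ (1 ⊗ U) V)³ = 1` in `L(H_β̂ ⊗_α H)`. -/
structure IsPseudoKac (b : CStarBase 𝔥) (α αh β βh : Submodule ℂ (𝔥 →L[ℂ] H))
    (U : H →L[ℂ] H) (V : RelTensor βh α →L[ℂ] RelTensor α β) : Prop where
  balanced : IsBalanced b α αh β βh U V
  regular : IsRegular α βh β V
  regular_check : IsRegular βh αh α (check α αh β βh U V)
  regular_hat : IsRegular β α αh (hat α αh β βh U V)
  cube : (flip α βh ∘L legTwo α β βh U ∘L V) ^ 3 = 1

end Factorizations

end PseudoKac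

end

/-! Being weak means three things: V is well-behaved, V̂₁₂ commutes with V₂₃, and V̌₂₃ commutes with
V₁₂. Write Â = Â(V), A = A(V), y = ⟨η|₂V|ξ⟩₂ and z = ⟨a|₁V|c⟩₁.

Slicing the pentagon equation in its third or first leg gives Δ̂(y) = ⟨η|₃V₁₃V₂₃|ξ⟩₃ and Δ(z) =
⟨a|₁V₁₂V₁₃|c⟩₁ (`IsPMU.comulHat_slice22`, `IsPMU.bra_comp_comul`). Compressing 1 ⊗ k between ⟨η|₂V
and V*|η'⟩₂ produces adjoints of slices if k = ⟨ξ|₁V|ξ'⟩₂, and products of a slice with an adjoint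
slice if k = ξξ'*. Regularity says that both kinds of k have the same closed span. Together with β =
[Âβ] this gives [ÂÂ*] ⊆ Â and Â* ⊆ [ÂÂ*], so Â is a C*-algebra. That Δ̂ lands in the fiber product
needs in addition a mirrored regularity condition, `Coregular`. The operators V*|ξ⟩₁ intertwine the
identity of Â with Δ̂; there are enough of them to make Δ̂ a morphism and to identify Δ̂ ∗ id and id
∗ Δ̂, and coassociativity is then the pentagon equation once more (`IsPMU.isConcreteHopf_legHat`).

The right leg needs no separate treatment. Passing from V to V̂ exchanges slices in the first and
the second leg up to factors U, so that A(V) = Â(V̂), and each of V, V̂ is coregular because the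
other one is regular. Moreover the pentagon equations of V and V̂ give Δ_V = Δ̂_V̂ on A(V), that is,
V(z ⊗ 1)V* = V̂*(1 ⊗ z)V̂ (`HatPair.comul_slice11`, `HatPair.comul_eq`).

For the commutation relations, the cube relation is rewritten as V̂VV̌ = G, where G maps x ⊗ y to Uy
⊗ x (`IsPseudoKac.hat_comp_check`). Clearly G(z ⊗ 1) = (1 ⊗ z)G, and V̂V(z ⊗ 1) = (1 ⊗ z)V̂V by the
identity for Δ_V. Cancelling V̂V shows that V̌ commutes with z ⊗ 1 for the slices z of the first
leg. Since V is the hat of V̌, the same reasoning applied to V̌ shows that V̂ commutes with 1 ⊗ y.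
Slicing the diagrams for V̌₂₃V₁₂ and V₂₃V̂₁₂ in their outer legs reduces them to these two facts.

All tensor operators are prescribed on total families, so their existence has to be proved. The tool
is `exists_clm_of_gram`: an explicit residual family witnesses the norm bound, and it is supplied by
the square root in `exists_defect`. -/

noncomputable section

namespace PseudoKac

open ContinuousLinearMap

/-! ### Closed linear spans and extension of operators from total families -/

section Spans

variable {X Y Z : Type*} [NormedAddCommGroup X] [InnerProductSpace ℂ X]
  [NormedAddCommGroup Y] [InnerProductSpace ℂ Y] [NormedAddCommGroup Z] [InnerProductSpace ℂ Z]

theorem subset_cspan {E : Type*} [NormedAddCommGroup E] [NormedSpace ℂ E] (S : Set E) :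
    S ⊆ cspan S :=
  Submodule.subset_span.trans (Submodule.le_topologicalClosure _)

theorem isClosed_cspan {E : Type*} [NormedAddCommGroup E] [NormedSpace ℂ E] (S : Set E) :
    IsClosed (cspan S : Set E) :=
  Submodule.isClosed_topologicalClosure _

theorem cspan_le {E : Type*} [NormedAddCommGroup E] [NormedSpace ℂ E] {S : Set E}
    {P : Submodule ℂ E} (hP : IsClosed (P : Set E)) (h : S ⊆ P) : cspan S ≤ P :=
  Submodule.topologicalClosure_minimal _ (Submodule.span_le.2 h) hP

/-- A continuous linear map that sends generators into a closed subspace sends their closed span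
into it. -/
theorem map_mem_of_mem_cspan {E F : Type*} [NormedAddCommGroup E] [NormedSpace ℂ E]
    [NormedAddCommGroup F] [NormedSpace ℂ F] (Φ : E →L[ℂ] F) {S : Set E} {P : Submodule ℂ F}
    (hP : IsClosed (P : Set F)) (h : ∀ s ∈ S, Φ s ∈ P) {x : E} (hx : x ∈ cspan S) : Φ x ∈ P :=
  (cspan_le (P := P.comap Φ.toLinearMap) (hP.preimage Φ.continuous) h) hx

theorem eq_of_mem_cspan {E F : Type*} [NormedAddCommGroup E] [NormedSpace ℂ E]
    [NormedAddCommGroup F] [NormedSpace ℂ F] (Φ Ψ : E →L[ℂ] F) {S : Set E}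
    (h : ∀ s ∈ S, Φ s = Ψ s) {x : E} (hx : x ∈ cspan S) : Φ x = Ψ x := by
  have := map_mem_of_mem_cspan (Φ - Ψ) (P := ⊥) (by simp)
    (fun s hs => by simpa [sub_eq_zero] using h s hs) hx
  simpa [sub_eq_zero] using this

theorem ext_of_cspan_eq_top {E F : Type*} [NormedAddCommGroup E] [NormedSpace ℂ E]
    [NormedAddCommGroup F] [NormedSpace ℂ F] {S : Set E} (hS : cspan S = ⊤) {Φ Ψ : E →L[ℂ] F}
    (h : ∀ s ∈ S, Φ s = Ψ s) : Φ = Ψ :=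
  ContinuousLinearMap.ext fun _ => eq_of_mem_cspan Φ Ψ h (hS ▸ Submodule.mem_top)

theorem comp_mem_opProd {S : Set (Y →L[ℂ] Z)} {T : Set (X →L[ℂ] Y)} {s : Y →L[ℂ] Z}
    {t : X →L[ℂ] Y} (hs : s ∈ S) (ht : t ∈ T) : s ∘L t ∈ opProd S T :=
  subset_cspan _ ⟨s, hs, t, ht, rfl⟩

theorem isClosed_opProd (S : Set (Y →L[ℂ] Z)) (T : Set (X →L[ℂ] Y)) :
    IsClosed (opProd S T : Set (X →L[ℂ] Z)) :=
  isClosed_cspan _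

theorem opProd_le {S : Set (Y →L[ℂ] Z)} {T : Set (X →L[ℂ] Y)} {P : Submodule ℂ (X →L[ℂ] Z)}
    (hP : IsClosed (P : Set (X →L[ℂ] Z))) (h : ∀ s ∈ S, ∀ t ∈ T, s ∘L t ∈ P) :
    opProd S T ≤ P :=
  cspan_le hP (by rintro _ ⟨s, hs, t, ht, rfl⟩; exact h s hs t ht)

theorem map_mem_of_mem_opProd {F : Type*} [NormedAddCommGroup F] [NormedSpace ℂ F]
    {S : Set (Y →L[ℂ] Z)} {T : Set (X →L[ℂ] Y)} (Φ : (X →L[ℂ] Z) →L[ℂ] F) {P : Submodule ℂ F}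
    (hP : IsClosed (P : Set F)) (h : ∀ s ∈ S, ∀ t ∈ T, Φ (s ∘L t) ∈ P) {x : X →L[ℂ] Z}
    (hx : x ∈ opProd S T) : Φ x ∈ P :=
  map_mem_of_mem_cspan Φ hP (by rintro _ ⟨s, hs, t, ht, rfl⟩; exact h s hs t ht) hx

theorem eq_of_mem_opProd {F : Type*} [NormedAddCommGroup F] [NormedSpace ℂ F]
    {S : Set (Y →L[ℂ] Z)} {T : Set (X →L[ℂ] Y)} (Φ Ψ : (X →L[ℂ] Z) →L[ℂ] F)
    (h : ∀ s ∈ S, ∀ t ∈ T, Φ (s ∘L t) = Ψ (s ∘L t)) {x : X →L[ℂ] Z}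
    (hx : x ∈ opProd S T) : Φ x = Ψ x :=
  eq_of_mem_cspan Φ Ψ (by rintro _ ⟨s, hs, t, ht, rfl⟩; exact h s hs t ht) hx

theorem apply_mem_vecSpan {S : Set (X →L[ℂ] Y)} {s : X →L[ℂ] Y} (hs : s ∈ S) (x : X) :
    s x ∈ vecSpan S :=
  subset_cspan _ ⟨s, hs, x, trivial, rfl⟩

theorem vecSpan_le {S : Set (X →L[ℂ] Y)} {P : Submodule ℂ Y} (hP : IsClosed (P : Set Y))
    (h : ∀ s ∈ S, ∀ x, s x ∈ P) : vecSpan S ≤ P :=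
  cspan_le hP (by rintro _ ⟨s, hs, x, -, rfl⟩; exact h s hs x)

theorem ext_of_vecSpan_eq_top {F : Type*} [NormedAddCommGroup F] [NormedSpace ℂ F]
    {S : Set (X →L[ℂ] Y)} (hS : vecSpan S = ⊤) {Φ Ψ : Y →L[ℂ] F}
    (h : ∀ s ∈ S, ∀ x, Φ (s x) = Ψ (s x)) : Φ = Ψ :=
  ext_of_cspan_eq_top hS (by rintro _ ⟨s, hs, x, -, rfl⟩; exact h s hs x)

/-- If the values of `S` are total, and the closed subspace `P` contains the range of each
operator in `S`, then `P = ⊤`. -/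
theorem eq_top_of_vecSpan {S : Set (X →L[ℂ] Y)} (hS : vecSpan S = ⊤) {P : Submodule ℂ Y}
    (hP : IsClosed (P : Set Y)) (h : ∀ s ∈ S, ∀ x, s x ∈ P) : P = ⊤ :=
  top_le_iff.1 (hS ▸ vecSpan_le hP h)

/-- Extension of a map from a total family to a bounded operator, under a Gram condition. -/
theorem exists_clm_of_gram [CompleteSpace Y] {ι : Type*} {f : ι → X} {g : ι → Y} {r : ι → Z}
    {C : ℝ} (hC : 0 ≤ C) (hf : cspan (Set.range f) = ⊤)
    (h : ∀ i j, (C : ℂ) ^ 2 * inner ℂ (f i) (f j) = inner ℂ (g i) (g j) + inner ℂ (r i) (r j)) :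
    ∃ T : X →L[ℂ] Y, (∀ i, T (f i) = g i) ∧ ‖T‖ ≤ C := by
  let F := Finsupp.linearCombination ℂ f
  let G := Finsupp.linearCombination ℂ g
  let R := Finsupp.linearCombination ℂ r
  -- The Gram identity is sesquilinear, so it passes to finite linear combinations; the residual
  -- term is nonnegative on the diagonal, which gives the bound by C.
  have key : ∀ c : ι →₀ ℂ, (C : ℂ) ^ 2 * inner ℂ (F c) (F c) =
      inner ℂ (G c) (G c) + inner ℂ (R c) (R c) := by
    intro c
    simp only [F, G, R, Finsupp.linearCombination_apply, Finsupp.sum, sum_inner, inner_sum,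
      inner_smul_left, inner_smul_right, Finset.mul_sum, ← Finset.sum_add_distrib]
    refine Finset.sum_congr rfl fun i _ => Finset.sum_congr rfl fun j _ => ?_
    linear_combination (c i * (starRingEnd ℂ) (c j)) * h j i
  have bound : ∀ c : ι →₀ ℂ, ‖G c‖ ≤ C * ‖F c‖ := by
    intro c
    have h1 := congrArg Complex.re (key c)
    rw [inner_self_eq_norm_sq_to_K, inner_self_eq_norm_sq_to_K, inner_self_eq_norm_sq_to_K] at h1
    have h2 : C ^ 2 * ‖F c‖ ^ 2 = ‖G c‖ ^ 2 + ‖R c‖ ^ 2 := by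
      simpa only [Complex.coe_algebraMap, ← Complex.ofReal_pow, ← Complex.ofReal_mul,
        ← Complex.ofReal_add, Complex.ofReal_re] using h1
    refine le_of_sq_le_sq ?_ (by positivity)
    nlinarith [sq_nonneg ‖R c‖]
  have dense : DenseRange F := by
    have h1 : LinearMap.range F = Submodule.span ℂ (Set.range f) :=
      Finsupp.range_linearCombination ℂ
    have h2 : Dense (Submodule.span ℂ (Set.range f) : Set X) :=
      Submodule.dense_iff_topologicalClosure_eq_top.mpr hf
    rw [← h1] at h2
    rwa [LinearMap.coe_range] at h2
  refine ⟨G.extendOfNorm F, fun i => ?_, LinearMap.opNorm_extendOfNorm_le dense hC bound⟩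
  have := LinearMap.extendOfNorm_eq dense ⟨C, bound⟩ (Finsupp.single i 1)
  simpa [F, G] using this

/-- A total family and a family with the same Gram matrix. -/
theorem exists_clm_of_gram_eq [CompleteSpace Y] {ι : Type*} {f : ι → X} {g : ι → Y}
    (hf : cspan (Set.range f) = ⊤) (h : ∀ i j, inner ℂ (f i) (f j) = inner ℂ (g i) (g j)) :
    ∃ T : X →L[ℂ] Y, ∀ i, T (f i) = g i := by
  obtain ⟨T, hT, -⟩ := exists_clm_of_gram (g := g) (r := fun _ => (0 : X)) (C := 1) zero_le_one hf
    (fun i j => by simp [h i j])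
  exact ⟨T, hT⟩

/-- A contraction defect: `y² = ‖T‖² - T* T`, with `y` in the bicommutant of `T* T`. -/
theorem exists_defect [CompleteSpace X] [CompleteSpace Y] (T : X →L[ℂ] Y) :
    ∃ y : X →L[ℂ] X, adjoint y = y ∧
      (∀ u, y (y u) = ((‖T‖ : ℂ) ^ 2) • u - adjoint T (T u)) ∧
      ∀ s : X →L[ℂ] X, (∀ u, s (adjoint T (T u)) = adjoint T (T (s u))) →
        ∀ u, y (s u) = s (y u) := by
  let P : X →L[ℂ] X := ((‖T‖ : ℂ) ^ 2) • (1 : X →L[ℂ] X) - adjoint T ∘L T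
  have hP : 0 ≤ P := by
    rw [nonneg_iff_isPositive, isPositive_iff_complex]
    intro u
    have h1 : inner ℂ (P u) u = (((‖T‖ * ‖u‖) ^ 2 - ‖T u‖ ^ 2 : ℝ) : ℂ) := by
      simp only [P, sub_apply, smul_apply, comp_apply, inner_sub_left,
        inner_smul_left, adjoint_inner_left, inner_self_eq_norm_sq_to_K]
      push_cast
      simp
      ring
    rw [h1]
    refine ⟨by rw [RCLike.re_to_complex, Complex.ofReal_re], ?_⟩
    have := T.le_opNorm u
    simp only [RCLike.re_to_complex, Complex.ofReal_re]
    have h2 : 0 ≤ ‖T u‖ := norm_nonneg _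
    nlinarith
  refine ⟨CFC.sqrt P, ?_, ?_, ?_⟩
  · have h1 : IsSelfAdjoint (CFC.sqrt P) :=
      ((nonneg_iff_isPositive _).1 (CFC.sqrt_nonneg P)).isSelfAdjoint
    exact h1.adjoint_eq
  · intro u
    have := DFunLike.congr_fun (CFC.sqrt_mul_sqrt_self P hP) u
    exact this
  · intro s hs u
    have hc : Commute P s := by
      refine ContinuousLinearMap.ext fun v => ?_
      change P (s v) = s (P v)
      simp [P, hs]
    have h2 : Commute (CFC.sqrt P) s := hc.cfcₙ_nnreal NNReal.sqrt
    exact DFunLike.congr_fun h2 u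

end Spans

/-- Spaces of operators. -/
abbrev OpSpace (X Y : Type*) [NormedAddCommGroup X] [InnerProductSpace ℂ X]
    [NormedAddCommGroup Y] [InnerProductSpace ℂ Y] := Submodule ℂ (X →L[ℂ] Y)

/-! ### Elementary tensors, kets and bras, and the flip -/

section Kets

set_option linter.unusedSectionVars false

variable {𝔥 𝔨 H K L M : Type*}
  [NormedAddCommGroup 𝔥] [InnerProductSpace ℂ 𝔥] [CompleteSpace 𝔥]
  [NormedAddCommGroup 𝔨] [InnerProductSpace ℂ 𝔨] [CompleteSpace 𝔨]
  [NormedAddCommGroup H] [InnerProductSpace ℂ H] [CompleteSpace H]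
  [NormedAddCommGroup K] [InnerProductSpace ℂ K] [CompleteSpace K]
  [NormedAddCommGroup L] [InnerProductSpace ℂ L] [CompleteSpace L]
  [NormedAddCommGroup M] [InnerProductSpace ℂ M] [CompleteSpace M]

/-- `x` commutes with all inner products `ξ* ξ'` of elements of `α`. -/
def CommutesInner (α : OpSpace 𝔥 H) (x : 𝔥 →L[ℂ] 𝔥) : Prop :=
  ∀ ξ ∈ α, ∀ ξ' ∈ α, ∀ ζ, x (adjoint ξ (ξ' ζ)) = adjoint ξ (ξ' (x ζ))

theorem CommutesInner.adjoint {α : OpSpace 𝔥 H} {x : 𝔥 →L[ℂ] 𝔥}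
    (hx : CommutesInner α x) : CommutesInner α (adjoint x) := by
  intro ξ hξ ξ' hξ' ζ
  refine ext_inner_left ℂ fun u => ?_
  rw [adjoint_inner_right, adjoint_inner_right, ← adjoint_inner_left, ← hx ξ' hξ' ξ hξ u,
    adjoint_inner_right, ← adjoint_inner_left ξ', adjoint_inner_right]

theorem CommutesInner.comp {α : OpSpace 𝔥 H} {x y : 𝔥 →L[ℂ] 𝔥}
    (hx : CommutesInner α x) (hy : CommutesInner α y) : CommutesInner α (x ∘L y) := by
  intro ξ hξ ξ' hξ' ζ
  rw [comp_apply, hy ξ hξ ξ' hξ', hx ξ hξ ξ' hξ', comp_apply]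

theorem cspan_range_eq_vecSpan (α : OpSpace 𝔥 H) :
    cspan (Set.range fun p : α × 𝔥 => (p.1 : 𝔥 →L[ℂ] H) p.2) =
      vecSpan (α : Set (𝔥 →L[ℂ] H)) := by
  unfold vecSpan
  congr 1
  ext v
  constructor
  · rintro ⟨p, rfl⟩
    exact ⟨_, p.1.2, p.2, trivial, rfl⟩
  · rintro ⟨ξ, hξ, ζ, -, rfl⟩
    exact ⟨(⟨ξ, hξ⟩, ζ), rfl⟩

/-- Let y be the square root of ‖x‖² - x*x. The inner products ξ*ξ' commute with x and x*, hence
with y, so the vectors ξyζ are exactly the residual family that accounts for the difference between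
‖x‖² times the Gram matrix of the ξζ and the Gram matrix of the ξxζ. -/
theorem exists_rho {α : OpSpace 𝔥 H} (hα : vecSpan (α : Set (𝔥 →L[ℂ] H)) = ⊤)
    {x : 𝔥 →L[ℂ] 𝔥} (hx : CommutesInner α x) :
    ∃ T : H →L[ℂ] H, (∀ (ξ : α) (ζ : 𝔥), T ((ξ : 𝔥 →L[ℂ] H) ζ) = (ξ : 𝔥 →L[ℂ] H) (x ζ)) ∧
      ‖T‖ ≤ ‖x‖ := by
  obtain ⟨y, hy1, hy2, hy3⟩ := exists_defect x
  obtain ⟨T, hT, hT'⟩ := exists_clm_of_gram (C := ‖x‖) (norm_nonneg x)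
    (f := fun p : α × 𝔥 => (p.1 : 𝔥 →L[ℂ] H) p.2)
    (g := fun p : α × 𝔥 => (p.1 : 𝔥 →L[ℂ] H) (x p.2))
    (r := fun p : α × 𝔥 => (p.1 : 𝔥 →L[ℂ] H) (y p.2))
    ((cspan_range_eq_vecSpan α).trans hα) (by
      intro p q
      have hc : ∀ u, (adjoint (p.1 : 𝔥 →L[ℂ] H) ∘L (q.1 : 𝔥 →L[ℂ] H)) (adjoint x (x u)) =
          adjoint x (x ((adjoint (p.1 : 𝔥 →L[ℂ] H) ∘L (q.1 : 𝔥 →L[ℂ] H)) u)) := fun u =>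
        (hx.adjoint.comp hx _ p.1.2 _ q.1.2 u).symm
      have e : ∀ u v, inner ℂ ((p.1 : 𝔥 →L[ℂ] H) u) ((q.1 : 𝔥 →L[ℂ] H) v) =
          inner ℂ u ((adjoint (p.1 : 𝔥 →L[ℂ] H) ∘L (q.1 : 𝔥 →L[ℂ] H)) v) := fun u v => by
        rw [comp_apply, adjoint_inner_right]
      have e1 : ∀ v, inner ℂ (x p.2) v = inner ℂ p.2 (adjoint x v) := fun v => by
        rw [adjoint_inner_right]
      have e2 : ∀ v, inner ℂ (y p.2) v = inner ℂ p.2 (y v) := fun v => by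
        rw [← adjoint_inner_left, hy1]
      simp only [e]
      rw [e1, e2, ← hy3 _ hc, hy2]
      have : adjoint x ((adjoint (p.1 : 𝔥 →L[ℂ] H) ∘L (q.1 : 𝔥 →L[ℂ] H)) (x q.2)) =
          adjoint x (x ((adjoint (p.1 : 𝔥 →L[ℂ] H) ∘L (q.1 : 𝔥 →L[ℂ] H)) q.2)) := by
        rw [comp_apply, comp_apply, hx _ p.1.2 _ q.1.2]
      rw [this, inner_sub_right, inner_smul_right]
      ring)
  exact ⟨T, fun ξ ζ => hT (ξ, ζ), hT'⟩

theorem rho_apply {α : OpSpace 𝔥 H} (hα : vecSpan (α : Set (𝔥 →L[ℂ] H)) = ⊤)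
    {x : 𝔥 →L[ℂ] 𝔥} (hx : CommutesInner α x) {ξ : 𝔥 →L[ℂ] H} (hξ : ξ ∈ α) (ζ : 𝔥) :
    rho α x (ξ ζ) = ξ (x ζ) := by
  obtain ⟨T, hT, -⟩ := exists_rho hα hx
  refine opOf_apply T ?_ ⟨ξ, hξ, ζ, rfl⟩
  rintro _ ⟨ξ, hξ, ζ, rfl⟩
  exact hT ⟨ξ, hξ⟩ ζ

theorem norm_rho_le {α : OpSpace 𝔥 H} (hα : vecSpan (α : Set (𝔥 →L[ℂ] H)) = ⊤)
    {x : 𝔥 →L[ℂ] 𝔥} (hx : CommutesInner α x) : ‖rho α x‖ ≤ ‖x‖ := by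
  obtain ⟨T, hT, hT'⟩ := exists_rho hα hx
  have : rho α x = T := ext_of_vecSpan_eq_top hα fun ξ hξ ζ => by
    rw [hT ⟨ξ, hξ⟩, rho_apply hα hx hξ]
  rwa [this]

theorem rho_comp {α : OpSpace 𝔥 H} (hα : vecSpan (α : Set (𝔥 →L[ℂ] H)) = ⊤)
    {x : 𝔥 →L[ℂ] 𝔥} (hx : CommutesInner α x) {ξ : 𝔥 →L[ℂ] H} (hξ : ξ ∈ α) :
    rho α x ∘L ξ = ξ ∘L x :=
  ContinuousLinearMap.ext fun ζ => rho_apply hα hx hξ ζ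

theorem inner_rho {α : OpSpace 𝔥 H} (hα : vecSpan (α : Set (𝔥 →L[ℂ] H)) = ⊤)
    {x : 𝔥 →L[ℂ] 𝔥} (hx : CommutesInner α x) :
    adjoint (rho α x) = rho α (adjoint x) := by
  refine ext_of_vecSpan_eq_top hα fun ξ hξ ζ => ?_
  rw [rho_apply hα hx.adjoint hξ]
  have : (innerSL ℂ (adjoint (rho α x) (ξ ζ))) = innerSL ℂ (ξ (adjoint x ζ)) := by
    refine ext_of_vecSpan_eq_top hα fun ξ' hξ' ζ' => ?_
    rw [innerSL_apply_apply, innerSL_apply_apply, adjoint_inner_left, rho_apply hα hx hξ',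
      ← adjoint_inner_right, ← adjoint_inner_right ξ, ← hx ξ hξ ξ' hξ', adjoint_inner_left]
  exact ext_inner_right ℂ fun v => DFunLike.congr_fun this v

/-- The pair `α`, `β` admits a relative tensor product. -/
def Linked (α : OpSpace 𝔥 H) (β : OpSpace 𝔥 K) : Prop :=
  InnerCommute α β ∧ vecSpan (α : Set (𝔥 →L[ℂ] H)) = ⊤ ∧ vecSpan (β : Set (𝔥 →L[ℂ] K)) = ⊤

variable {α : OpSpace 𝔥 H} {β : OpSpace 𝔥 K}

theorem Linked.comm (h : Linked α β) : InnerCommute α β := h.1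

theorem Linked.left (h : Linked α β) : vecSpan (α : Set (𝔥 →L[ℂ] H)) = ⊤ := h.2.1

theorem Linked.right (h : Linked α β) : vecSpan (β : Set (𝔥 →L[ℂ] K)) = ⊤ := h.2.2

theorem Linked.symm (h : Linked α β) : Linked β α :=
  ⟨fun ξ hξ ξ' hξ' η hη η' hη' => (h.comm η hη η' hη' ξ hξ ξ' hξ').symm, h.right, h.left⟩

theorem Linked.commutesInner (h : Linked α β) (ξ ξ' : α) :
    CommutesInner β (adjoint (ξ : 𝔥 →L[ℂ] H) ∘L (ξ' : 𝔥 →L[ℂ] H)) :=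
  fun η hη η' hη' ζ => DFunLike.congr_fun (h.comm ξ ξ.2 ξ' ξ'.2 η hη η' hη') ζ

theorem Linked.inner_tmul (h : Linked α β) (ξ ξ' : α) (ζ ζ' : 𝔥) (η η' : β) :
    inner ℂ (tmul α β ξ ζ η) (tmul α β ξ' ζ' η') =
      inner ℂ ((η : 𝔥 →L[ℂ] K) ζ)
        ((η' : 𝔥 →L[ℂ] K) (adjoint (ξ : 𝔥 →L[ℂ] H) ((ξ' : 𝔥 →L[ℂ] H) ζ'))) := by
  rw [PseudoKac.inner_tmul h.comm, ← adjoint_inner_right]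
  have := h.commutesInner ξ ξ' _ η.2 _ η'.2 ζ'
  simp only [comp_apply] at this ⊢
  rw [this]

theorem cspan_range_tmul (α : OpSpace 𝔥 H) (β : OpSpace 𝔥 K) :
    cspan (Set.range fun p : α × 𝔥 × β => tmul α β p.1 p.2.1 p.2.2) = ⊤ := by
  rw [eq_top_iff]
  rintro v -
  induction v using UniformSpace.Completion.induction_on with
  | hp => exact isClosed_cspan _
  | ih f =>
    obtain ⟨g, rfl⟩ := (toPre α β).surjective f
    induction g using Finsupp.induction_linear with
    | zero =>
      rw [map_zero, UniformSpace.Completion.coe_zero]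
      exact zero_mem _
    | add f g hf hg =>
      rw [map_add, UniformSpace.Completion.coe_add]
      exact add_mem hf hg
    | single p c =>
      have : Finsupp.single p c = c • Finsupp.single p (1 : ℂ) := by simp
      rw [this, map_smul, UniformSpace.Completion.coe_smul]
      exact Submodule.smul_mem _ _ (subset_cspan _ ⟨p, rfl⟩)

theorem ext_tmul {F : Type*} [NormedAddCommGroup F] [NormedSpace ℂ F]
    {Φ Ψ : RelTensor α β →L[ℂ] F} (h : ∀ ξ ζ η, Φ (tmul α β ξ ζ η) = Ψ (tmul α β ξ ζ η)) :
    Φ = Ψ :=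
  ext_of_cspan_eq_top (cspan_range_tmul α β) (by rintro _ ⟨p, rfl⟩; exact h _ _ _)

/-- The residual family is ηyζ with y the square root of ‖ξ‖² - ξ*ξ. It has the right Gram matrix
because y, like ξ*ξ, commutes with all η*η'. -/
theorem exists_ketOne (h : Linked α β) (ξ : α) :
    ∃ T : K →L[ℂ] RelTensor α β,
      (∀ (η : β) ζ, T ((η : 𝔥 →L[ℂ] K) ζ) = tmul α β ξ ζ η) ∧ ‖T‖ ≤ ‖ξ‖ := by
  obtain ⟨y, hy1, hy2, hy3⟩ := exists_defect (ξ : 𝔥 →L[ℂ] H)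
  have hy : CommutesInner β y := by
    intro η hη η' hη' ζ
    exact hy3 (adjoint η ∘L η') (fun u => (h.commutesInner ξ ξ η hη η' hη' u).symm) ζ
  obtain ⟨T, hT, hT'⟩ := exists_clm_of_gram (C := ‖ξ‖) (norm_nonneg ξ)
    (f := fun p : β × 𝔥 => (p.1 : 𝔥 →L[ℂ] K) p.2)
    (g := fun p : β × 𝔥 => tmul α β ξ p.2 p.1)
    (r := fun p : β × 𝔥 => (p.1 : 𝔥 →L[ℂ] K) (y p.2))
    ((cspan_range_eq_vecSpan β).trans h.right) (by
      intro p q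
      rw [h.inner_tmul]
      have e2 : inner ℂ ((p.1 : 𝔥 →L[ℂ] K) (y p.2)) ((q.1 : 𝔥 →L[ℂ] K) (y q.2)) =
          inner ℂ ((p.1 : 𝔥 →L[ℂ] K) p.2) ((q.1 : 𝔥 →L[ℂ] K) (y (y q.2))) := by
        have e3 : ∀ u v, inner ℂ (y u) v = inner ℂ u (y v) := fun u v => by
          rw [← adjoint_inner_left, hy1]
        rw [← adjoint_inner_right, ← hy _ p.1.2 _ q.1.2, e3, hy _ p.1.2 _ q.1.2,
          hy _ p.1.2 _ q.1.2, adjoint_inner_right]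
      rw [e2, hy2, map_sub, map_smul, inner_sub_right, inner_smul_right]
      change (‖ξ‖ : ℂ) ^ 2 * _ = _ + ((‖ξ‖ : ℂ) ^ 2 * _ - _)
      ring)
  exact ⟨T, fun η ζ => hT (η, ζ), hT'⟩

theorem ketOne_apply (h : Linked α β) (ξ : α) (η : β) (ζ : 𝔥) :
    ketOne α β ξ ((η : 𝔥 →L[ℂ] K) ζ) = tmul α β ξ ζ η := by
  obtain ⟨T, hT, -⟩ := exists_ketOne h ξ
  refine opOf_apply T ?_ ⟨ζ, η, rfl⟩
  rintro _ ⟨ζ, η, rfl⟩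
  exact hT η ζ

theorem norm_ketOne_le (h : Linked α β) (ξ : α) : ‖ketOne α β ξ‖ ≤ ‖ξ‖ := by
  obtain ⟨T, hT, hT'⟩ := exists_ketOne h ξ
  have : ketOne α β ξ = T := ext_of_vecSpan_eq_top h.right fun η hη ζ => by
    rw [hT ⟨η, hη⟩, ketOne_apply h ξ ⟨η, hη⟩]
  rwa [this]

theorem exists_flip (h : Linked α β) :
    ∃ T : RelTensor α β →L[ℂ] RelTensor β α,
      ∀ ξ ζ η, T (tmul α β ξ ζ η) = tmul β α η ζ ξ := by
  obtain ⟨T, hT⟩ := exists_clm_of_gram_eq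
    (f := fun p : α × 𝔥 × β => tmul α β p.1 p.2.1 p.2.2)
    (g := fun p : α × 𝔥 × β => tmul β α p.2.2 p.2.1 p.1) (cspan_range_tmul α β) (by
      intro p q
      rw [PseudoKac.inner_tmul h.comm, PseudoKac.inner_tmul h.symm.comm]
      congr 1
      exact DFunLike.congr_fun (h.comm _ p.1.2 _ q.1.2 _ p.2.2.2 _ q.2.2.2) q.2.1)
  exact ⟨T, fun ξ ζ η => hT (ξ, ζ, η)⟩

theorem flip_tmul (h : Linked α β) (ξ : α) (ζ : 𝔥) (η : β) :
    flip α β (tmul α β ξ ζ η) = tmul β α η ζ ξ := by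
  obtain ⟨T, hT⟩ := exists_flip h
  refine opOf_apply T ?_ ⟨ξ, ζ, η, rfl⟩
  rintro _ ⟨ξ, ζ, η, rfl⟩
  exact hT ξ ζ η

theorem flip_flip (h : Linked α β) : flip β α ∘L flip α β = ContinuousLinearMap.id ℂ _ :=
  ext_tmul fun ξ ζ η => by rw [comp_apply, flip_tmul h, flip_tmul h.symm, id_apply]

theorem adjoint_flip (h : Linked α β) : adjoint (flip α β) = flip β α := by
  refine ext_tmul fun η ζ ξ => ?_
  have : innerSL ℂ (adjoint (flip α β) (tmul β α η ζ ξ)) = innerSL ℂ (tmul α β ξ ζ η) := by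
    refine ext_tmul fun ξ' ζ' η' => ?_
    rw [innerSL_apply_apply, innerSL_apply_apply, adjoint_inner_left, flip_tmul h,
      PseudoKac.inner_tmul h.comm, PseudoKac.inner_tmul h.symm.comm]
    congr 1
    exact (DFunLike.congr_fun (h.comm _ ξ.2 _ ξ'.2 _ η.2 _ η'.2) ζ').symm
  rw [flip_tmul h.symm]
  exact ext_inner_right ℂ fun v => DFunLike.congr_fun this v

theorem isUnitaryMap_flip (h : Linked α β) : IsUnitaryMap (flip α β) := by
  rw [IsUnitaryMap, adjoint_flip h]
  exact ⟨flip_flip h, flip_flip h.symm⟩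

/-- The flip of a first-leg ket is a bounded operator with the prescribed values, so no second Gram
computation is needed. -/
theorem ketTwo_apply (h : Linked α β) (ξ : α) (η : β) (ζ : 𝔥) :
    ketTwo α β η ((ξ : 𝔥 →L[ℂ] H) ζ) = tmul α β ξ ζ η := by
  refine opOf_apply (flip β α ∘L ketOne β α η) ?_ ⟨ξ, ζ, rfl⟩
  rintro _ ⟨ξ, ζ, rfl⟩
  rw [comp_apply, ketOne_apply h.symm, flip_tmul h.symm]

theorem flip_comp_ketOne (h : Linked α β) (ξ : α) :
    flip α β ∘L ketOne α β ξ = ketTwo β α ξ :=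
  ext_of_vecSpan_eq_top h.right fun η hη ζ => by
    rw [comp_apply, ketOne_apply h ξ ⟨η, hη⟩, flip_tmul h, ketTwo_apply h.symm ⟨η, hη⟩]

theorem flip_comp_ketTwo (h : Linked α β) (η : β) :
    flip α β ∘L ketTwo α β η = ketOne β α η := by
  rw [← flip_comp_ketOne h.symm, ← comp_assoc, flip_flip h.symm, id_comp]

/-- Both sides send ζ to ξ ⊗ ζ ⊗ η. This is the rule by which first-leg and second-leg kets are
exchanged, and it also makes `ketOne` linear in ξ. -/
theorem ketOne_comp (h : Linked α β) (ξ : α) (η : β) :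
    ketOne α β ξ ∘L (η : 𝔥 →L[ℂ] K) = ketTwo α β η ∘L (ξ : 𝔥 →L[ℂ] H) :=
  ContinuousLinearMap.ext fun ζ => by
    rw [comp_apply, comp_apply, ketOne_apply h, ketTwo_apply h]

theorem IsUnitaryMap.norm_apply {V : H →L[ℂ] K} (hV : IsUnitaryMap V) (v : H) :
    ‖V v‖ = ‖v‖ := by
  have h1 : inner ℂ (V v) (V v) = inner ℂ v v := by
    rw [← adjoint_inner_right, ← comp_apply, hV.1, id_apply]
  rw [inner_self_eq_norm_sq_to_K, inner_self_eq_norm_sq_to_K] at h1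
  have h2 : ‖V v‖ ^ 2 = ‖v‖ ^ 2 := by exact_mod_cast h1
  exact (sq_eq_sq₀ (norm_nonneg _) (norm_nonneg _)).1 h2

theorem ketOne_add (h : Linked α β) (ξ ξ' : α) :
    ketOne α β (ξ + ξ') = ketOne α β ξ + ketOne α β ξ' := by
  refine ext_of_vecSpan_eq_top h.right fun η hη ζ => ?_
  have e : ∀ ξ : α, ketOne α β ξ (η ζ) = ketTwo α β ⟨η, hη⟩ ((ξ : 𝔥 →L[ℂ] H) ζ) := fun ξ =>
    DFunLike.congr_fun (ketOne_comp h ξ ⟨η, hη⟩) ζ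
  rw [add_apply, e, e, e, Submodule.coe_add, add_apply, map_add]

theorem ketOne_smul (h : Linked α β) (c : ℂ) (ξ : α) :
    ketOne α β (c • ξ) = c • ketOne α β ξ := by
  refine ext_of_vecSpan_eq_top h.right fun η hη ζ => ?_
  have e : ∀ ξ : α, ketOne α β ξ (η ζ) = ketTwo α β ⟨η, hη⟩ ((ξ : 𝔥 →L[ℂ] H) ζ) := fun ξ =>
    DFunLike.congr_fun (ketOne_comp h ξ ⟨η, hη⟩) ζ
  rw [smul_apply, e, e, Submodule.coe_smul, smul_apply, map_smul]

/-- `ketOne` as a linear map. -/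
def ketOneLin (h : Linked α β) : α →ₗ[ℂ] (K →L[ℂ] RelTensor α β) where
  toFun := ketOne α β
  map_add' := ketOne_add h
  map_smul' := ketOne_smul h

/-- `ketOne` as a bounded linear map. -/
def ketOneL (h : Linked α β) : α →L[ℂ] (K →L[ℂ] RelTensor α β) where
  toLinearMap := ketOneLin h
  cont := AddMonoidHomClass.continuous_of_bound (ketOneLin h) 1 fun ξ => by
    rw [one_mul]
    exact norm_ketOne_le h ξ

@[simp]
theorem ketOneL_apply (h : Linked α β) (ξ : α) : ketOneL h ξ = ketOne α β ξ := rfl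

/-- `ketTwo` as a bounded linear map. -/
def ketTwoL (h : Linked α β) : β →L[ℂ] H →L[ℂ] RelTensor α β :=
  (compL ℂ H (RelTensor β α) (RelTensor α β) (flip β α)) ∘L ketOneL h.symm

@[simp]
theorem ketTwoL_apply (h : Linked α β) (η : β) : ketTwoL h η = ketTwo α β η :=
  flip_comp_ketOne h.symm η

theorem ext_ketOne (h : Linked α β) {F : Type*} [NormedAddCommGroup F] [NormedSpace ℂ F]
    {Φ Ψ : RelTensor α β →L[ℂ] F} (hΦ : ∀ ξ, Φ ∘L ketOne α β ξ = Ψ ∘L ketOne α β ξ) : Φ = Ψ :=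
  ext_tmul fun ξ ζ η => by
    rw [← ketOne_apply h]
    exact DFunLike.congr_fun (hΦ ξ) _

theorem ext_ketTwo (h : Linked α β) {F : Type*} [NormedAddCommGroup F] [NormedSpace ℂ F]
    {Φ Ψ : RelTensor α β →L[ℂ] F} (hΦ : ∀ η, Φ ∘L ketTwo α β η = Ψ ∘L ketTwo α β η) : Φ = Ψ :=
  ext_tmul fun ξ ζ η => by
    rw [← ketTwo_apply h]
    exact DFunLike.congr_fun (hΦ η) _

theorem cspan_range_ketOne (h : Linked α β) :
    cspan (Set.range fun p : α × K => ketOne α β p.1 p.2) = ⊤ := by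
  refine top_le_iff.1 (cspan_range_tmul α β ▸ cspan_le (isClosed_cspan _) ?_)
  rintro _ ⟨p, rfl⟩
  exact subset_cspan _ ⟨(p.1, (p.2.2 : 𝔥 →L[ℂ] K) p.2.1), ketOne_apply h _ _ _⟩

theorem cspan_range_ketTwo (h : Linked α β) :
    cspan (Set.range fun p : β × H => ketTwo α β p.1 p.2) = ⊤ := by
  refine top_le_iff.1 (cspan_range_tmul α β ▸ cspan_le (isClosed_cspan _) ?_)
  rintro _ ⟨p, rfl⟩
  exact subset_cspan _ ⟨(p.2.2, (p.1 : 𝔥 →L[ℂ] H) p.2.1), ketTwo_apply h _ _ _⟩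

/-- Two vectors in a relative tensor product agree if all their slices do. -/
theorem eq_of_bra_eq {Y : Type*} [NormedAddCommGroup Y] [InnerProductSpace ℂ Y] {Φ Ψ : Y →L[ℂ] H}
    {S : Set H} (hS : cspan S = ⊤) (h : ∀ s ∈ S, ∀ y, inner ℂ s (Φ y) = inner ℂ s (Ψ y)) :
    Φ = Ψ := by
  ext y
  refine ext_inner_right ℂ fun v => ?_
  have : innerSL ℂ (Φ y) = innerSL ℂ (Ψ y) := ext_of_cspan_eq_top hS fun s hs => by
    rw [innerSL_apply_apply, innerSL_apply_apply, ← inner_conj_symm, h s hs, inner_conj_symm]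
  exact DFunLike.congr_fun this v

theorem ext_braOne (h : Linked α β) {Y : Type*} [NormedAddCommGroup Y] [InnerProductSpace ℂ Y]
    {Φ Ψ : Y →L[ℂ] RelTensor α β}
    (hΦ : ∀ ξ, adjoint (ketOne α β ξ) ∘L Φ = adjoint (ketOne α β ξ) ∘L Ψ) : Φ = Ψ := by
  refine eq_of_bra_eq (cspan_range_ketOne h) ?_
  rintro _ ⟨p, rfl⟩ y
  rw [← adjoint_inner_right, ← adjoint_inner_right]
  exact congrArg _ (DFunLike.congr_fun (hΦ p.1) y)

theorem ext_braTwo (h : Linked α β) {Y : Type*} [NormedAddCommGroup Y] [InnerProductSpace ℂ Y]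
    {Φ Ψ : Y →L[ℂ] RelTensor α β}
    (hΦ : ∀ η, adjoint (ketTwo α β η) ∘L Φ = adjoint (ketTwo α β η) ∘L Ψ) : Φ = Ψ := by
  refine eq_of_bra_eq (cspan_range_ketTwo h) ?_
  rintro _ ⟨p, rfl⟩ y
  rw [← adjoint_inner_right, ← adjoint_inner_right]
  exact congrArg _ (DFunLike.congr_fun (hΦ p.1) y)

theorem inner_ketOne (h : Linked α β) (ξ ξ' : α) (k k' : K) :
    inner ℂ (ketOne α β ξ k) (ketOne α β ξ' k') =
      inner ℂ k (rho β (adjoint (ξ : 𝔥 →L[ℂ] H) ∘L (ξ' : 𝔥 →L[ℂ] H)) k') := by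
  rw [← adjoint_inner_right, ← comp_apply]
  refine congrArg _ (DFunLike.congr_fun (?_ : _ = _) k')
  refine eq_of_bra_eq h.right ?_
  rintro _ ⟨η, hη, ζ, -, rfl⟩ y
  rw [comp_apply, adjoint_inner_right]
  have : innerSL ℂ (adjoint (ketOne α β ξ') (ketOne α β ξ (η ζ))) =
      innerSL ℂ (adjoint (rho β (adjoint (ξ : 𝔥 →L[ℂ] H) ∘L (ξ' : 𝔥 →L[ℂ] H))) (η ζ)) := by
    refine ext_of_vecSpan_eq_top h.right fun η' hη' ζ' => ?_
    rw [innerSL_apply_apply, innerSL_apply_apply, adjoint_inner_left, adjoint_inner_left,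
      ketOne_apply h ξ ⟨η, hη⟩, ketOne_apply h ξ' ⟨η', hη'⟩, h.inner_tmul,
      rho_apply h.right (h.commutesInner ξ ξ') hη']
    rfl
  have := DFunLike.congr_fun this y
  rwa [innerSL_apply_apply, innerSL_apply_apply, adjoint_inner_left, adjoint_inner_left] at this

/-- Together with the mixed relation `adjoint_ketOne_comp_ketTwo`, this reduces every composite of a
bra with a ket to operators on the factors; later proofs use the completed inner product only
through these relations. -/
theorem adjoint_ketOne_comp (h : Linked α β) (ξ ξ' : α) :
    adjoint (ketOne α β ξ) ∘L ketOne α β ξ' =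
      rho β (adjoint (ξ : 𝔥 →L[ℂ] H) ∘L (ξ' : 𝔥 →L[ℂ] H)) := by
  ext k
  refine ext_inner_left ℂ fun v => ?_
  rw [comp_apply, adjoint_inner_right, inner_ketOne h]

theorem adjoint_ketTwo_comp (h : Linked α β) (η η' : β) :
    adjoint (ketTwo α β η) ∘L ketTwo α β η' =
      rho α (adjoint (η : 𝔥 →L[ℂ] K) ∘L (η' : 𝔥 →L[ℂ] K)) := by
  rw [← flip_comp_ketOne h.symm, ← flip_comp_ketOne h.symm, adjoint_comp, comp_assoc,
    ← comp_assoc _ (flip β α), (isUnitaryMap_flip h.symm).1, id_comp,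
    adjoint_ketOne_comp h.symm]

theorem inner_ketTwo (h : Linked α β) (η η' : β) (k k' : H) :
    inner ℂ (ketTwo α β η k) (ketTwo α β η' k') =
      inner ℂ k (rho α (adjoint (η : 𝔥 →L[ℂ] K) ∘L (η' : 𝔥 →L[ℂ] K)) k') := by
  rw [← adjoint_inner_right, ← comp_apply, adjoint_ketTwo_comp h]

theorem adjoint_ketOne_comp_ketTwo (h : Linked α β) (ξ : α) (η : β) :
    adjoint (ketOne α β ξ) ∘L ketTwo α β η =
      (η : 𝔥 →L[ℂ] K) ∘L adjoint (ξ : 𝔥 →L[ℂ] H) := by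
  refine ext_of_vecSpan_eq_top h.left fun ξ' hξ' ζ => ?_
  rw [comp_apply, ketTwo_apply h ⟨ξ', hξ'⟩, ← ketOne_apply h, ← comp_apply (adjoint _),
    adjoint_ketOne_comp h, rho_apply h.right (h.commutesInner _ _) η.2]
  rfl

theorem adjoint_ketTwo_comp_ketOne (h : Linked α β) (ξ : α) (η : β) :
    adjoint (ketTwo α β η) ∘L ketOne α β ξ =
      (ξ : 𝔥 →L[ℂ] H) ∘L adjoint (η : 𝔥 →L[ℂ] K) := by
  rw [← adjoint_adjoint (adjoint (ketTwo α β η) ∘L ketOne α β ξ), adjoint_comp, adjoint_adjoint,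
    adjoint_ketOne_comp_ketTwo h, adjoint_comp, adjoint_adjoint]

end Kets

/-! ### The operators 1 ⊗ T and S ⊗ 1 -/

section Legs

set_option linter.unusedSectionVars false

variable {𝔥 𝔨 H K L M N : Type*}
  [NormedAddCommGroup 𝔥] [InnerProductSpace ℂ 𝔥] [CompleteSpace 𝔥]
  [NormedAddCommGroup 𝔨] [InnerProductSpace ℂ 𝔨] [CompleteSpace 𝔨]
  [NormedAddCommGroup H] [InnerProductSpace ℂ H] [CompleteSpace H]
  [NormedAddCommGroup K] [InnerProductSpace ℂ K] [CompleteSpace K]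
  [NormedAddCommGroup L] [InnerProductSpace ℂ L] [CompleteSpace L]
  [NormedAddCommGroup M] [InnerProductSpace ℂ M] [CompleteSpace M]
  {α : OpSpace 𝔥 H} {β : OpSpace 𝔥 K} {γ : OpSpace 𝔥 L}
  {δ : OpSpace 𝔥 M}

/-- `T` intertwines `ρ_β(ξ* ξ')` and `ρ_γ(ξ* ξ')` for all `ξ`, `ξ'` in `α`. -/
def Intw (α : OpSpace 𝔥 H) (β : OpSpace 𝔥 K)
    (γ : OpSpace 𝔥 L) (T : K →L[ℂ] L) : Prop :=
  ∀ ξ ξ' : α, T ∘L rho β (adjoint (ξ : 𝔥 →L[ℂ] H) ∘L (ξ' : 𝔥 →L[ℂ] H)) =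
    rho γ (adjoint (ξ : 𝔥 →L[ℂ] H) ∘L (ξ' : 𝔥 →L[ℂ] H)) ∘L T

/-- The representations ρ act by inserting x between η and ζ, on the far side from T, so any T that
respects the operator spaces commutes past them. -/
theorem rho_intertwine (hβ : vecSpan (β : Set (𝔥 →L[ℂ] K)) = ⊤)
    (hγ : vecSpan (γ : Set (𝔥 →L[ℂ] L)) = ⊤) {T : K →L[ℂ] L} (hT : ∀ η ∈ β, T ∘L η ∈ γ)
    {x : 𝔥 →L[ℂ] 𝔥} (hx : CommutesInner β x) (hx' : CommutesInner γ x) :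
    T ∘L rho β x = rho γ x ∘L T := by
  refine ext_of_vecSpan_eq_top hβ fun η hη ζ => ?_
  have := rho_apply hγ hx' (hT η hη) ζ
  rw [comp_apply, comp_apply, rho_apply hβ hx hη]
  exact this.symm

theorem Intw.of_maps (h : Linked α β) (h' : Linked α γ) {T : K →L[ℂ] L}
    (hT : ∀ η ∈ β, T ∘L η ∈ γ) : Intw α β γ T := fun ξ ξ' =>
  rho_intertwine h.right h'.right hT (h.commutesInner ξ ξ') (h'.commutesInner ξ ξ')

theorem Intw.comp {S : L →L[ℂ] M} {T : K →L[ℂ] L} (hS : Intw α γ δ S) (hT : Intw α β γ T) :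
    Intw α β δ (S ∘L T) := fun ξ ξ' => by
  rw [comp_assoc, hT, ← comp_assoc, hS, comp_assoc]

/-- The adjoint of ξ*ξ' is ξ'*ξ, again an inner product of α, so the family of intertwining
relations is closed under taking adjoints. -/
theorem Intw.adjoint (h : Linked α β) (h' : Linked α γ) {T : K →L[ℂ] L} (hT : Intw α β γ T) :
    Intw α γ β (adjoint T) := fun ξ ξ' => by
  have h1 := congrArg ContinuousLinearMap.adjoint (hT ξ' ξ)
  rw [adjoint_comp, adjoint_comp, inner_rho h.right (h.commutesInner _ _),
    inner_rho h'.right (h'.commutesInner _ _), adjoint_comp, adjoint_adjoint] at h1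
  exact h1.symm

/-- T and T* both intertwine, so T*T commutes with every ρ_β(ξ*ξ'), and therefore so does the square
root y of ‖T‖² - T*T. Hence the vectors ξ ⊗ yk form the residual family. -/
theorem exists_legTwo (h : Linked α β) (h' : Linked α γ) {T : K →L[ℂ] L} (hT : Intw α β γ T) :
    ∃ R : RelTensor α β →L[ℂ] RelTensor α γ,
      (∀ ξ, R ∘L ketOne α β ξ = ketOne α γ ξ ∘L T) ∧ ‖R‖ ≤ ‖T‖ := by
  obtain ⟨y, hy1, hy2, hy3⟩ := exists_defect T
  obtain ⟨R, hR, hR'⟩ := exists_clm_of_gram (C := ‖T‖) (norm_nonneg T)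
    (f := fun p : α × K => ketOne α β p.1 p.2)
    (g := fun p : α × K => ketOne α γ p.1 (T p.2))
    (r := fun p : α × K => ketOne α β p.1 (y p.2)) (cspan_range_ketOne h) (by
      intro p q
      have hc : ∀ u, rho β (ContinuousLinearMap.adjoint (p.1 : 𝔥 →L[ℂ] H) ∘L
            (q.1 : 𝔥 →L[ℂ] H)) (ContinuousLinearMap.adjoint T (T u)) =
          ContinuousLinearMap.adjoint T (T (rho β (ContinuousLinearMap.adjoint
            (p.1 : 𝔥 →L[ℂ] H) ∘L (q.1 : 𝔥 →L[ℂ] H)) u)) := fun u =>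
        (DFunLike.congr_fun (((hT.adjoint h h').comp hT) p.1 q.1) u).symm
      have e2 : ∀ u v, inner ℂ (y u) v = inner ℂ u (y v) := fun u v => by
        rw [← adjoint_inner_left, hy1]
      have e3 : rho γ (ContinuousLinearMap.adjoint (p.1 : 𝔥 →L[ℂ] H) ∘L
          (q.1 : 𝔥 →L[ℂ] H)) (T q.2) = T (rho β (ContinuousLinearMap.adjoint
            (p.1 : 𝔥 →L[ℂ] H) ∘L (q.1 : 𝔥 →L[ℂ] H)) q.2) :=
        (DFunLike.congr_fun (hT p.1 q.1) q.2).symm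
      rw [inner_ketOne h, inner_ketOne h', inner_ketOne h, e2, ← hy3 _ hc, hy2, e3,
        inner_sub_right, inner_smul_right, adjoint_inner_right]
      ring)
  exact ⟨R, fun ξ => ContinuousLinearMap.ext fun k => hR (ξ, k), hR'⟩

theorem legTwo_eq (h : Linked α β) {T : K →L[ℂ] L} {R : RelTensor α β →L[ℂ] RelTensor α γ}
    (hR : ∀ ξ, R ∘L ketOne α β ξ = ketOne α γ ξ ∘L T) : legTwo α β γ T = R := by
  have hR' : ∀ ξ k, R (ketOne α β ξ k) = ketOne α γ ξ (T k) := fun ξ k =>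
    DFunLike.congr_fun (hR ξ) k
  have e : ∀ ξ k, legTwo α β γ T (ketOne α β ξ k) = ketOne α γ ξ (T k) := fun ξ k => by
    refine opOf_apply R ?_ ⟨ξ, ξ, k, rfl, rfl⟩
    rintro _ ⟨ξ, ξ', k, hξ, rfl⟩
    obtain rfl : ξ' = ξ := Subtype.ext hξ
    exact hR' ξ' k
  exact ext_ketOne h fun ξ => ContinuousLinearMap.ext fun k => (e ξ k).trans (hR' ξ k).symm

theorem legTwo_comp_ketOne (h : Linked α β) (h' : Linked α γ) {T : K →L[ℂ] L}
    (hT : Intw α β γ T) (ξ : α) : legTwo α β γ T ∘L ketOne α β ξ = ketOne α γ ξ ∘L T := by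
  obtain ⟨R, hR, -⟩ := exists_legTwo h h' hT
  rw [legTwo_eq h hR, hR]

theorem norm_legTwo_le (h : Linked α β) (h' : Linked α γ) {T : K →L[ℂ] L}
    (hT : Intw α β γ T) : ‖legTwo α β γ T‖ ≤ ‖T‖ := by
  obtain ⟨R, hR, hR'⟩ := exists_legTwo h h' hT
  rwa [legTwo_eq h hR]

theorem legTwo_comp_ketTwo (h : Linked α β) (h' : Linked α γ) {T : K →L[ℂ] L}
    (hT : Intw α β γ T) {η : β} {η' : γ}
    (hη : (η' : 𝔥 →L[ℂ] L) = T ∘L (η : 𝔥 →L[ℂ] K)) :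
    legTwo α β γ T ∘L ketTwo α β η = ketTwo α γ η' := by
  refine ext_of_vecSpan_eq_top h.left fun ξ hξ ζ => ?_
  rw [comp_apply, ketTwo_apply h ⟨ξ, hξ⟩, ketTwo_apply h' ⟨ξ, hξ⟩, ← ketOne_apply h,
    ← ketOne_apply h', hη, ← comp_apply, legTwo_comp_ketOne h h' hT]
  rfl

theorem legTwo_id (h : Linked α β) :
    legTwo α β β (ContinuousLinearMap.id ℂ K) = ContinuousLinearMap.id ℂ _ :=
  legTwo_eq h fun ξ => by rw [id_comp, comp_id]

theorem legTwo_comp (h : Linked α β) (h' : Linked α γ) (h'' : Linked α δ) {S : L →L[ℂ] M}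
    {T : K →L[ℂ] L} (hS : Intw α γ δ S) (hT : Intw α β γ T) :
    legTwo α β δ (S ∘L T) = legTwo α γ δ S ∘L legTwo α β γ T :=
  legTwo_eq h fun ξ => by
    rw [comp_assoc, legTwo_comp_ketOne h h' hT, ← comp_assoc, legTwo_comp_ketOne h' h'' hS,
      comp_assoc]

theorem adjoint_legTwo (h : Linked α β) (h' : Linked α γ) {T : K →L[ℂ] L}
    (hT : Intw α β γ T) : adjoint (legTwo α β γ T) = legTwo α γ β (adjoint T) := by
  refine (legTwo_eq h' fun ξ => ext_braOne h fun ξ' => ?_).symm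
  rw [← comp_assoc, ← adjoint_comp, legTwo_comp_ketOne h h' hT, adjoint_comp, comp_assoc,
    adjoint_ketOne_comp h', ← comp_assoc, adjoint_ketOne_comp h]
  exact hT.adjoint h h' ξ' ξ

theorem legTwo_add (h : Linked α β) (h' : Linked α γ) {S T : K →L[ℂ] L}
    (hS : Intw α β γ S) (hT : Intw α β γ T) :
    legTwo α β γ (S + T) = legTwo α β γ S + legTwo α β γ T :=
  legTwo_eq h fun ξ => by
    rw [add_comp, legTwo_comp_ketOne h h' hS, legTwo_comp_ketOne h h' hT, comp_add]

theorem legTwo_smul (h : Linked α β) (h' : Linked α γ) (c : ℂ) {T : K →L[ℂ] L}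
    (hT : Intw α β γ T) : legTwo α β γ (c • T) = c • legTwo α β γ T :=
  legTwo_eq h fun ξ => by rw [smul_comp, legTwo_comp_ketOne h h' hT, comp_smul]

theorem legOne_eq (h : Linked β α) {T : K →L[ℂ] L} {R : RelTensor β α →L[ℂ] RelTensor γ α}
    (hR : ∀ ξ, R ∘L ketTwo β α ξ = ketTwo γ α ξ ∘L T) : legOne β γ α T = R := by
  have hR' : ∀ ξ k, R (ketTwo β α ξ k) = ketTwo γ α ξ (T k) := fun ξ k =>
    DFunLike.congr_fun (hR ξ) k
  have e : ∀ ξ k, legOne β γ α T (ketTwo β α ξ k) = ketTwo γ α ξ (T k) := fun ξ k => by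
    refine opOf_apply R ?_ ⟨ξ, ξ, k, rfl, rfl⟩
    rintro _ ⟨ξ, ξ', k, hξ, rfl⟩
    obtain rfl : ξ' = ξ := Subtype.ext hξ
    exact hR' ξ' k
  exact ext_ketTwo h fun ξ => ContinuousLinearMap.ext fun k => (e ξ k).trans (hR' ξ k).symm

/-- Existence and most rules for `legOne` are inherited from `legTwo` through this conjugation. -/
theorem legOne_eq_flip (h : Linked β α) (h' : Linked γ α) {T : K →L[ℂ] L} (hT : Intw α β γ T) :
    legOne β γ α T = flip α γ ∘L legTwo α β γ T ∘L flip β α :=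
  legOne_eq h fun ξ => by
    rw [comp_assoc, comp_assoc, flip_comp_ketTwo h, legTwo_comp_ketOne h.symm h'.symm hT,
      ← comp_assoc, flip_comp_ketOne h'.symm]

theorem legOne_comp_ketTwo (h : Linked β α) (h' : Linked γ α) {T : K →L[ℂ] L}
    (hT : Intw α β γ T) (ξ : α) : legOne β γ α T ∘L ketTwo β α ξ = ketTwo γ α ξ ∘L T := by
  rw [legOne_eq_flip h h' hT, comp_assoc, comp_assoc, flip_comp_ketTwo h,
    legTwo_comp_ketOne h.symm h'.symm hT, ← comp_assoc, flip_comp_ketOne h'.symm]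

theorem legOne_comp_ketOne (h : Linked β α) (h' : Linked γ α) {T : K →L[ℂ] L}
    (hT : Intw α β γ T) {η : β} {η' : γ}
    (hη : (η' : 𝔥 →L[ℂ] L) = T ∘L (η : 𝔥 →L[ℂ] K)) :
    legOne β γ α T ∘L ketOne β α η = ketOne γ α η' := by
  rw [legOne_eq_flip h h' hT, comp_assoc, comp_assoc, flip_comp_ketOne h,
    legTwo_comp_ketTwo h.symm h'.symm hT hη, flip_comp_ketTwo h'.symm]

theorem legOne_comp (h : Linked β α) (h' : Linked γ α) (h'' : Linked δ α) {S : L →L[ℂ] M}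
    {T : K →L[ℂ] L} (hS : Intw α γ δ S) (hT : Intw α β γ T) :
    legOne β δ α (S ∘L T) = legOne γ δ α S ∘L legOne β γ α T :=
  legOne_eq h fun ξ => by
    rw [comp_assoc, legOne_comp_ketTwo h h' hT, ← comp_assoc, legOne_comp_ketTwo h' h'' hS,
      comp_assoc]

theorem adjoint_legOne (h : Linked β α) (h' : Linked γ α) {T : K →L[ℂ] L}
    (hT : Intw α β γ T) : adjoint (legOne β γ α T) = legOne γ β α (adjoint T) := by
  rw [legOne_eq_flip h h' hT, legOne_eq_flip h' h (hT.adjoint h.symm h'.symm), adjoint_comp,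
    adjoint_comp, adjoint_flip h, adjoint_flip h'.symm, adjoint_legTwo h.symm h'.symm hT,
    comp_assoc]

/-- Tested against a ket |ξ'⟩₁, this is the intertwining relation for ξ*ξ'. Bras, like kets, may
thus be moved past an operator that acts on the other leg; this is what makes slicing of diagrams
possible. -/
theorem braOne_comp_legTwo (h : Linked α β) (h' : Linked α γ) {T : K →L[ℂ] L}
    (hT : Intw α β γ T) (ξ : α) :
    adjoint (ketOne α γ ξ) ∘L legTwo α β γ T = T ∘L adjoint (ketOne α β ξ) := by
  refine ext_ketOne h fun ξ' => ?_
  rw [comp_assoc, legTwo_comp_ketOne h h' hT, ← comp_assoc, adjoint_ketOne_comp h', comp_assoc,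
    adjoint_ketOne_comp h]
  exact (hT ξ ξ').symm

theorem braTwo_comp_legOne (h : Linked β α) (h' : Linked γ α) {T : K →L[ℂ] L}
    (hT : Intw α β γ T) (ξ : α) :
    adjoint (ketTwo γ α ξ) ∘L legOne β γ α T = T ∘L adjoint (ketTwo β α ξ) := by
  refine ext_ketTwo h fun ξ' => ?_
  rw [comp_assoc, legOne_comp_ketTwo h h' hT, ← comp_assoc, adjoint_ketTwo_comp h', comp_assoc,
    adjoint_ketTwo_comp h]
  exact (hT ξ ξ').symm

end Legs

/-! ### Threefold relative tensor products -/

section Chains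

set_option linter.unusedSectionVars false

variable {𝔥 𝔨 H K L : Type*}
  [NormedAddCommGroup 𝔥] [InnerProductSpace ℂ 𝔥] [CompleteSpace 𝔥]
  [NormedAddCommGroup 𝔨] [InnerProductSpace ℂ 𝔨] [CompleteSpace 𝔨]
  [NormedAddCommGroup H] [InnerProductSpace ℂ H] [CompleteSpace H]
  [NormedAddCommGroup K] [InnerProductSpace ℂ K] [CompleteSpace K]
  [NormedAddCommGroup L] [InnerProductSpace ℂ L] [CompleteSpace L]
  {α : OpSpace 𝔥 H} {β : OpSpace 𝔥 K} {γ : OpSpace 𝔨 K}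
  {δ : OpSpace 𝔨 L}

/-- The relation is extended from S to its closed span one variable at a time. Taking adjoints
exchanges the two variables, so each extension takes place in the variable that enters linearly. -/
theorem commutesInner_cspan {S : Set (𝔥 →L[ℂ] H)} {x : 𝔥 →L[ℂ] 𝔥}
    (h : ∀ s ∈ S, ∀ s' ∈ S, x ∘L adjoint s ∘L s' = (adjoint s ∘L s') ∘L x) :
    CommutesInner (cspan S) x := by
  have h1 : ∀ s ∈ S, ∀ t ∈ cspan S, x ∘L adjoint s ∘L t = (adjoint s ∘L t) ∘L x := by
    intro s hs t ht
    exact eq_of_mem_cspan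
      (compL ℂ 𝔥 𝔥 𝔥 x ∘L compL ℂ 𝔥 H 𝔥 (adjoint s))
      ((compL ℂ 𝔥 𝔥 𝔥).flip x ∘L compL ℂ 𝔥 H 𝔥 (adjoint s)) (h s hs) ht
  have h2 : ∀ t ∈ cspan S, ∀ s ∈ S, (adjoint t ∘L s) ∘L adjoint x = adjoint x ∘L adjoint t ∘L s := by
    intro t ht s hs
    have := congrArg adjoint (h1 s hs t ht)
    simpa only [adjoint_comp, adjoint_adjoint, comp_assoc] using this
  have h3 : ∀ t ∈ cspan S, ∀ t' ∈ cspan S,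
      (adjoint t ∘L t') ∘L adjoint x = adjoint x ∘L adjoint t ∘L t' := by
    intro t ht t' ht'
    exact eq_of_mem_cspan
      ((compL ℂ 𝔥 𝔥 𝔥).flip (adjoint x) ∘L compL ℂ 𝔥 H 𝔥 (adjoint t))
      (compL ℂ 𝔥 𝔥 𝔥 (adjoint x) ∘L compL ℂ 𝔥 H 𝔥 (adjoint t)) (h2 t ht) ht'
  intro t ht t' ht' ζ
  have := congrArg adjoint (h3 t' ht' t ht)
  rw [adjoint_comp, adjoint_comp, adjoint_comp, adjoint_comp, adjoint_adjoint,
    adjoint_adjoint] at this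
  exact DFunLike.congr_fun this ζ

/-- `α` and `β` are linked, and the operators `ρ_β(ξ* ξ')` with `ξ`, `ξ'` in `α` map `γ` to
itself. -/
def Acts (α : OpSpace 𝔥 H) (β : OpSpace 𝔥 K)
    (γ : OpSpace 𝔨 K) : Prop :=
  Linked α β ∧
  (∀ ξ ξ' : α, ∀ c ∈ γ,
    rho β (adjoint (ξ : 𝔥 →L[ℂ] H) ∘L (ξ' : 𝔥 →L[ℂ] H)) ∘L c ∈ γ) ∧
  vecSpan (γ : Set (𝔨 →L[ℂ] K)) = ⊤

theorem Acts.linked (h : Acts α β γ) : Linked α β := h.1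

theorem Acts.map (h : Acts α β γ) (ξ ξ' : α) (c : 𝔨 →L[ℂ] K) (hc : c ∈ γ) :
    rho β (adjoint (ξ : 𝔥 →L[ℂ] H) ∘L (ξ' : 𝔥 →L[ℂ] H)) ∘L c ∈ γ := h.2.1 ξ ξ' c hc

theorem Acts.total (h : Acts α β γ) : vecSpan (γ : Set (𝔨 →L[ℂ] K)) = ⊤ := h.2.2

theorem ketOne_comp_mem (ξ : α) {c : 𝔨 →L[ℂ] K} (hc : c ∈ γ) :
    ketOne α β ξ ∘L c ∈ rightTri α β γ :=
  comp_mem_opProd ⟨ξ, rfl⟩ hc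

theorem ketTwo_comp_mem (ξ : α) {c : 𝔨 →L[ℂ] K} (hc : c ∈ γ) :
    ketTwo β α ξ ∘L c ∈ leftTri β α γ :=
  comp_mem_opProd ⟨ξ, rfl⟩ hc

/-- On generators, (|ξ⟩₁c)*(|ξ'⟩₁c') = c*(ρ_β(ξ*ξ')c'), and the bracket lies in γ again. So the new
inner products are inner products of γ. -/
theorem Acts.commutesInner_rightTri (h : Acts α β γ) {x : 𝔨 →L[ℂ] 𝔨} (hx : CommutesInner γ x) :
    CommutesInner (rightTri α β γ) x := by
  refine commutesInner_cspan ?_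
  rintro _ ⟨_, ⟨ξ, rfl⟩, c, hc, rfl⟩ _ ⟨_, ⟨ξ', rfl⟩, c', hc', rfl⟩
  have e : adjoint (ketOne α β ξ ∘L c) ∘L (ketOne α β ξ' ∘L c') = adjoint c ∘L
      rho β (adjoint (ξ : 𝔥 →L[ℂ] H) ∘L (ξ' : 𝔥 →L[ℂ] H)) ∘L c' := by
    rw [adjoint_comp, comp_assoc, ← comp_assoc _ _ c', adjoint_ketOne_comp h.linked]
  simp only [e]
  exact ContinuousLinearMap.ext fun ζ => hx c hc _ (h.map ξ ξ' c' hc') ζ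

theorem Acts.commutesInner_leftTri (h : Acts α β γ) {x : 𝔨 →L[ℂ] 𝔨} (hx : CommutesInner γ x) :
    CommutesInner (leftTri β α γ) x := by
  refine commutesInner_cspan ?_
  rintro _ ⟨_, ⟨ξ, rfl⟩, c, hc, rfl⟩ _ ⟨_, ⟨ξ', rfl⟩, c', hc', rfl⟩
  have e : adjoint (ketTwo β α ξ ∘L c) ∘L (ketTwo β α ξ' ∘L c') = adjoint c ∘L
      rho β (adjoint (ξ : 𝔥 →L[ℂ] H) ∘L (ξ' : 𝔥 →L[ℂ] H)) ∘L c' := by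
    rw [adjoint_comp, comp_assoc, ← comp_assoc _ _ c', adjoint_ketTwo_comp h.linked.symm]
  simp only [e]
  exact ContinuousLinearMap.ext fun ζ => hx c hc _ (h.map ξ ξ' c' hc') ζ

theorem Acts.vecSpan_rightTri (h : Acts α β γ) :
    vecSpan (rightTri α β γ : Set (𝔨 →L[ℂ] RelTensor α β)) = ⊤ := by
  refine top_le_iff.1 (cspan_range_ketOne h.linked ▸ cspan_le (isClosed_cspan _) ?_)
  rintro _ ⟨⟨ξ, k⟩, rfl⟩
  refine map_mem_of_mem_cspan (ketOne α β ξ) (isClosed_cspan _) ?_ (h.total ▸ Submodule.mem_top)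
  rintro _ ⟨c, hc, ζ, -, rfl⟩
  exact apply_mem_vecSpan (ketOne_comp_mem ξ hc) ζ

theorem Acts.vecSpan_leftTri (h : Acts α β γ) :
    vecSpan (leftTri β α γ : Set (𝔨 →L[ℂ] RelTensor β α)) = ⊤ := by
  refine top_le_iff.1 (cspan_range_ketTwo h.linked.symm ▸ cspan_le (isClosed_cspan _) ?_)
  rintro _ ⟨⟨ξ, k⟩, rfl⟩
  refine map_mem_of_mem_cspan (ketTwo β α ξ) (isClosed_cspan _) ?_ (h.total ▸ Submodule.mem_top)
  rintro _ ⟨c, hc, ζ, -, rfl⟩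
  exact apply_mem_vecSpan (ketTwo_comp_mem ξ hc) ζ

/-- The representation attached to α ▷ γ acts on the second leg alone, which lets it move past
first-leg kets. -/
theorem Acts.rho_rightTri (h : Acts α β γ) {x : 𝔨 →L[ℂ] 𝔨} (hx : CommutesInner γ x) (ξ : α) :
    rho (rightTri α β γ) x ∘L ketOne α β ξ = ketOne α β ξ ∘L rho γ x :=
  ext_of_vecSpan_eq_top h.total fun c hc ζ => by
    have := rho_apply h.vecSpan_rightTri (h.commutesInner_rightTri hx)
      (ketOne_comp_mem (β := β) ξ hc) ζ
    rw [comp_apply, comp_apply, rho_apply h.total hx hc]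
    exact this

theorem Acts.rho_leftTri (h : Acts α β γ) {x : 𝔨 →L[ℂ] 𝔨} (hx : CommutesInner γ x) (ξ : α) :
    rho (leftTri β α γ) x ∘L ketTwo β α ξ = ketTwo β α ξ ∘L rho γ x :=
  ext_of_vecSpan_eq_top h.total fun c hc ζ => by
    have := rho_apply h.vecSpan_leftTri (h.commutesInner_leftTri hx)
      (ketTwo_comp_mem (β := β) ξ hc) ζ
    rw [comp_apply, comp_apply, rho_apply h.total hx hc]
    exact this

/-- `β` and `γ` are compatible, `β` is linked with `α`, and `γ` is linked with `δ`. -/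
def Chain (α : OpSpace 𝔥 H) (β : OpSpace 𝔥 K)
    (γ : OpSpace 𝔨 K) (δ : OpSpace 𝔨 L) : Prop :=
  Acts α β γ ∧ Acts δ γ β

theorem Chain.left (h : Chain α β γ δ) : Acts α β γ := h.1

theorem Chain.right (h : Chain α β γ δ) : Acts δ γ β := h.2

theorem Chain.symm (h : Chain α β γ δ) : Chain δ γ β α := ⟨h.right, h.left⟩

theorem Linked.of_commutesInner (hα : vecSpan (α : Set (𝔥 →L[ℂ] H)) = ⊤)
    (hβ : vecSpan (β : Set (𝔥 →L[ℂ] K)) = ⊤)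
    (h : ∀ η η' : β, CommutesInner α (adjoint (η : 𝔥 →L[ℂ] K) ∘L (η' : 𝔥 →L[ℂ] K))) :
    Linked α β :=
  ⟨fun ξ hξ ξ' hξ' η hη η' hη' =>
    ContinuousLinearMap.ext fun ζ => (h ⟨η, hη⟩ ⟨η', hη'⟩ ξ hξ ξ' hξ' ζ).symm, hα, hβ⟩

theorem Chain.linked_rightTri (h : Chain α β γ δ) : Linked (rightTri α β γ) δ :=
  .of_commutesInner h.left.vecSpan_rightTri h.right.linked.left fun η η' =>
    h.left.commutesInner_rightTri (h.right.linked.commutesInner η η')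

theorem Chain.linked_leftTri (h : Chain α β γ δ) : Linked (leftTri β α γ) δ :=
  .of_commutesInner h.left.vecSpan_leftTri h.right.linked.left fun η η' =>
    h.left.commutesInner_leftTri (h.right.linked.commutesInner η η')

theorem Chain.linked_leftTri' (h : Chain α β γ δ) : Linked α (leftTri γ δ β) :=
  h.symm.linked_leftTri.symm

/-- The operator ρ_β(ξ*ξ') maps γ to itself, hence intertwines ρ_γ with itself. -/
theorem Chain.rho_comm (h : Chain α β γ δ) (ξ ξ' : α) (η η' : δ) (k : K) :
    rho β (adjoint (ξ : 𝔥 →L[ℂ] H) ∘L (ξ' : 𝔥 →L[ℂ] H))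
        (rho γ (adjoint (η : 𝔨 →L[ℂ] L) ∘L (η' : 𝔨 →L[ℂ] L)) k) =
      rho γ (adjoint (η : 𝔨 →L[ℂ] L) ∘L (η' : 𝔨 →L[ℂ] L))
        (rho β (adjoint (ξ : 𝔥 →L[ℂ] H) ∘L (ξ' : 𝔥 →L[ℂ] H)) k) :=
  DFunLike.congr_fun (rho_intertwine h.left.total h.left.total (h.left.map ξ ξ')
    (h.right.linked.commutesInner η η') (h.right.linked.commutesInner η η')) k

/-- All three ways of forming the threefold tensor product have the same Gram matrix on the vectors
labelled by (ξ, k, η). Hence `assoc`, `assocInv` and `flipLast` exist and preserve inner products.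
-/
theorem Chain.inner_right (h : Chain α β γ δ) (ξ ξ' : α) (η η' : δ) (k k' : K) :
    inner ℂ (ketTwo (rightTri α β γ) δ η (ketOne α β ξ k))
        (ketTwo (rightTri α β γ) δ η' (ketOne α β ξ' k')) =
      inner ℂ k (rho β (adjoint (ξ : 𝔥 →L[ℂ] H) ∘L (ξ' : 𝔥 →L[ℂ] H))
        (rho γ (adjoint (η : 𝔨 →L[ℂ] L) ∘L (η' : 𝔨 →L[ℂ] L)) k')) := by
  rw [inner_ketTwo h.linked_rightTri, ← comp_apply (rho _ _),
    h.left.rho_rightTri (h.right.linked.commutesInner η η'), comp_apply,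
    inner_ketOne h.left.linked]

theorem Chain.inner_left (h : Chain α β γ δ) (ξ ξ' : α) (η η' : δ) (k k' : K) :
    inner ℂ (ketTwo (leftTri β α γ) δ η (ketTwo β α ξ k))
        (ketTwo (leftTri β α γ) δ η' (ketTwo β α ξ' k')) =
      inner ℂ k (rho β (adjoint (ξ : 𝔥 →L[ℂ] H) ∘L (ξ' : 𝔥 →L[ℂ] H))
        (rho γ (adjoint (η : 𝔨 →L[ℂ] L) ∘L (η' : 𝔨 →L[ℂ] L)) k')) := by
  rw [inner_ketTwo h.linked_leftTri, ← comp_apply (rho _ _),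
    h.left.rho_leftTri (h.right.linked.commutesInner η η'), comp_apply,
    inner_ketTwo h.left.linked.symm]

theorem Chain.inner_left' (h : Chain α β γ δ) (ξ ξ' : α) (η η' : δ) (k k' : K) :
    inner ℂ (ketOne α (leftTri γ δ β) ξ (ketTwo γ δ η k))
        (ketOne α (leftTri γ δ β) ξ' (ketTwo γ δ η' k')) =
      inner ℂ k (rho β (adjoint (ξ : 𝔥 →L[ℂ] H) ∘L (ξ' : 𝔥 →L[ℂ] H))
        (rho γ (adjoint (η : 𝔨 →L[ℂ] L) ∘L (η' : 𝔨 →L[ℂ] L)) k')) := by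
  rw [inner_ketOne h.linked_leftTri', ← comp_apply (rho _ _),
    h.right.rho_leftTri (h.left.linked.commutesInner ξ ξ'), comp_apply,
    inner_ketTwo h.right.linked.symm, h.rho_comm]

theorem Chain.cspan_right (h : Chain α β γ δ) :
    cspan (Set.range fun p : α × K × δ =>
      ketTwo (rightTri α β γ) δ p.2.2 (ketOne α β p.1 p.2.1)) = ⊤ := by
  refine top_le_iff.1 (cspan_range_ketTwo h.linked_rightTri ▸ cspan_le (isClosed_cspan _) ?_)
  rintro _ ⟨⟨η, v⟩, rfl⟩
  refine map_mem_of_mem_cspan (ketTwo _ δ η) (isClosed_cspan _) ?_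
    (cspan_range_ketOne h.left.linked ▸ Submodule.mem_top)
  rintro _ ⟨⟨ξ, k⟩, rfl⟩
  exact subset_cspan _ ⟨(ξ, k, η), rfl⟩

theorem Chain.cspan_left (h : Chain α β γ δ) :
    cspan (Set.range fun p : α × K × δ =>
      ketTwo (leftTri β α γ) δ p.2.2 (ketTwo β α p.1 p.2.1)) = ⊤ := by
  refine top_le_iff.1 (cspan_range_ketTwo h.linked_leftTri ▸ cspan_le (isClosed_cspan _) ?_)
  rintro _ ⟨⟨η, v⟩, rfl⟩
  refine map_mem_of_mem_cspan (ketTwo _ δ η) (isClosed_cspan _) ?_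
    (cspan_range_ketTwo h.left.linked.symm ▸ Submodule.mem_top)
  rintro _ ⟨⟨ξ, k⟩, rfl⟩
  exact subset_cspan _ ⟨(ξ, k, η), rfl⟩

theorem Chain.cspan_left' (h : Chain α β γ δ) :
    cspan (Set.range fun p : α × K × δ =>
      ketOne α (leftTri γ δ β) p.1 (ketTwo γ δ p.2.2 p.2.1)) = ⊤ := by
  refine top_le_iff.1 (cspan_range_ketOne h.linked_leftTri' ▸ cspan_le (isClosed_cspan _) ?_)
  rintro _ ⟨⟨ξ, v⟩, rfl⟩
  refine map_mem_of_mem_cspan (ketOne α _ ξ) (isClosed_cspan _) ?_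
    (cspan_range_ketTwo h.right.linked.symm ▸ Submodule.mem_top)
  rintro _ ⟨⟨η, k⟩, rfl⟩
  exact subset_cspan _ ⟨(ξ, k, η), rfl⟩

theorem Chain.assoc_apply (h : Chain α β γ δ) (ξ : α) (k : K) (η : δ) :
    assoc α β γ δ (ketTwo (rightTri α β γ) δ η (ketOne α β ξ k)) =
      ketOne α (leftTri γ δ β) ξ (ketTwo γ δ η k) := by
  obtain ⟨T, hT⟩ := exists_clm_of_gram_eq
    (f := fun p : α × K × δ => ketTwo (rightTri α β γ) δ p.2.2 (ketOne α β p.1 p.2.1))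
    (g := fun p : α × K × δ => ketOne α (leftTri γ δ β) p.1 (ketTwo γ δ p.2.2 p.2.1))
    h.cspan_right (fun p q => by rw [h.inner_right, h.inner_left'])
  refine opOf_apply T ?_ ⟨ξ, k, η, rfl⟩
  rintro _ ⟨ξ, k, η, rfl⟩
  exact hT (ξ, k, η)

theorem Chain.assocInv_apply (h : Chain α β γ δ) (ξ : α) (k : K) (η : δ) :
    assocInv α β γ δ (ketOne α (leftTri γ δ β) ξ (ketTwo γ δ η k)) =
      ketTwo (rightTri α β γ) δ η (ketOne α β ξ k) := by
  obtain ⟨T, hT⟩ := exists_clm_of_gram_eq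
    (g := fun p : α × K × δ => ketTwo (rightTri α β γ) δ p.2.2 (ketOne α β p.1 p.2.1))
    (f := fun p : α × K × δ => ketOne α (leftTri γ δ β) p.1 (ketTwo γ δ p.2.2 p.2.1))
    h.cspan_left' (fun p q => by rw [h.inner_right, h.inner_left'])
  refine opOf_apply T ?_ ⟨ξ, k, η, rfl⟩
  rintro _ ⟨ξ, k, η, rfl⟩
  exact hT (ξ, k, η)

end Chains

/-! ### Reassociation of threefold tensor products -/

section Triple

set_option linter.unusedSectionVars false

variable {𝔥 𝔨 H K L : Type*}
  [NormedAddCommGroup 𝔥] [InnerProductSpace ℂ 𝔥] [CompleteSpace 𝔥]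
  [NormedAddCommGroup 𝔨] [InnerProductSpace ℂ 𝔨] [CompleteSpace 𝔨]
  [NormedAddCommGroup H] [InnerProductSpace ℂ H] [CompleteSpace H]
  [NormedAddCommGroup K] [InnerProductSpace ℂ K] [CompleteSpace K]
  [NormedAddCommGroup L] [InnerProductSpace ℂ L] [CompleteSpace L]
  {α : OpSpace 𝔥 H} {β : OpSpace 𝔥 K} {γ : OpSpace 𝔨 K} {δ : OpSpace 𝔨 L}

theorem Chain.assoc_comp_assocInv (h : Chain α β γ δ) :
    assoc α β γ δ ∘L assocInv α β γ δ = ContinuousLinearMap.id ℂ _ :=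
  ext_of_cspan_eq_top h.cspan_left' (by
    rintro _ ⟨⟨ξ, k, η⟩, rfl⟩
    rw [comp_apply, h.assocInv_apply, h.assoc_apply, id_apply])

theorem Chain.assocInv_comp_assoc (h : Chain α β γ δ) :
    assocInv α β γ δ ∘L assoc α β γ δ = ContinuousLinearMap.id ℂ _ :=
  ext_of_cspan_eq_top h.cspan_right (by
    rintro _ ⟨⟨ξ, k, η⟩, rfl⟩
    rw [comp_apply, h.assoc_apply, h.assocInv_apply, id_apply])

theorem Chain.adjoint_assoc (h : Chain α β γ δ) :
    adjoint (assoc α β γ δ) = assocInv α β γ δ := by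
  refine eq_of_bra_eq h.cspan_right ?_
  rintro _ ⟨⟨ξ, k, η⟩, rfl⟩ y
  have : innerSL ℂ (assoc α β γ δ (ketTwo _ δ η (ketOne α β ξ k))) =
      innerSL ℂ (ketTwo _ δ η (ketOne α β ξ k)) ∘L assocInv α β γ δ := by
    refine ext_of_cspan_eq_top h.cspan_left' ?_
    rintro _ ⟨⟨ξ', k', η'⟩, rfl⟩
    rw [comp_apply, innerSL_apply_apply, innerSL_apply_apply, h.assoc_apply, h.assocInv_apply,
      h.inner_right, h.inner_left']
  rw [adjoint_inner_right]
  exact DFunLike.congr_fun this y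

theorem Chain.intw_ketTwo (h : Chain α β γ δ) (η : δ) :
    Intw α β (leftTri γ δ β) (ketTwo γ δ η) :=
  .of_maps h.left.linked h.linked_leftTri' fun _ hc => ketTwo_comp_mem η hc

theorem Chain.intw_ketOne (h : Chain α β γ δ) (ξ : α) :
    Intw δ γ (rightTri α β γ) (ketOne α β ξ) :=
  .of_maps h.right.linked h.linked_rightTri.symm fun _ hc => ketOne_comp_mem ξ hc

theorem Chain.intw_ketTwo' (h : Chain α β γ δ) (ξ : α) :
    Intw δ γ (leftTri β α γ) (ketTwo β α ξ) :=
  .of_maps h.right.linked h.linked_leftTri.symm fun _ hc => ketTwo_comp_mem ξ hc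

/-- Both sides send ξ ⊗ k to the vector labelled by (ξ, k, η). Kets of the third leg thus become
operators on the second factor after reassociation, so that diagrams with changing brackets can be
sliced in the third leg. -/
theorem Chain.assoc_comp_ketTwo (h : Chain α β γ δ) (η : δ) :
    assoc α β γ δ ∘L ketTwo (rightTri α β γ) δ η =
      legTwo α β (leftTri γ δ β) (ketTwo γ δ η) := by
  refine (legTwo_eq h.left.linked fun ξ => ?_).symm
  exact ContinuousLinearMap.ext fun k => h.assoc_apply ξ k η

theorem Chain.assocInv_comp_legTwo (h : Chain α β γ δ) (η : δ) :
    assocInv α β γ δ ∘L legTwo α β (leftTri γ δ β) (ketTwo γ δ η) =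
      ketTwo (rightTri α β γ) δ η := by
  rw [← h.assoc_comp_ketTwo, ← comp_assoc, h.assocInv_comp_assoc, id_comp]

/-- The counterpart of `Chain.assoc_comp_ketTwo` for slicing in the first leg. -/
theorem Chain.assocInv_comp_ketOne (h : Chain α β γ δ) (ξ : α) :
    assocInv α β γ δ ∘L ketOne α (leftTri γ δ β) ξ =
      legOne γ (rightTri α β γ) δ (ketOne α β ξ) := by
  refine (legOne_eq h.right.linked.symm fun η => ?_).symm
  exact ContinuousLinearMap.ext fun k => h.assocInv_apply ξ k η

theorem Chain.assoc_comp_legOne (h : Chain α β γ δ) (ξ : α) :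
    assoc α β γ δ ∘L legOne γ (rightTri α β γ) δ (ketOne α β ξ) =
      ketOne α (leftTri γ δ β) ξ := by
  rw [← h.assocInv_comp_ketOne, ← comp_assoc, h.assoc_comp_assocInv, id_comp]

end Triple

/-! ### The exchange of the last two legs -/

section FlipLast

set_option linter.unusedSectionVars false

variable {𝔥 𝔨 H K L : Type*}
  [NormedAddCommGroup 𝔥] [InnerProductSpace ℂ 𝔥] [CompleteSpace 𝔥]
  [NormedAddCommGroup 𝔨] [InnerProductSpace ℂ 𝔨] [CompleteSpace 𝔨]
  [NormedAddCommGroup H] [InnerProductSpace ℂ H] [CompleteSpace H]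
  [NormedAddCommGroup K] [InnerProductSpace ℂ K] [CompleteSpace K]
  [NormedAddCommGroup L] [InnerProductSpace ℂ L] [CompleteSpace L]
  {α : OpSpace 𝔥 H} {β : OpSpace 𝔥 K} {γ : OpSpace 𝔨 H} {δ : OpSpace 𝔨 L}

theorem Chain.flipLast_apply (h : Chain β α γ δ) (ξ : β) (k : H) (η : δ) :
    flipLast α β γ δ (ketTwo (leftTri α β γ) δ η (ketTwo α β ξ k)) =
      ketTwo (leftTri γ δ α) β ξ (ketTwo γ δ η k) := by
  obtain ⟨T, hT⟩ := exists_clm_of_gram_eq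
    (f := fun p : β × H × δ => ketTwo (leftTri α β γ) δ p.2.2 (ketTwo α β p.1 p.2.1))
    (g := fun p : β × H × δ => ketTwo (leftTri γ δ α) β p.1 (ketTwo γ δ p.2.2 p.2.1))
    h.cspan_left (fun p q => by rw [h.inner_left, h.symm.inner_left, h.rho_comm])
  refine opOf_apply T ?_ ⟨k, ξ, η, rfl⟩
  rintro _ ⟨k, ξ, η, rfl⟩
  exact hT (ξ, k, η)

theorem Chain.flipLast_comp_flipLast (h : Chain β α γ δ) :
    flipLast γ δ α β ∘L flipLast α β γ δ = ContinuousLinearMap.id ℂ _ :=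
  ext_of_cspan_eq_top h.cspan_left (by
    rintro _ ⟨⟨ξ, k, η⟩, rfl⟩
    rw [comp_apply, h.flipLast_apply, h.symm.flipLast_apply, id_apply])

theorem Chain.adjoint_flipLast (h : Chain β α γ δ) :
    adjoint (flipLast α β γ δ) = flipLast γ δ α β := by
  refine eq_of_bra_eq h.cspan_left ?_
  rintro _ ⟨⟨ξ, k, η⟩, rfl⟩ y
  have : innerSL ℂ (flipLast α β γ δ (ketTwo _ δ η (ketTwo α β ξ k))) =
      innerSL ℂ (ketTwo _ δ η (ketTwo α β ξ k)) ∘L flipLast γ δ α β := by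
    refine ext_of_cspan_eq_top h.symm.cspan_left ?_
    rintro _ ⟨⟨η', k', ξ'⟩, rfl⟩
    rw [comp_apply, innerSL_apply_apply, innerSL_apply_apply, h.flipLast_apply,
      h.symm.flipLast_apply, h.inner_left, h.symm.inner_left, h.rho_comm]
  rw [adjoint_inner_right]
  exact DFunLike.congr_fun this y

theorem Chain.flipLast_comp_ketTwo (h : Chain β α γ δ) (η : δ) :
    flipLast α β γ δ ∘L ketTwo (leftTri α β γ) δ η =
      legOne α (leftTri γ δ α) β (ketTwo γ δ η) := by
  refine (legOne_eq h.left.linked.symm fun ξ => ?_).symm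
  exact ContinuousLinearMap.ext fun k => h.flipLast_apply ξ k η

end FlipLast

/-! ### C*-factorizations supply linked pairs and chains -/

section Factorizations

set_option linter.unusedSectionVars false

variable {𝔥 𝔨 H K L : Type*}
  [NormedAddCommGroup 𝔥] [InnerProductSpace ℂ 𝔥] [CompleteSpace 𝔥]
  [NormedAddCommGroup 𝔨] [InnerProductSpace ℂ 𝔨] [CompleteSpace 𝔨]
  [NormedAddCommGroup H] [InnerProductSpace ℂ H] [CompleteSpace H]
  [NormedAddCommGroup K] [InnerProductSpace ℂ K] [CompleteSpace K]
  [NormedAddCommGroup L] [InnerProductSpace ℂ L] [CompleteSpace L]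
  {b : CStarBase 𝔥} {c : CStarBase 𝔨}
  {α : OpSpace 𝔥 H} {β : OpSpace 𝔥 K} {γ : OpSpace 𝔨 K} {δ : OpSpace 𝔨 L}

theorem IsFactorization.inner_mem (h : IsFactorization b α) (ξ ξ' : α) :
    adjoint (ξ : 𝔥 →L[ℂ] H) ∘L (ξ' : 𝔥 →L[ℂ] H) ∈ b.B := by
  have : adjoint (ξ : 𝔥 →L[ℂ] H) ∘L (ξ' : 𝔥 →L[ℂ] H) ∈
      opProd (adjSet (α : Set (𝔥 →L[ℂ] H))) (α : Set (𝔥 →L[ℂ] H)) :=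
    comp_mem_opProd ⟨ξ, ξ.2, rfl⟩ ξ'.2
  rw [← SetLike.mem_coe, h.inner_eq] at this
  exact this

theorem IsFactorization.comp_mem (h : IsFactorization b α) {ξ : 𝔥 →L[ℂ] H} (hξ : ξ ∈ α)
    {x : 𝔥 →L[ℂ] 𝔥} (hx : x ∈ b.B) : ξ ∘L x ∈ α := by
  rw [← h.mul_eq]
  exact comp_mem_opProd hξ hx

theorem IsFactorization.commutesInner (h : IsFactorization b α) {x : 𝔥 →L[ℂ] 𝔥}
    (hx : x ∈ b.Bd) : CommutesInner α x := fun ξ hξ ξ' hξ' ζ =>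
  (DFunLike.congr_fun (b.comm _ (h.inner_mem ⟨ξ, hξ⟩ ⟨ξ', hξ'⟩) x hx) ζ).symm

theorem IsFactorization.linked (h : IsFactorization b α) (h' : IsFactorization b.op β) :
    Linked α β :=
  .of_commutesInner h.vec_eq h'.vec_eq fun η η' => h.commutesInner (h'.inner_mem η η')

/-- The inner products of α lie in the algebra represented by ρ_β, and those of δ in the algebra
represented by ρ_γ, so compatibility of β and γ supplies both invariance conditions. -/
theorem IsFactorization.chain (hα : IsFactorization b α) (hβ : IsFactorization b.op β)
    (hγ : IsFactorization c γ) (hδ : IsFactorization c.op δ) (h : Compatible b.op c β γ) :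
    Chain α β γ δ := by
  refine ⟨⟨hα.linked hβ, fun ξ ξ' d hd => ?_, hγ.vec_eq⟩,
    ⟨(hγ.linked hδ).symm, fun η η' d hd => ?_, hβ.vec_eq⟩⟩
  · have : rho β (adjoint (ξ : 𝔥 →L[ℂ] H) ∘L (ξ' : 𝔥 →L[ℂ] H)) ∘L d ∈
        opProd (rho β '' (b.op.Bd : Set (𝔥 →L[ℂ] 𝔥))) (γ : Set (𝔨 →L[ℂ] K)) :=
      comp_mem_opProd ⟨_, hα.inner_mem ξ ξ', rfl⟩ hd
    rwa [h.1] at this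
  · have : rho γ (adjoint (η : 𝔨 →L[ℂ] L) ∘L (η' : 𝔨 →L[ℂ] L)) ∘L d ∈
        opProd (rho γ '' (c.Bd : Set (𝔨 →L[ℂ] 𝔨))) (β : Set (𝔥 →L[ℂ] K)) :=
      comp_mem_opProd ⟨_, hδ.inner_mem η η', rfl⟩ hd
    rwa [h.2] at this

theorem Compatible.symm {β : OpSpace 𝔥 K} (h : Compatible b c β γ) : Compatible c b γ β :=
  ⟨h.2, h.1⟩

end Factorizations

/-! ### Unitary operators and their legs -/

section Unitary

set_option linter.unusedSectionVars false

variable {X Y Z W W' : Type*} [NormedAddCommGroup X] [InnerProductSpace ℂ X] [CompleteSpace X]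
  [NormedAddCommGroup Y] [InnerProductSpace ℂ Y] [CompleteSpace Y]
  [NormedAddCommGroup Z] [InnerProductSpace ℂ Z] [CompleteSpace Z]
  [NormedAddCommGroup W] [InnerProductSpace ℂ W] [CompleteSpace W]
  [NormedAddCommGroup W'] [InnerProductSpace ℂ W'] [CompleteSpace W']

theorem comp_comp_of_eq {A : Y →L[ℂ] Z} {B : X →L[ℂ] Y} {C : X →L[ℂ] Z} (h : A ∘L B = C)
    (T : W →L[ℂ] X) : A ∘L B ∘L T = C ∘L T := by
  rw [← comp_assoc, h]

theorem comp_comp_of_eq' {A : Y →L[ℂ] Z} {B : X →L[ℂ] Y} {C : W' →L[ℂ] Z} {D : X →L[ℂ] W'}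
    (h : A ∘L B = C ∘L D) (T : W →L[ℂ] X) : A ∘L B ∘L T = C ∘L D ∘L T := by
  rw [← comp_assoc, h, comp_assoc]

theorem IsUnitaryMap.comp {V : Y →L[ℂ] Z} {T : X →L[ℂ] Y} (hV : IsUnitaryMap V)
    (hT : IsUnitaryMap T) : IsUnitaryMap (V ∘L T) := by
  constructor
  · rw [adjoint_comp, comp_assoc, comp_comp_of_eq hV.1, id_comp, hT.1]
  · rw [adjoint_comp, comp_assoc, comp_comp_of_eq hT.2, id_comp, hV.2]

theorem IsUnitaryMap.adjoint {V : Y →L[ℂ] Z} (hV : IsUnitaryMap V) :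
    IsUnitaryMap (adjoint V) := by
  rw [IsUnitaryMap, adjoint_adjoint]
  exact ⟨hV.2, hV.1⟩

theorem IsUnitaryMap.cancel_left {V : Y →L[ℂ] Z} (hV : IsUnitaryMap V) {S T : X →L[ℂ] Y}
    (h : V ∘L S = V ∘L T) : S = T := by
  have := congrArg (fun R => ContinuousLinearMap.adjoint V ∘L R) h
  simpa only [← comp_assoc, hV.1, id_comp] using this

theorem IsUnitaryMap.cancel_right {V : X →L[ℂ] Y} (hV : IsUnitaryMap V) {S T : Y →L[ℂ] Z}
    (h : S ∘L V = T ∘L V) : S = T := by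
  have := congrArg (fun R => R ∘L ContinuousLinearMap.adjoint V) h
  simpa only [comp_assoc, hV.2, comp_id] using this

end Unitary

section UnitaryLegs

set_option linter.unusedSectionVars false

variable {𝔥 𝔨 H K L : Type*}
  [NormedAddCommGroup 𝔥] [InnerProductSpace ℂ 𝔥] [CompleteSpace 𝔥]
  [NormedAddCommGroup 𝔨] [InnerProductSpace ℂ 𝔨] [CompleteSpace 𝔨]
  [NormedAddCommGroup H] [InnerProductSpace ℂ H] [CompleteSpace H]
  [NormedAddCommGroup K] [InnerProductSpace ℂ K] [CompleteSpace K]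
  [NormedAddCommGroup L] [InnerProductSpace ℂ L] [CompleteSpace L]

theorem IsUnitaryMap.legTwo {α : OpSpace 𝔥 H} {β : OpSpace 𝔥 K} {γ : OpSpace 𝔥 L}
    (h : Linked α β) (h' : Linked α γ) {T : K →L[ℂ] L} (hT : Intw α β γ T)
    (hU : IsUnitaryMap T) : IsUnitaryMap (legTwo α β γ T) := by
  rw [IsUnitaryMap, adjoint_legTwo h h' hT]
  constructor
  · rw [← legTwo_comp h h' h (hT.adjoint h h') hT, hU.1, legTwo_id h]
  · rw [← legTwo_comp h' h h' hT (hT.adjoint h h'), hU.2, legTwo_id h']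

theorem IsUnitaryMap.legOne {α : OpSpace 𝔥 H} {β : OpSpace 𝔥 K} {γ : OpSpace 𝔥 L}
    (h : Linked β α) (h' : Linked γ α) {T : K →L[ℂ] L} (hT : Intw α β γ T)
    (hU : IsUnitaryMap T) : IsUnitaryMap (legOne β γ α T) := by
  rw [legOne_eq_flip h h' hT]
  exact (isUnitaryMap_flip h'.symm).comp ((hU.legTwo h.symm h'.symm hT).comp (isUnitaryMap_flip h))

theorem Chain.isUnitaryMap_assocInv {α : OpSpace 𝔥 H} {β : OpSpace 𝔥 K} {γ : OpSpace 𝔨 K}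
    {δ : OpSpace 𝔨 L} (h : Chain α β γ δ) : IsUnitaryMap (assocInv α β γ δ) := by
  rw [IsUnitaryMap, ← h.adjoint_assoc, adjoint_adjoint, h.adjoint_assoc]
  exact ⟨h.assoc_comp_assocInv, h.assocInv_comp_assoc⟩

theorem Chain.isUnitaryMap_flipLast {α : OpSpace 𝔥 H} {β : OpSpace 𝔥 K} {γ : OpSpace 𝔨 H}
    {δ : OpSpace 𝔨 L} (h : Chain β α γ δ) : IsUnitaryMap (flipLast α β γ δ) := by
  rw [IsUnitaryMap, h.adjoint_flipLast]
  exact ⟨h.flipLast_comp_flipLast, h.symm.flipLast_comp_flipLast⟩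

theorem flip_comp_mem {α : OpSpace 𝔥 H} {β : OpSpace 𝔥 K} {γ : OpSpace 𝔨 K}
    (h : Linked α β) {T : 𝔨 →L[ℂ] RelTensor α β} (hT : T ∈ rightTri α β γ) :
    flip α β ∘L T ∈ leftTri β α γ :=
  map_mem_of_mem_opProd (compL ℂ 𝔨 (RelTensor α β) (RelTensor β α) (flip α β))
    (isClosed_opProd _ _) (by
      rintro _ ⟨ξ, rfl⟩ c hc
      rw [compL_apply, ← comp_assoc, flip_comp_ketOne h]
      exact ketTwo_comp_mem ξ hc) hT

theorem Chain.braTwo_comp_assoc {α : OpSpace 𝔥 H} {β : OpSpace 𝔥 K} {γ : OpSpace 𝔨 K}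
    {δ : OpSpace 𝔨 L} (h : Chain α β γ δ) (η : δ) :
    adjoint (PseudoKac.legTwo α β (leftTri γ δ β) (ketTwo γ δ η)) ∘L assoc α β γ δ =
      adjoint (ketTwo (rightTri α β γ) δ η) := by
  rw [← h.assocInv_comp_legTwo, adjoint_comp, ← h.adjoint_assoc, adjoint_adjoint]

theorem Chain.braOne_comp_assoc {α : OpSpace 𝔥 H} {β : OpSpace 𝔥 K} {γ : OpSpace 𝔨 K}
    {δ : OpSpace 𝔨 L} (h : Chain α β γ δ) (ξ : α) :
    adjoint (ketOne α (leftTri γ δ β) ξ) ∘L assoc α β γ δ =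
      adjoint (PseudoKac.legOne γ (rightTri α β γ) δ (ketOne α β ξ)) := by
  rw [← h.assocInv_comp_ketOne, adjoint_comp, ← h.adjoint_assoc, adjoint_adjoint]

end UnitaryLegs

/-! ### The pentagon equation and its slices -/

section Pentagon

variable {𝔥 H : Type*}
  [NormedAddCommGroup 𝔥] [InnerProductSpace ℂ 𝔥] [CompleteSpace 𝔥]
  [NormedAddCommGroup H] [InnerProductSpace ℂ H] [CompleteSpace H]
  {b : CStarBase 𝔥} {α βh β : OpSpace 𝔥 H}
  {V : RelTensor βh α →L[ℂ] RelTensor α β}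

/-- The operator `V₁₃`. -/
def pmuThirteen (α βh β : OpSpace 𝔥 H) (V : RelTensor βh α →L[ℂ] RelTensor α β) :
    RelTensor βh (rightTri α β α) →L[ℂ] RelTensor (leftTri βh α α) β :=
  flipLast α β βh α ∘L legOne (rightTri βh α β) (leftTri α β βh) α V ∘L
    assocInv βh α β α ∘L legTwo βh (rightTri α β α) (leftTri β α α) (flip α β)

namespace IsPMU

theorem linked (hV : IsPMU b α βh β V) : Linked α β := hV.fact_α.linked hV.fact_β

theorem linked_hat (hV : IsPMU b α βh β V) : Linked βh α :=
  hV.fact_βh.linked (b := b.op) hV.fact_α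

theorem chain_hhα (hV : IsPMU b α βh β V) : Chain βh α βh α :=
  hV.fact_βh.chain (b := b.op) (c := b.op) hV.fact_α hV.fact_βh hV.fact_α hV.compat_α_βh

theorem chain_αβh (hV : IsPMU b α βh β V) : Chain α β βh α :=
  hV.fact_α.chain (c := b.op) hV.fact_β hV.fact_βh hV.fact_α hV.compat_β_βh

theorem chain_αβα (hV : IsPMU b α βh β V) : Chain α β α β :=
  hV.fact_α.chain hV.fact_β hV.fact_α hV.fact_β hV.compat_α_β.symm

theorem chain_hαβ (hV : IsPMU b α βh β V) : Chain βh α β α :=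
  hV.fact_βh.chain (b := b.op) (c := b.op) hV.fact_α hV.fact_β hV.fact_α hV.compat_α_β

theorem chain_βαh (hV : IsPMU b α βh β V) : Chain β α βh α :=
  hV.fact_β.chain (b := b.op) (c := b.op) hV.fact_α hV.fact_βh hV.fact_α hV.compat_α_βh

theorem chain_αβαh (hV : IsPMU b α βh β V) : Chain α β α βh :=
  hV.fact_α.chain hV.fact_β hV.fact_α hV.fact_βh hV.compat_α_β.symm

theorem comp_mem_one (hV : IsPMU b α βh β V) {T : 𝔥 →L[ℂ] RelTensor βh α}
    (hT : T ∈ leftTri βh α α) : V ∘L T ∈ rightTri α β α := by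
  rw [← SetLike.mem_coe, ← hV.map_one]
  exact ⟨T, hT, rfl⟩

theorem comp_mem_two (hV : IsPMU b α βh β V) {T : 𝔥 →L[ℂ] RelTensor βh α}
    (hT : T ∈ rightTri βh α β) : V ∘L T ∈ leftTri α β βh := by
  rw [← SetLike.mem_coe, ← hV.map_two]
  exact ⟨T, hT, rfl⟩

theorem comp_mem_three (hV : IsPMU b α βh β V) {T : 𝔥 →L[ℂ] RelTensor βh α}
    (hT : T ∈ rightTri βh α βh) : V ∘L T ∈ rightTri α β βh := by
  rw [← SetLike.mem_coe, ← hV.map_three]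
  exact ⟨T, hT, rfl⟩

theorem comp_mem_four (hV : IsPMU b α βh β V) {T : 𝔥 →L[ℂ] RelTensor βh α}
    (hT : T ∈ leftTri βh α β) : V ∘L T ∈ leftTri α β β := by
  rw [← SetLike.mem_coe, ← hV.map_four]
  exact ⟨T, hT, rfl⟩

/-- Each mapping condition on V makes some leg of V in the pentagon well defined. The third and
fourth conditions serve V₁₂ and V₂₃ on the short side, the first serves V₁₂ and V₂₃ on the long side
(with respect to β and β̂), and the second serves V₁₃. -/
theorem intw_three (hV : IsPMU b α βh β V) :
    Intw α (rightTri βh α βh) (rightTri α β βh) V :=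
  .of_maps hV.chain_hhα.linked_rightTri.symm hV.chain_αβh.linked_rightTri.symm
    fun _ hT => hV.comp_mem_three hT

theorem intw_four (hV : IsPMU b α βh β V) : Intw α (leftTri βh α β) (leftTri α β β) V :=
  .of_maps hV.chain_αβh.linked_leftTri' hV.chain_αβα.linked_leftTri'
    fun _ hT => hV.comp_mem_four hT

theorem intw_one (hV : IsPMU b α βh β V) : Intw β (leftTri βh α α) (rightTri α β α) V :=
  .of_maps hV.chain_βαh.symm.linked_leftTri.symm hV.chain_αβα.linked_rightTri.symm
    fun _ hT => hV.comp_mem_one hT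

theorem intw_one' (hV : IsPMU b α βh β V) : Intw βh (leftTri βh α α) (rightTri α β α) V :=
  .of_maps hV.chain_hhα.linked_leftTri' hV.chain_αβαh.linked_rightTri.symm
    fun _ hT => hV.comp_mem_one hT

theorem intw_two (hV : IsPMU b α βh β V) : Intw α (rightTri βh α β) (leftTri α β βh) V :=
  .of_maps hV.chain_hαβ.linked_rightTri.symm hV.chain_βαh.linked_leftTri.symm
    fun _ hT => hV.comp_mem_two hT

theorem intw_flip (hV : IsPMU b α βh β V) :
    Intw βh (rightTri α β α) (leftTri β α α) (flip α β) :=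
  .of_maps hV.chain_αβαh.linked_rightTri.symm hV.chain_hαβ.linked_leftTri'
    fun _ hT => flip_comp_mem hV.linked hT

theorem intw_ketOne (hV : IsPMU b α βh β V) (ξ : α) :
    Intw βh α (rightTri α β α) (ketOne α β ξ) :=
  hV.chain_αβαh.intw_ketOne ξ

theorem intw_ketTwo (hV : IsPMU b α βh β V) (ξ : α) :
    Intw β α (leftTri βh α α) (ketTwo βh α ξ) :=
  hV.chain_βαh.symm.intw_ketTwo' ξ

theorem isUnitaryMap_thirteen (hV : IsPMU b α βh β V) : IsUnitaryMap (pmuThirteen α βh β V) :=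
  hV.chain_βαh.isUnitaryMap_flipLast.comp <|
    (hV.unitary.legOne hV.chain_hαβ.linked_rightTri hV.chain_βαh.linked_leftTri hV.intw_two).comp <|
    hV.chain_hαβ.isUnitaryMap_assocInv.comp <|
    (isUnitaryMap_flip hV.linked).legTwo hV.chain_αβαh.linked_rightTri.symm
      hV.chain_hαβ.linked_leftTri' hV.intw_flip

/-- `V₁₃ |ξ⟩₂ = |ξ⟩₂ V`. -/
theorem thirteen_comp (hV : IsPMU b α βh β V) (ξ : α) :
    pmuThirteen α βh β V ∘L legTwo βh α (rightTri α β α) (ketOne α β ξ) =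
      legOne α (leftTri βh α α) β (ketTwo βh α ξ) ∘L V := by
  rw [pmuThirteen, comp_assoc, comp_assoc, comp_assoc,
    ← legTwo_comp hV.linked_hat hV.chain_αβαh.linked_rightTri.symm hV.chain_hαβ.linked_leftTri'
      hV.intw_flip (hV.intw_ketOne ξ), flip_comp_ketOne hV.linked,
    hV.chain_hαβ.assocInv_comp_legTwo,
    legOne_comp_ketTwo hV.chain_hαβ.linked_rightTri hV.chain_βαh.linked_leftTri hV.intw_two,
    comp_comp_of_eq (hV.chain_βαh.flipLast_comp_ketTwo ξ)]

/-- `⟨ξ|₂ V₁₃ = V ⟨ξ|₂`. -/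
theorem bra_comp_thirteen (hV : IsPMU b α βh β V) (ξ : α) :
    adjoint (legOne α (leftTri βh α α) β (ketTwo βh α ξ)) ∘L pmuThirteen α βh β V =
      V ∘L adjoint (legTwo βh α (rightTri α β α) (ketOne α β ξ)) := by
  -- After multiplication by V₁₃* on the right, the claim is the adjoint of `thirteen_comp`
  -- multiplied by V on the left.
  refine hV.isUnitaryMap_thirteen.adjoint.cancel_right ?_
  have := congrArg adjoint (hV.thirteen_comp ξ)
  rw [adjoint_comp, adjoint_comp] at this
  rw [comp_assoc, comp_assoc, hV.isUnitaryMap_thirteen.2, comp_id, this,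
    comp_comp_of_eq hV.unitary.2, id_comp]

theorem pentagon' (hV : IsPMU b α βh β V) :
    legTwo α (leftTri βh α β) (leftTri α β β) V ∘L assoc α β βh α ∘L
      legOne (rightTri βh α βh) (rightTri α β βh) α V =
    assoc α β α β ∘L legOne (leftTri βh α α) (rightTri α β α) β V ∘L
      pmuThirteen α βh β V ∘L legTwo βh (leftTri βh α α) (rightTri α β α) V ∘L
      assoc βh α βh α := by
  rw [hV.pentagon, pmuThirteen]
  simp only [comp_assoc]

/-- The slice `⟨η|₂ V |ξ⟩₂`. -/
def slice22 (α βh β : OpSpace 𝔥 H) (V : RelTensor βh α →L[ℂ] RelTensor α β) (η : β) (ξ : α) :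
    H →L[ℂ] H := adjoint (ketTwo α β η) ∘L V ∘L ketTwo βh α ξ

/-- The slice `⟨η|₂ V |ξ⟩₁`. -/
def slice21 (α βh β : OpSpace 𝔥 H) (V : RelTensor βh α →L[ℂ] RelTensor α β) (η : β) (ξ : βh) :
    H →L[ℂ] H := adjoint (ketTwo α β η) ∘L V ∘L ketOne βh α ξ

/-- The slice `⟨ξ|₁ V |η⟩₁`. -/
def slice11 (α βh β : OpSpace 𝔥 H) (V : RelTensor βh α →L[ℂ] RelTensor α β) (ξ : α) (η : βh) :
    H →L[ℂ] H := adjoint (ketOne α β ξ) ∘L V ∘L ketOne βh α η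

/-- The slice `⟨ξ|₁ V |ξ'⟩₂`. -/
def slice12 (α βh β : OpSpace 𝔥 H) (V : RelTensor βh α →L[ℂ] RelTensor α β) (ξ ξ' : α) :
    H →L[ℂ] H := adjoint (ketOne α β ξ) ∘L V ∘L ketTwo βh α ξ'

theorem intw_slice22 (hV : IsPMU b α βh β V) (η : β) (ξ : α) :
    Intw α β β (slice22 α βh β V η ξ) :=
  ((hV.chain_αβα.intw_ketTwo η).adjoint hV.linked hV.chain_αβα.linked_leftTri').comp
    (hV.intw_four.comp (hV.chain_αβh.intw_ketTwo ξ))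

theorem intw_slice21 (hV : IsPMU b α βh β V) (η : β) (ξ : βh) :
    Intw α β βh (slice21 α βh β V η ξ) :=
  ((hV.chain_βαh.intw_ketTwo' η).adjoint hV.linked_hat.symm
    hV.chain_βαh.linked_leftTri.symm).comp
    (hV.intw_two.comp (hV.chain_hαβ.intw_ketOne ξ))

theorem intw_slice11 (hV : IsPMU b α βh β V) (ξ : α) (η : βh) :
    Intw α βh βh (slice11 α βh β V ξ η) :=
  ((hV.chain_αβh.intw_ketOne ξ).adjoint hV.linked_hat.symm
    hV.chain_αβh.linked_rightTri.symm).comp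
    (hV.intw_three.comp (hV.chain_hhα.intw_ketOne η))

theorem intw_V_ketTwo (hV : IsPMU b α βh β V) (ξ : α) :
    Intw βh α (rightTri α β α) (V ∘L ketTwo βh α ξ) :=
  hV.intw_one'.comp (hV.chain_hhα.intw_ketTwo ξ)

theorem intw_slice12 (hV : IsPMU b α βh β V) (ξ ξ' : α) :
    Intw βh α α (slice12 α βh β V ξ ξ') :=
  ((hV.intw_ketOne ξ).adjoint hV.linked_hat hV.chain_αβαh.linked_rightTri.symm).comp
    (hV.intw_V_ketTwo ξ')

/-- The operator `⟨η|₃ V₁₃`. -/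
def braThirteen (α βh β : OpSpace 𝔥 H) (V : RelTensor βh α →L[ℂ] RelTensor α β) (η : β) :
    RelTensor βh (rightTri α β α) →L[ℂ] RelTensor βh α :=
  adjoint (ketTwo (leftTri βh α α) β η) ∘L pmuThirteen α βh β V

theorem braThirteen_comp_legTwo (hV : IsPMU b α βh β V) (η : β) (ξ : α) :
    braThirteen α βh β V η ∘L legTwo βh α (rightTri α β α) (ketOne α β ξ) =
      ketTwo βh α ξ ∘L adjoint (ketTwo α β η) ∘L V := by
  rw [braThirteen, comp_assoc, hV.thirteen_comp,
    comp_comp_of_eq' (braTwo_comp_legOne hV.linked hV.chain_βαh.symm.linked_leftTri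
      (hV.intw_ketTwo ξ) η)]

/-- Slicing the first and third legs of V₁₃ leaves the slice ⟨η|₂V|c⟩₁. The flip appears because
this slice acts on the old second leg and ends up in the new first one. -/
theorem braThirteen_comp_ketOne (hV : IsPMU b α βh β V) (η : β) (c : βh) :
    braThirteen α βh β V η ∘L ketOne βh (rightTri α β α) c =
      flip α βh ∘L legTwo α β βh (slice21 α βh β V η c) := by
  refine ext_ketOne hV.linked fun ξ => ?_
  rw [comp_assoc, comp_assoc, ← legTwo_comp_ketOne hV.linked_hat
    hV.chain_αβαh.linked_rightTri.symm (hV.intw_ketOne ξ) c,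
    comp_comp_of_eq (hV.braThirteen_comp_legTwo η ξ),
    legTwo_comp_ketOne hV.linked hV.linked_hat.symm (hV.intw_slice21 η c),
    comp_comp_of_eq (flip_comp_ketOne hV.linked_hat.symm ξ), comp_assoc, comp_assoc]
  rfl

theorem bra_comp_braThirteen (hV : IsPMU b α βh β V) (η : β) (ξ : α) :
    adjoint (ketTwo βh α ξ) ∘L braThirteen α βh β V η =
      adjoint (ketTwo α β η) ∘L V ∘L
        adjoint (legTwo βh α (rightTri α β α) (ketOne α β ξ)) := by
  rw [← hV.bra_comp_thirteen, braThirteen, ← comp_assoc, ← comp_assoc, ← adjoint_comp,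
    ← adjoint_comp, legOne_comp_ketTwo hV.linked hV.chain_βαh.symm.linked_leftTri
      (hV.intw_ketTwo ξ)]

theorem pentagon_comp_ketTwo (hV : IsPMU b α βh β V) (ξ : α) :
    legTwo α β (leftTri α β β) (V ∘L ketTwo βh α ξ) ∘L V =
    assoc α β α β ∘L legOne (leftTri βh α α) (rightTri α β α) β V ∘L
      pmuThirteen α βh β V ∘L legTwo βh α (rightTri α β α) (V ∘L ketTwo βh α ξ) := by
  have := congrArg (fun T => T ∘L ketTwo (rightTri βh α βh) α ξ) hV.pentagon'
  simp only [comp_assoc] at this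
  rw [hV.chain_hhα.assoc_comp_ketTwo, legOne_comp_ketTwo hV.chain_hhα.linked_rightTri
    hV.chain_αβh.linked_rightTri hV.intw_three, comp_comp_of_eq
    (hV.chain_αβh.assoc_comp_ketTwo ξ), ← comp_assoc,
    ← legTwo_comp hV.linked hV.chain_αβh.linked_leftTri' hV.chain_αβα.linked_leftTri'
      hV.intw_four (hV.chain_αβh.intw_ketTwo ξ),
    ← legTwo_comp hV.linked_hat hV.chain_hhα.linked_leftTri'
      hV.chain_αβαh.linked_rightTri.symm hV.intw_one' (hV.chain_hhα.intw_ketTwo ξ)] at this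
  exact this

/-- Apply ⟨η|₃ and |ξ⟩₃ to V₂₃V₁₂ = V₁₂V₁₃V₂₃. Since ⟨η|₃ passes V₁₂, the result is (1 ⊗ y)V =
V⟨η|₃V₁₃V₂₃|ξ⟩₃ with y the slice of V, and V is cancelled on the left. -/
theorem comulHat_slice22 (hV : IsPMU b α βh β V) (η : β) (ξ : α) :
    comulHat α βh β V (slice22 α βh β V η ξ) =
      braThirteen α βh β V η ∘L legTwo βh α (rightTri α β α) (V ∘L ketTwo βh α ξ) := by
  refine hV.unitary.cancel_left ?_
  have := congrArg (fun T => adjoint (legTwo α β (leftTri α β β) (ketTwo α β η)) ∘L T)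
    (hV.pentagon_comp_ketTwo ξ)
  rw [comp_comp_of_eq (hV.chain_αβα.braTwo_comp_assoc η),
    comp_comp_of_eq' (braTwo_comp_legOne hV.chain_βαh.symm.linked_leftTri
      hV.chain_αβα.linked_rightTri hV.intw_one η),
    adjoint_legTwo hV.linked hV.chain_αβα.linked_leftTri' (hV.chain_αβα.intw_ketTwo η),
    ← comp_assoc, ← legTwo_comp hV.linked hV.chain_αβα.linked_leftTri' hV.linked
      ((hV.chain_αβα.intw_ketTwo η).adjoint hV.linked hV.chain_αβα.linked_leftTri')
      (hV.intw_four.comp (hV.chain_αβh.intw_ketTwo ξ))] at this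
  rw [comulHat, comp_comp_of_eq hV.unitary.2, id_comp, braThirteen, comp_assoc]
  exact this

/-- The slices of `Δ̂` on the slices of `V`. -/
theorem bra_comp_comulHat (hV : IsPMU b α βh β V) (η : β) (ξ ξ' : α) :
    adjoint (ketTwo βh α ξ') ∘L comulHat α βh β V (slice22 α βh β V η ξ) =
      adjoint (ketTwo α β η) ∘L V ∘L legTwo βh α α (slice12 α βh β V ξ' ξ) := by
  rw [hV.comulHat_slice22, ← comp_assoc, hV.bra_comp_braThirteen, comp_assoc, comp_assoc,
    adjoint_legTwo hV.linked_hat hV.chain_αβαh.linked_rightTri.symm (hV.intw_ketOne ξ'),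
    ← legTwo_comp hV.linked_hat hV.chain_αβαh.linked_rightTri.symm hV.linked_hat
      ((hV.intw_ketOne ξ').adjoint hV.linked_hat hV.chain_αβαh.linked_rightTri.symm)
      (hV.intw_V_ketTwo ξ)]
  rfl

/-- The slices of `Δ` on the slices of `V`. -/
theorem bra_comp_comul (hV : IsPMU b α βh β V) (a : α) (c : βh) (η : β) :
    adjoint (ketTwo α β η) ∘L comul α βh β V (slice11 α βh β V a c) =
      adjoint (ketOne α β a) ∘L V ∘L flip α βh ∘L legTwo α β βh (slice21 α βh β V η c) := by
  -- Slice the pentagon in its first leg: on one side ⟨a|₁ passes V₂₃, on the other V₂₃ passes |c⟩₁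
  -- and leaves a factor V on the right.
  have h1 := congrArg (fun T => adjoint (ketOne α (leftTri α β β) a) ∘L T ∘L
    legOne βh (rightTri βh α βh) α (ketOne βh α c)) hV.pentagon'
  simp only [comp_assoc] at h1
  have i1 := (hV.chain_αβh.intw_ketOne a).adjoint hV.linked_hat.symm
    hV.chain_αβh.linked_rightTri.symm
  have i2 := (hV.chain_αβα.intw_ketOne a).adjoint hV.linked.symm
    hV.chain_αβα.linked_rightTri.symm
  rw [hV.chain_hhα.assoc_comp_legOne, legTwo_comp_ketOne hV.chain_hhα.linked_leftTri'
      hV.chain_αβαh.linked_rightTri.symm hV.intw_one',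
    comp_comp_of_eq (hV.chain_αβα.braOne_comp_assoc a),
    ← legOne_comp hV.linked_hat hV.chain_hhα.linked_rightTri hV.chain_αβh.linked_rightTri
      hV.intw_three (hV.chain_hhα.intw_ketOne c),
    comp_comp_of_eq' (braOne_comp_legTwo hV.chain_αβh.linked_leftTri'
      hV.chain_αβα.linked_leftTri' hV.intw_four a),
    comp_comp_of_eq (hV.chain_αβh.braOne_comp_assoc a),
    adjoint_legOne hV.linked_hat hV.chain_αβh.linked_rightTri (hV.chain_αβh.intw_ketOne a),
    adjoint_legOne hV.linked hV.chain_αβα.linked_rightTri (hV.chain_αβα.intw_ketOne a),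
    ← legOne_comp hV.linked_hat hV.chain_αβh.linked_rightTri hV.linked_hat i1
      (hV.intw_three.comp (hV.chain_hhα.intw_ketOne c))] at h1
  -- Cancelling that factor V gives Δ(⟨a|₁V|c⟩₁) = ⟨a|₁V₁₂V₁₃|c⟩₁.
  have h2 : comul α βh β V (slice11 α βh β V a c) =
      legOne (rightTri α β α) α β (adjoint (ketOne α β a)) ∘L
        legOne (leftTri βh α α) (rightTri α β α) β V ∘L pmuThirteen α βh β V ∘L
          ketOne βh (rightTri α β α) c := by
    refine hV.unitary.cancel_right ?_
    rw [comul, comp_assoc, comp_assoc, hV.unitary.1, comp_id]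
    simp only [comp_assoc]
    exact h1
  rw [h2, comp_comp_of_eq' (braTwo_comp_legOne hV.chain_αβα.linked_rightTri hV.linked i2 η),
    comp_comp_of_eq' (braTwo_comp_legOne hV.chain_βαh.symm.linked_leftTri
      hV.chain_αβα.linked_rightTri hV.intw_one η), ← hV.braThirteen_comp_ketOne, braThirteen,
    comp_assoc]

end IsPMU

end Pentagon

/-! ### Passage to closed spans for partially defined constructions -/

section Closures

set_option linter.unusedSectionVars false

/-- A bounded linear map on a closed subspace `D` that sends a subset `S` of `D` into a closed
subspace `P` sends `[S]` into `P`. -/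
theorem mem_of_mem_cspan_subtype {E F : Type*} [NormedAddCommGroup E] [NormedSpace ℂ E]
    [NormedAddCommGroup F] [NormedSpace ℂ F] {D : Submodule ℂ E} (hD : IsClosed (D : Set E))
    (g : D →L[ℂ] F) {S : Set E} {P : Submodule ℂ F} (hP : IsClosed (P : Set F))
    (h : ∀ s ∈ S, ∃ hs : s ∈ D, g ⟨s, hs⟩ ∈ P) {x : E} (hx : x ∈ cspan S) (hxD : x ∈ D) :
    g ⟨x, hxD⟩ ∈ P := by
  -- Q is the preimage of P under g, regarded inside E. It is closed in E because D is closed, so it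
  -- contains the closed span of S as soon as it contains S.
  let Q : Submodule ℂ E := (P.comap g.toLinearMap).map D.subtype
  have hQ : IsClosed (Q : Set E) := by
    have h1 : (Q : Set E) = Subtype.val '' (g ⁻¹' (P : Set F)) := rfl
    rw [h1]
    exact hD.isClosedEmbedding_subtypeVal.isClosedMap _ (hP.preimage g.continuous)
  have : x ∈ Q := cspan_le hQ (fun s hs => by
    obtain ⟨h1, h2⟩ := h s hs
    exact ⟨⟨s, h1⟩, h2, rfl⟩) hx
  obtain ⟨y, hy, rfl⟩ := this
  exact hy

variable {X Y : Type*} [NormedAddCommGroup X] [InnerProductSpace ℂ X] [CompleteSpace X]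
  [NormedAddCommGroup Y] [InnerProductSpace ℂ Y] [CompleteSpace Y]

/-- The space of adjoints of elements of `S`. -/
def adjSub (S : OpSpace X Y) : OpSpace Y X where
  carrier := {T | adjoint T ∈ S}
  add_mem' := fun {T T'} hT hT' => by
    rw [Set.mem_ofPred_eq, map_add]
    exact add_mem hT hT'
  zero_mem' := by rw [Set.mem_ofPred_eq, map_zero]; exact zero_mem S
  smul_mem' := fun c T hT => by
    rw [Set.mem_ofPred_eq, LinearIsometryEquiv.map_smulₛₗ]
    exact S.smul_mem _ hT

theorem mem_adjSub {S : OpSpace X Y} {T : Y →L[ℂ] X} : T ∈ adjSub S ↔ adjoint T ∈ S := Iff.rfl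

theorem isClosed_adjSub {S : OpSpace X Y} (hS : IsClosed (S : Set (X →L[ℂ] Y))) :
    IsClosed (adjSub S : Set (Y →L[ℂ] X)) :=
  hS.preimage (LinearIsometryEquiv.continuous _)

end Closures

section Partial

set_option linter.unusedSectionVars false

variable {𝔥 H K L : Type*}
  [NormedAddCommGroup 𝔥] [InnerProductSpace ℂ 𝔥] [CompleteSpace 𝔥]
  [NormedAddCommGroup H] [InnerProductSpace ℂ H] [CompleteSpace H]
  [NormedAddCommGroup K] [InnerProductSpace ℂ K] [CompleteSpace K]
  [NormedAddCommGroup L] [InnerProductSpace ℂ L] [CompleteSpace L]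
  {α : OpSpace 𝔥 H} {β : OpSpace 𝔥 K} {γ : OpSpace 𝔥 L}

/-- The space of all `T` that satisfy `Intw α β γ T`. -/
def intwSub (α : OpSpace 𝔥 H) (β : OpSpace 𝔥 K) (γ : OpSpace 𝔥 L) : OpSpace K L where
  carrier := {T | Intw α β γ T}
  add_mem' := fun {T T'} hT hT' ξ ξ' => by rw [add_comp, comp_add, hT, hT']
  zero_mem' := fun ξ ξ' => by rw [zero_comp, comp_zero]
  smul_mem' := fun c T hT ξ ξ' => by rw [smul_comp, comp_smul, hT]

theorem isClosed_intwSub (α : OpSpace 𝔥 H) (β : OpSpace 𝔥 K) (γ : OpSpace 𝔥 L) :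
    IsClosed (intwSub α β γ : Set (K →L[ℂ] L)) := by
  have : (intwSub α β γ : Set (K →L[ℂ] L)) = ⋂ ξ : α, ⋂ ξ' : α,
      {T | T ∘L rho β (adjoint (ξ : 𝔥 →L[ℂ] H) ∘L (ξ' : 𝔥 →L[ℂ] H)) =
        rho γ (adjoint (ξ : 𝔥 →L[ℂ] H) ∘L (ξ' : 𝔥 →L[ℂ] H)) ∘L T} := by
    ext T
    simp only [Set.mem_iInter]
    rfl
  rw [this]
  refine isClosed_iInter fun ξ => isClosed_iInter fun ξ' => isClosed_eq ?_ ?_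
  · exact ((compL ℂ K K L).flip _).continuous
  · exact (compL ℂ K L L _).continuous

/-- `legTwo` as a linear map. -/
def legTwoLin (h : Linked α β) (h' : Linked α γ) :
    intwSub α β γ →ₗ[ℂ] (RelTensor α β →L[ℂ] RelTensor α γ) where
  toFun T := legTwo α β γ T
  map_add' S T := legTwo_add h h' S.2 T.2
  map_smul' c T := legTwo_smul h h' c T.2

/-- `legTwo` as a bounded linear map. -/
def legTwoL (h : Linked α β) (h' : Linked α γ) :
    intwSub α β γ →L[ℂ] (RelTensor α β →L[ℂ] RelTensor α γ) where
  toLinearMap := legTwoLin h h'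
  cont := AddMonoidHomClass.continuous_of_bound (legTwoLin h h') 1 fun T => by
    rw [one_mul]
    exact norm_legTwo_le h h' T.2

/-- The operator 1 ⊗ k depends linearly and continuously on k only within the closed space of
intertwiners. For this reason every generator must be an intertwiner and not only the limit k. -/
theorem comp_legTwo_comp_mem {Y Z : Type*} [NormedAddCommGroup Y] [InnerProductSpace ℂ Y]
    [NormedAddCommGroup Z] [InnerProductSpace ℂ Z] (h : Linked α β) (h' : Linked α γ)
    (A : RelTensor α γ →L[ℂ] Z) (B : Y →L[ℂ] RelTensor α β) {P : OpSpace Y Z}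
    (hP : IsClosed (P : Set (Y →L[ℂ] Z))) {S : Set (K →L[ℂ] L)}
    (hS : ∀ k ∈ S, Intw α β γ k ∧ A ∘L legTwo α β γ k ∘L B ∈ P) {k : K →L[ℂ] L}
    (hk : k ∈ cspan S) (hk' : Intw α β γ k) : A ∘L legTwo α β γ k ∘L B ∈ P :=
  mem_of_mem_cspan_subtype (isClosed_intwSub α β γ)
    (compL ℂ Y (RelTensor α γ) Z A ∘L
      (compL ℂ Y (RelTensor α β) (RelTensor α γ)).flip B ∘L legTwoL h h') hP
    (fun s hs => ⟨(hS s hs).1, (hS s hs).2⟩) hk hk'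

/-- `1 ⊗ g η* = |g⟩₂ ⟨η|₂`. -/
theorem legTwo_ket_bra (h : Linked α β) (h' : Linked α γ) (g : γ) (η : β) :
    legTwo α β γ ((g : 𝔥 →L[ℂ] L) ∘L adjoint (η : 𝔥 →L[ℂ] K)) =
      ketTwo α γ g ∘L adjoint (ketTwo α β η) :=
  legTwo_eq h fun ξ => by
    rw [comp_assoc, adjoint_ketTwo_comp_ketOne h, ← comp_assoc, ← ketOne_comp h', comp_assoc]

theorem intw_ket_bra (h : Linked α β) (h' : Linked α γ) (g : γ) (η : β) :
    Intw α β γ ((g : 𝔥 →L[ℂ] L) ∘L adjoint (η : 𝔥 →L[ℂ] K)) := by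
  intro ξ ξ'
  have e : adjoint (η : 𝔥 →L[ℂ] K) ∘L
      rho β (adjoint (ξ : 𝔥 →L[ℂ] H) ∘L (ξ' : 𝔥 →L[ℂ] H)) =
      (adjoint (ξ : 𝔥 →L[ℂ] H) ∘L (ξ' : 𝔥 →L[ℂ] H)) ∘L adjoint (η : 𝔥 →L[ℂ] K) := by
    have hc := h.commutesInner ξ' ξ
    have := congrArg adjoint (rho_comp h.right hc η.2)
    rw [adjoint_comp (rho β _), adjoint_comp (η : 𝔥 →L[ℂ] K), inner_rho h.right hc,
      adjoint_comp (adjoint (ξ' : 𝔥 →L[ℂ] H)), adjoint_adjoint] at this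
    exact this
  rw [comp_assoc, e, comp_comp_of_eq (rho_comp h'.right (h'.commutesInner ξ ξ') g.2)]
  simp only [comp_assoc]

/-- The space of all `x` that commute with the inner products of elements of `α`. -/
def commSub (α : OpSpace 𝔥 H) : OpSpace 𝔥 𝔥 where
  carrier := {x | CommutesInner α x}
  add_mem' := fun {x y} hx hy ξ hξ ξ' hξ' ζ => by
    rw [add_apply, hx ξ hξ ξ' hξ', hy ξ hξ ξ' hξ', add_apply, map_add, map_add]
  zero_mem' := fun ξ hξ ξ' hξ' ζ => by
    rw [zero_apply, zero_apply, map_zero, map_zero]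
  smul_mem' := fun c x hx ξ hξ ξ' hξ' ζ => by
    rw [smul_apply, smul_apply, hx ξ hξ ξ' hξ', map_smul, map_smul]

theorem isClosed_commSub (α : OpSpace 𝔥 H) : IsClosed (commSub α : Set (𝔥 →L[ℂ] 𝔥)) := by
  have : (commSub α : Set (𝔥 →L[ℂ] 𝔥)) = ⋂ ξ : α, ⋂ ξ' : α,
      {x | x ∘L (adjoint (ξ : 𝔥 →L[ℂ] H) ∘L (ξ' : 𝔥 →L[ℂ] H)) =
        (adjoint (ξ : 𝔥 →L[ℂ] H) ∘L (ξ' : 𝔥 →L[ℂ] H)) ∘L x} := by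
    ext x
    simp only [Set.mem_iInter]
    exact ⟨fun h ξ ξ' => ContinuousLinearMap.ext fun ζ => h ξ ξ.2 ξ' ξ'.2 ζ,
      fun h ξ hξ ξ' hξ' ζ => DFunLike.congr_fun (h ⟨ξ, hξ⟩ ⟨ξ', hξ'⟩) ζ⟩
  rw [this]
  refine isClosed_iInter fun ξ => isClosed_iInter fun ξ' => isClosed_eq ?_ ?_
  · exact ((compL ℂ 𝔥 𝔥 𝔥).flip _).continuous
  · exact (compL ℂ 𝔥 𝔥 𝔥 _).continuous

/-- `rho` as a linear map. -/
def rhoLin (hα : vecSpan (α : Set (𝔥 →L[ℂ] H)) = ⊤) : commSub α →ₗ[ℂ] (H →L[ℂ] H) where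
  toFun x := rho α x
  map_add' x y := ext_of_vecSpan_eq_top hα fun ξ hξ ζ => by
    rw [rho_apply hα (x + y).2 hξ, add_apply, rho_apply hα x.2 hξ, rho_apply hα y.2 hξ,
      Submodule.coe_add, add_apply, map_add]
  map_smul' c x := ext_of_vecSpan_eq_top hα fun ξ hξ ζ => by
    rw [rho_apply hα (c • x).2 hξ, RingHom.id_apply, smul_apply, rho_apply hα x.2 hξ,
      Submodule.coe_smul, smul_apply, map_smul]

/-- `rho` as a bounded linear map. -/
def rhoL (hα : vecSpan (α : Set (𝔥 →L[ℂ] H)) = ⊤) : commSub α →L[ℂ] (H →L[ℂ] H) where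
  toLinearMap := rhoLin hα
  cont := AddMonoidHomClass.continuous_of_bound (rhoLin hα) 1 fun x => by
    rw [one_mul]
    exact norm_rho_le hα x.2

end Partial

section Slices

set_option linter.unusedSectionVars false

variable {𝔥 𝔨 H K : Type*}
  [NormedAddCommGroup 𝔥] [InnerProductSpace ℂ 𝔥] [CompleteSpace 𝔥]
  [NormedAddCommGroup 𝔨] [InnerProductSpace ℂ 𝔨] [CompleteSpace 𝔨]
  [NormedAddCommGroup H] [InnerProductSpace ℂ H] [CompleteSpace H]
  [NormedAddCommGroup K] [InnerProductSpace ℂ K] [CompleteSpace K]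
  {α : OpSpace 𝔥 H} {β : OpSpace 𝔥 K} {γ : OpSpace 𝔨 K}

theorem Acts.bra_comp_mem_leftTri (h : Acts α β γ) (hγ : IsClosed (γ : Set (𝔨 →L[ℂ] K))) (ξ : α)
    {c : 𝔨 →L[ℂ] RelTensor β α} (hc : c ∈ leftTri β α γ) :
    adjoint (ketTwo β α ξ) ∘L c ∈ γ :=
  map_mem_of_mem_opProd (compL ℂ 𝔨 (RelTensor β α) K (adjoint (ketTwo β α ξ))) hγ (by
    rintro _ ⟨ξ', rfl⟩ c hc
    rw [compL_apply, comp_comp_of_eq (adjoint_ketTwo_comp h.linked.symm ξ ξ')]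
    exact h.map ξ ξ' c hc) hc

theorem Acts.bra_comp_mem_rightTri (h : Acts α β γ) (hγ : IsClosed (γ : Set (𝔨 →L[ℂ] K))) (ξ : α)
    {c : 𝔨 →L[ℂ] RelTensor α β} (hc : c ∈ rightTri α β γ) :
    adjoint (ketOne α β ξ) ∘L c ∈ γ :=
  map_mem_of_mem_opProd (compL ℂ 𝔨 (RelTensor α β) K (adjoint (ketOne α β ξ))) hγ (by
    rintro _ ⟨ξ', rfl⟩ c hc
    rw [compL_apply, comp_comp_of_eq (adjoint_ketOne_comp h.linked ξ ξ')]
    exact h.map ξ ξ' c hc) hc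

/-- The relative tensor product is balanced: ξ ⊗ xζ ⊗ η and ξ ⊗ ζ ⊗ ηx are both |ξ⟩₁ applied to ηxζ.
-/
theorem ketTwo_comp_rho (h : Linked α β) {x : 𝔥 →L[ℂ] 𝔥} (hx : CommutesInner α x) {η η' : β}
    (hη : (η' : 𝔥 →L[ℂ] K) = (η : 𝔥 →L[ℂ] K) ∘L x) :
    ketTwo α β η ∘L rho α x = ketTwo α β η' :=
  ext_of_vecSpan_eq_top h.left fun ξ hξ ζ => by
    rw [comp_apply, rho_apply h.left hx hξ, ketTwo_apply h ⟨ξ, hξ⟩, ketTwo_apply h ⟨ξ, hξ⟩,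
      ← ketOne_apply h, ← ketOne_apply h, hη, comp_apply]

end Slices

/-! ### Regularity makes the left leg a C*-algebra -/

section LegHat

variable {𝔥 H : Type*}
  [NormedAddCommGroup 𝔥] [InnerProductSpace ℂ 𝔥] [CompleteSpace 𝔥]
  [NormedAddCommGroup H] [InnerProductSpace ℂ H] [CompleteSpace H]
  {b : CStarBase 𝔥} {α βh β : OpSpace 𝔥 H}
  {V : RelTensor βh α →L[ℂ] RelTensor α β}

theorem isClosed_legHat : IsClosed (legHat α βh β V : Set (H →L[ℂ] H)) := isClosed_opProd _ _

theorem slice22_mem (η : β) (ξ : α) : IsPMU.slice22 α βh β V η ξ ∈ legHat α βh β V :=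
  comp_mem_opProd ⟨_, ⟨η, rfl⟩, rfl⟩ ⟨_, ⟨ξ, rfl⟩, rfl⟩

theorem map_mem_of_mem_legHat {F : Type*} [NormedAddCommGroup F] [NormedSpace ℂ F]
    (Φ : (H →L[ℂ] H) →L[ℂ] F) {P : Submodule ℂ F} (hP : IsClosed (P : Set F))
    (h : ∀ η ξ, Φ (IsPMU.slice22 α βh β V η ξ) ∈ P) {y : H →L[ℂ] H}
    (hy : y ∈ legHat α βh β V) : Φ y ∈ P :=
  map_mem_of_mem_opProd Φ hP (by
    rintro _ ⟨_, ⟨η, rfl⟩, rfl⟩ _ ⟨_, ⟨ξ, rfl⟩, rfl⟩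
    exact h η ξ) hy

theorem legHat_le {P : OpSpace H H} (hP : IsClosed (P : Set (H →L[ℂ] H)))
    (h : ∀ η ξ, IsPMU.slice22 α βh β V η ξ ∈ P) : legHat α βh β V ≤ P :=
  fun _ hy => map_mem_of_mem_legHat (ContinuousLinearMap.id ℂ _) hP h hy

namespace IsPMU

theorem intw_of_mem_legHat (hV : IsPMU b α βh β V) {y : H →L[ℂ] H}
    (hy : y ∈ legHat α βh β V) : Intw α β β y :=
  legHat_le (isClosed_intwSub α β β) (fun η ξ => hV.intw_slice22 η ξ) hy

theorem slice22_comp_mem (hV : IsPMU b α βh β V) (η : β) (ξ : α) {η' : 𝔥 →L[ℂ] H}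
    (hη' : η' ∈ β) : slice22 α βh β V η ξ ∘L η' ∈ β := by
  rw [slice22, comp_assoc, comp_assoc]
  exact hV.chain_αβα.right.bra_comp_mem_leftTri hV.fact_β.closed η
    (hV.comp_mem_four (ketTwo_comp_mem ξ hη'))

theorem comp_mem_of_mem_legHat (hV : IsPMU b α βh β V) {y : H →L[ℂ] H}
    (hy : y ∈ legHat α βh β V) {η : 𝔥 →L[ℂ] H} (hη : η ∈ β) : y ∘L η ∈ β :=
  map_mem_of_mem_legHat ((compL ℂ 𝔥 H H).flip η) hV.fact_β.closed
    (fun η' ξ => hV.slice22_comp_mem η' ξ hη) hy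

/-- `β = [⟨β|₂ V |α⟩₂ β]`. -/
theorem le_opProd_slices (hV : IsPMU b α βh β V) :
    β ≤ opProd (Set.range fun p : β × α => slice22 α βh β V p.1 p.2) (β : Set (𝔥 →L[ℂ] H)) := by
  set Q := opProd (Set.range fun p : β × α => slice22 α βh β V p.1 p.2) (β : Set (𝔥 →L[ℂ] H))
  have hQ : IsClosed (Q : Set (𝔥 →L[ℂ] H)) := isClosed_opProd _ _
  have key : ∀ η η₁ η' : β, rho α (adjoint (η : 𝔥 →L[ℂ] H) ∘L (η₁ : 𝔥 →L[ℂ] H)) ∘L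
      (η' : 𝔥 →L[ℂ] H) ∈ Q := by
    intro η η₁ η'
    rw [← adjoint_ketTwo_comp hV.linked, comp_assoc]
    have h1 : ketTwo α β η₁ ∘L (η' : 𝔥 →L[ℂ] H) ∈ leftTri α β β := ketTwo_comp_mem η₁ η'.2
    -- By the fourth mapping condition |η₁⟩₂η' lies in V[|α⟩₂β], so applying ⟨η|₂ produces slices of
    -- V acting on β.
    rw [← SetLike.mem_coe, ← hV.map_four] at h1
    obtain ⟨w, hw, h1⟩ := h1
    rw [← h1]
    refine map_mem_of_mem_opProd (compL ℂ 𝔥 _ H (adjoint (ketTwo α β η)) ∘L compL ℂ 𝔥 _ _ V)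
      hQ ?_ hw
    rintro _ ⟨ξ, rfl⟩ η₂ hη₂
    exact comp_mem_opProd (s := slice22 α βh β V η ξ) ⟨(η, ξ), rfl⟩ hη₂
  intro η' hη'
  -- Compatibility gives β = [ρ_α(𝔅†)β] with 𝔅† = [β*β], and ρ_α(η*η₁) = ⟨η|₂|η₁⟩₂ reduces the claim
  -- to the case just treated.
  rw [← hV.compat_α_β.1] at hη'
  refine opProd_le hQ ?_ hη'
  rintro _ ⟨x, hx, rfl⟩ η hη
  have hx' : x ∈ (opProd (adjSet (β : Set (𝔥 →L[ℂ] H))) (β : Set (𝔥 →L[ℂ] H)) :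
      Set (𝔥 →L[ℂ] 𝔥)) := by
    rw [hV.fact_β.inner_eq]
    exact hx
  refine mem_of_mem_cspan_subtype (isClosed_commSub α)
    ((compL ℂ 𝔥 H H).flip η ∘L rhoL hV.fact_α.vec_eq) hQ ?_ hx'
    (hV.fact_α.commutesInner hx)
  rintro _ ⟨_, ⟨η₁, hη₁, rfl⟩, η₂, hη₂, rfl⟩
  exact ⟨hV.linked.symm.commutesInner ⟨η₁, hη₁⟩ ⟨η₂, hη₂⟩, key ⟨η₁, hη₁⟩ ⟨η₂, hη₂⟩ ⟨η, hη⟩⟩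

theorem vecSpan_legHat (hV : IsPMU b α βh β V) :
    vecSpan (legHat α βh β V : Set (H →L[ℂ] H)) = ⊤ := by
  refine eq_top_of_vecSpan hV.fact_β.vec_eq (isClosed_cspan _) fun η hη ζ => ?_
  refine map_mem_of_mem_opProd (apply ℂ H ζ) (isClosed_cspan _) ?_ (hV.le_opProd_slices hη)
  rintro _ ⟨p, rfl⟩ η' _
  exact apply_mem_vecSpan (SetLike.mem_coe.2 (slice22_mem p.1 p.2)) (η' ζ)

/-- With y = ⟨η|₂V|ξ'⟩₂, the left factor together with the middle one is ⟨ξ|₂Δ̂(y) by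
`bra_comp_comulHat`, and Δ̂(y)V* = V*(1 ⊗ y) moves y onto η'. The result is an adjoint slice. -/
theorem sandwich_slice12 (hV : IsPMU b α βh β V) (η η' η'' : β) (ξ ξ' : α)
    (hη : (η'' : 𝔥 →L[ℂ] H) = slice22 α βh β V η ξ' ∘L (η' : 𝔥 →L[ℂ] H)) :
    (adjoint (ketTwo α β η) ∘L V) ∘L legTwo βh α α (slice12 α βh β V ξ ξ') ∘L
      (adjoint V ∘L ketTwo α β η') = adjoint (V ∘L ketTwo βh α ξ) ∘L ketTwo α β η'' := by
  have h : comulHat α βh β V (slice22 α βh β V η ξ') ∘L adjoint V =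
      adjoint V ∘L legTwo α β β (slice22 α βh β V η ξ') := by
    rw [comulHat, comp_assoc, comp_assoc, hV.unitary.2, comp_id]
  rw [← comp_assoc, comp_assoc _ V, ← hV.bra_comp_comulHat η ξ' ξ, comp_assoc, comp_comp_of_eq h,
    comp_assoc, legTwo_comp_ketTwo hV.linked hV.linked (hV.intw_slice22 η ξ') hη, adjoint_comp,
    comp_assoc]

/-- Since 1 ⊗ ξξ'* = |ξ⟩₂⟨ξ'|₂, the compression splits into a slice times an adjoint slice.
Regularity allows this formula and `sandwich_slice12` to be interchanged inside closed subspaces. -/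
theorem sandwich_ket_bra (hV : IsPMU b α βh β V) (η η' : β) (ξ ξ' : α) :
    (adjoint (ketTwo α β η) ∘L V) ∘L
      legTwo βh α α ((ξ : 𝔥 →L[ℂ] H) ∘L adjoint (ξ' : 𝔥 →L[ℂ] H)) ∘L
      (adjoint V ∘L ketTwo α β η') =
      slice22 α βh β V η ξ ∘L adjoint (V ∘L ketTwo βh α ξ') ∘L ketTwo α β η' := by
  rw [legTwo_ket_bra hV.linked_hat hV.linked_hat, slice22, adjoint_comp]
  simp only [comp_assoc]

theorem adjoint_slice22 (η : β) (ξ : α) :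
    adjoint (slice22 α βh β V η ξ) = adjoint (V ∘L ketTwo βh α ξ) ∘L ketTwo α β η := by
  rw [slice22, adjoint_comp, adjoint_adjoint]

/-- Regularity approximates ξξ'* by combinations of slices ⟨ξ₁|₁V|ξ₂⟩₂, whose compressions are
adjoint slices. This is the inclusion [ÂÂ*] ⊆ Â*. -/
theorem sandwich_mem_of_isRegular (hV : IsPMU b α βh β V) (hr : IsRegular α βh β V)
    {P : OpSpace H H} (hP : IsClosed (P : Set (H →L[ℂ] H))) {η η' : β}
    (h : ∀ (η'' : β) (ξ : α), adjoint (slice22 α βh β V η'' ξ) ∈ P)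
    (ξ ξ' : α) : slice22 α βh β V η ξ ∘L adjoint (slice22 α βh β V η' ξ') ∈ P := by
  rw [adjoint_slice22, ← hV.sandwich_ket_bra]
  have hk := comp_mem_opProd ξ.2 (S := (α : Set (𝔥 →L[ℂ] H)))
    (T := adjSet (α : Set (𝔥 →L[ℂ] H))) ⟨_, ξ'.2, rfl⟩
  rw [← hr] at hk
  refine comp_legTwo_comp_mem hV.linked_hat hV.linked_hat _ _ hP ?_ hk
    (intw_ket_bra hV.linked_hat hV.linked_hat ξ ξ')
  rintro _ ⟨_, ⟨_, ⟨ξ₁, rfl⟩, rfl⟩, _, ⟨_, ⟨ξ₂, rfl⟩, rfl⟩, rfl⟩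
  refine ⟨hV.intw_slice12 ξ₁ ξ₂, ?_⟩
  have := h ⟨_, hV.slice22_comp_mem η ξ₂ η'.2⟩ ξ₁
  rw [adjoint_slice22, ← hV.sandwich_slice12 η η' _ ξ₁ ξ₂ rfl] at this
  exact this

/-- The other direction of regularity: ⟨ξ|₁V|ξ'⟩₂ is approximated by combinations of ξ₁ξ₂*. It
controls adjoint slices whose vector in β has the special form yη', which suffices because β = [Âβ].
-/
theorem adjoint_slice22_mem_of_isRegular (hV : IsPMU b α βh β V) (hr : IsRegular α βh β V)
    {P : OpSpace H H} (hP : IsClosed (P : Set (H →L[ℂ] H))) {η η' η'' : β}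
    (h : ∀ ξ ξ' : α, slice22 α βh β V η ξ ∘L adjoint (slice22 α βh β V η' ξ') ∈ P)
    (ξ ξ' : α) (hη : (η'' : 𝔥 →L[ℂ] H) = slice22 α βh β V η ξ' ∘L (η' : 𝔥 →L[ℂ] H)) :
    adjoint (V ∘L ketTwo βh α ξ) ∘L ketTwo α β η'' ∈ P := by
  rw [← hV.sandwich_slice12 η η' η'' ξ ξ' hη]
  have hk : slice12 α βh β V ξ ξ' ∈
      opProd (α : Set (𝔥 →L[ℂ] H)) (adjSet (α : Set (𝔥 →L[ℂ] H))) := by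
    rw [← hr]
    exact comp_mem_opProd ⟨_, ⟨ξ, rfl⟩, rfl⟩ ⟨_, ⟨ξ', rfl⟩, rfl⟩
  refine comp_legTwo_comp_mem hV.linked_hat hV.linked_hat _ _ hP ?_ hk (hV.intw_slice12 ξ ξ')
  rintro _ ⟨ξ₁, hξ₁, _, ⟨ξ₂, hξ₂, rfl⟩, rfl⟩
  refine ⟨intw_ket_bra hV.linked_hat hV.linked_hat ⟨ξ₁, hξ₁⟩ ⟨ξ₂, hξ₂⟩, ?_⟩
  have := h ⟨ξ₁, hξ₁⟩ ⟨ξ₂, hξ₂⟩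
  rw [adjoint_slice22, ← hV.sandwich_ket_bra] at this
  exact this

theorem comp_adjoint_mem (hV : IsPMU b α βh β V) (hr : IsRegular α βh β V) {y y' : H →L[ℂ] H}
    (hy : y ∈ legHat α βh β V) (hy' : y' ∈ legHat α βh β V) :
    y ∘L adjoint y' ∈ legHat α βh β V := by
  have hcl : IsClosed (adjSub (legHat α βh β V) : Set (H →L[ℂ] H)) :=
    isClosed_adjSub isClosed_legHat
  -- Taking adjoints reverses the product, so that each factor in turn appears linearly and can be
  -- extended from slices to all of Â.
  have h1 : ∀ η ξ, slice22 α βh β V η ξ ∘L adjoint y ∈ adjSub (legHat α βh β V) := by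
    intro η ξ
    rw [mem_adjSub, adjoint_comp, adjoint_adjoint]
    refine map_mem_of_mem_legHat ((compL ℂ H H H).flip (adjoint (slice22 α βh β V η ξ)))
      isClosed_legHat (fun η' ξ' => ?_) hy
    have := hV.sandwich_mem_of_isRegular hr hcl (η := η) (η' := η')
      (fun η₁ ξ₁ => by rw [mem_adjSub, adjoint_adjoint]; exact slice22_mem _ _) ξ ξ'
    rw [mem_adjSub, adjoint_comp, adjoint_adjoint] at this
    exact this
  have h2 : y' ∘L adjoint y ∈ adjSub (legHat α βh β V) :=
    map_mem_of_mem_legHat ((compL ℂ H H H).flip (adjoint y)) hcl h1 hy'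
  rwa [mem_adjSub, adjoint_comp, adjoint_adjoint] at h2

theorem adjoint_mem_opProd (hV : IsPMU b α βh β V) (hr : IsRegular α βh β V) {y : H →L[ℂ] H}
    (hy : y ∈ legHat α βh β V) :
    adjoint y ∈ opProd (legHat α βh β V : Set (H →L[ℂ] H))
      (adjSet (legHat α βh β V : Set (H →L[ℂ] H))) := by
  set Z := opProd (legHat α βh β V : Set (H →L[ℂ] H)) (adjSet (legHat α βh β V : Set (H →L[ℂ] H)))
  have hZ : IsClosed (Z : Set (H →L[ℂ] H)) := isClosed_opProd _ _
  have h1 : ∀ (η : β) (ξ : α), adjoint (slice22 α βh β V η ξ) ∈ Z := by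
    intro η ξ
    -- The adjoint slice is linear and continuous in η, so η may be taken from the generators of
    -- [Âβ] = β.
    have : ((compL ℂ H _ H (adjoint (V ∘L ketTwo βh α ξ))) ∘L ketTwoL hV.linked) η ∈ Z := by
      refine mem_of_mem_cspan_subtype hV.fact_β.closed _ hZ ?_ (hV.le_opProd_slices η.2) η.2
      rintro _ ⟨_, ⟨p, rfl⟩, η', hη', rfl⟩
      refine ⟨hV.slice22_comp_mem p.1 p.2 hη', ?_⟩
      have := hV.adjoint_slice22_mem_of_isRegular hr hZ (η := p.1) (η' := ⟨η', hη'⟩)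
        (η'' := ⟨_, hV.slice22_comp_mem p.1 p.2 hη'⟩)
        (fun ξ₁ ξ₂ => comp_mem_opProd (slice22_mem _ _) ⟨_, slice22_mem _ _, rfl⟩) ξ p.2 rfl
      rw [comp_apply, ketTwoL_apply, compL_apply]
      exact this
    rw [comp_apply, ketTwoL_apply, compL_apply] at this
    rw [adjoint_slice22]
    exact this
  exact legHat_le (isClosed_adjSub hZ) h1 hy

/-- Combine Â* ⊆ [ÂÂ*] with [ÂÂ*] ⊆ Â. -/
theorem adjoint_mem_legHat (hV : IsPMU b α βh β V) (hr : IsRegular α βh β V) {y : H →L[ℂ] H}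
    (hy : y ∈ legHat α βh β V) : adjoint y ∈ legHat α βh β V := by
  have h1 : opProd (legHat α βh β V : Set (H →L[ℂ] H))
      (adjSet (legHat α βh β V : Set (H →L[ℂ] H))) ≤ adjSub (adjSub (legHat α βh β V)) := by
    refine opProd_le (isClosed_adjSub (isClosed_adjSub isClosed_legHat)) ?_
    rintro s hs _ ⟨t, ht, rfl⟩
    rw [mem_adjSub, mem_adjSub, adjoint_adjoint]
    exact hV.comp_adjoint_mem hr hs ht
  have h2 := h1 (hV.adjoint_mem_opProd hr hy)
  rwa [mem_adjSub, mem_adjSub, adjoint_adjoint] at h2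

theorem isNondegCStarAlg_legHat (hV : IsPMU b α βh β V) (hr : IsRegular α βh β V) :
    IsNondegCStarAlg (legHat α βh β V) where
  closed := isClosed_legHat
  mul_mem x hx y hy := by
    have := hV.comp_adjoint_mem hr hx (hV.adjoint_mem_legHat hr hy)
    rwa [adjoint_adjoint] at this
  adjoint_mem _ hx := hV.adjoint_mem_legHat hr hx
  nondeg := hV.vecSpan_legHat

/-- By balancing, ρ_α(x)⟨η|₂ = ⟨ηx*|₂, and ηx* stays in β. -/
theorem rho_comp_slice22_mem (hV : IsPMU b α βh β V) {x : 𝔥 →L[ℂ] 𝔥} (hx : x ∈ b.Bd) (η : β)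
    (ξ : α) : rho α x ∘L slice22 α βh β V η ξ ∈ legHat α βh β V := by
  have hc := hV.fact_α.commutesInner hx
  have h := ketTwo_comp_rho hV.linked hc.adjoint (η := η)
    (η' := ⟨_, hV.fact_β.comp_mem η.2 (x := adjoint x) (star_mem hx)⟩) rfl
  have h' := congrArg adjoint h
  rw [adjoint_comp, inner_rho hV.linked.left hc.adjoint, adjoint_adjoint] at h'
  rw [slice22, comp_comp_of_eq h']
  exact slice22_mem _ ξ

end IsPMU
end LegHat

section RhoKets

set_option linter.unusedSectionVars false

variable {𝔥 𝔨 H K : Type*}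
  [NormedAddCommGroup 𝔥] [InnerProductSpace ℂ 𝔥] [CompleteSpace 𝔥]
  [NormedAddCommGroup 𝔨] [InnerProductSpace ℂ 𝔨] [CompleteSpace 𝔨]
  [NormedAddCommGroup H] [InnerProductSpace ℂ H] [CompleteSpace H]
  [NormedAddCommGroup K] [InnerProductSpace ℂ K] [CompleteSpace K]
  {α : OpSpace 𝔥 H} {β : OpSpace 𝔥 K} {γ : OpSpace 𝔨 K}

theorem Acts.rho_rightTri_comp_ketTwo (h : Acts α β γ) {x : 𝔨 →L[ℂ] 𝔨} (hx : CommutesInner γ x)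
    {η η' : β} (hη : (η' : 𝔥 →L[ℂ] K) = rho γ x ∘L (η : 𝔥 →L[ℂ] K)) :
    rho (rightTri α β γ) x ∘L ketTwo α β η = ketTwo α β η' :=
  ext_of_vecSpan_eq_top h.linked.left fun ξ hξ ζ => by
    rw [comp_apply, ketTwo_apply h.linked ⟨ξ, hξ⟩, ketTwo_apply h.linked ⟨ξ, hξ⟩,
      ← ketOne_apply h.linked, ← ketOne_apply h.linked, hη, ← comp_apply, h.rho_rightTri hx,
      comp_apply, comp_apply]

theorem comp_ketTwo_mem {Z : Type*} [NormedAddCommGroup Z] [InnerProductSpace ℂ Z]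
    (h : Linked α β) (hβ : IsClosed (β : Set (𝔥 →L[ℂ] K))) (A : RelTensor α β →L[ℂ] Z)
    {P : OpSpace H Z} (hP : IsClosed (P : Set (H →L[ℂ] Z))) {S : Set (𝔥 →L[ℂ] K)}
    (hS : ∀ η ∈ S, ∃ hη : η ∈ β, A ∘L ketTwo α β ⟨η, hη⟩ ∈ P) {η : 𝔥 →L[ℂ] K}
    (hη : η ∈ cspan S) (hη' : η ∈ β) : A ∘L ketTwo α β ⟨η, hη'⟩ ∈ P := by
  have := mem_of_mem_cspan_subtype hβ
    (compL ℂ H (RelTensor α β) Z A ∘L ketTwoL h) hP (S := S) (P := P) (fun η hη => ?_) hη hη'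
  · rwa [comp_apply, compL_apply, ketTwoL_apply] at this
  · obtain ⟨h1, h2⟩ := hS η hη
    refine ⟨h1, ?_⟩
    rwa [comp_apply, compL_apply, ketTwoL_apply]

end RhoKets

/-! ### The comultiplication of the left leg as a morphism into the fiber product -/

section HopfHat

variable {𝔥 H : Type*}
  [NormedAddCommGroup 𝔥] [InnerProductSpace ℂ 𝔥] [CompleteSpace 𝔥]
  [NormedAddCommGroup H] [InnerProductSpace ℂ H] [CompleteSpace H]
  {b : CStarBase 𝔥} {α βh β : OpSpace 𝔥 H}
  {V : RelTensor βh α →L[ℂ] RelTensor α β}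

namespace IsPMU

/-- By the second mapping condition V carries the action of x through ρ_β on the second leg of its
domain to the action through ρ_β̂ on the first leg of its range. Thus ρ_β̂(x) is absorbed into the
ket as ρ_β(x)ξ, which lies in α by compatibility. -/
theorem rho_hat_comp_slice22_mem (hV : IsPMU b α βh β V) {x : 𝔥 →L[ℂ] 𝔥} (hx : x ∈ b.B) (η : β)
    (ξ : α) : rho βh x ∘L slice22 α βh β V η ξ ∈ legHat α βh β V := by
  have hc := hV.fact_βh.commutesInner hx
  have hc' := hV.fact_β.commutesInner hx
  have hL := hV.chain_βαh.left
  have hR := hV.chain_hαβ.left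
  have h1 : rho βh x ∘L adjoint (ketTwo α β η) =
      adjoint (ketTwo α β η) ∘L rho (leftTri α β βh) x := by
    have := congrArg adjoint (hL.rho_leftTri hc.adjoint η)
    rw [adjoint_comp, adjoint_comp, inner_rho hV.fact_βh.vec_eq hc.adjoint, adjoint_adjoint,
      inner_rho hL.vecSpan_leftTri (hL.commutesInner_leftTri hc.adjoint), adjoint_adjoint] at this
    exact this.symm
  have hξ : rho β x ∘L (ξ : 𝔥 →L[ℂ] H) ∈ α := by
    have := comp_mem_opProd (S := rho β '' (b.op.Bd : Set (𝔥 →L[ℂ] 𝔥))) ⟨x, hx, rfl⟩ ξ.2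
    rwa [hV.compat_α_β.2] at this
  have h2 : V ∘L rho (rightTri βh α β) x = rho (leftTri α β βh) x ∘L V :=
    rho_intertwine hR.vecSpan_rightTri hL.vecSpan_leftTri (fun _ hT => hV.comp_mem_two hT)
      (hR.commutesInner_rightTri hc') (hL.commutesInner_leftTri hc)
  rw [slice22, comp_comp_of_eq' h1, comp_comp_of_eq' h2.symm,
    hR.rho_rightTri_comp_ketTwo hc' (η := ξ) (η' := ⟨_, hξ⟩) rfl]
  exact slice22_mem _ _

theorem isConcreteAlg_legHat_right (hV : IsPMU b α βh β V) (hr : IsRegular α βh β V) :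
    IsConcreteAlg b (legHat α βh β V) α where
  alg := hV.isNondegCStarAlg_legHat hr
  fact := hV.fact_α
  rho_mul x hx _ ha := map_mem_of_mem_legHat (compL ℂ H H H (rho α x)) isClosed_legHat
    (fun η ξ => hV.rho_comp_slice22_mem hx η ξ) ha

theorem isConcreteAlg_legHat_left (hV : IsPMU b α βh β V) (hr : IsRegular α βh β V) :
    IsConcreteAlg b.op (legHat α βh β V) βh where
  alg := hV.isNondegCStarAlg_legHat hr
  fact := hV.fact_βh
  rho_mul x hx _ ha := map_mem_of_mem_legHat (compL ℂ H H H (rho βh x)) isClosed_legHat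
    (fun η ξ => hV.rho_hat_comp_slice22_mem hx η ξ) ha

theorem comulHat_comp_mem (hV : IsPMU b α βh β V) {Z : Type*} [NormedAddCommGroup Z]
    [InnerProductSpace ℂ Z] (B : Z →L[ℂ] RelTensor βh α) {P : OpSpace Z (RelTensor βh α)}
    (hP : IsClosed (P : Set (Z →L[ℂ] RelTensor βh α)))
    (h : ∀ η ξ, comulHat α βh β V (slice22 α βh β V η ξ) ∘L B ∈ P) {y : H →L[ℂ] H}
    (hy : y ∈ legHat α βh β V) : comulHat α βh β V y ∘L B ∈ P := by
  have e : ∀ y, comulHat α βh β V y ∘L B = adjoint V ∘L legTwo α β β y ∘L (V ∘L B) := by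
    intro y
    simp only [comulHat, comp_assoc]
  rw [e]
  refine comp_legTwo_comp_mem hV.linked hV.linked _ _ hP ?_ hy (hV.intw_of_mem_legHat hy)
  rintro _ ⟨_, ⟨_, ⟨η, rfl⟩, rfl⟩, _, ⟨_, ⟨ξ, rfl⟩, rfl⟩, rfl⟩
  refine ⟨hV.intw_slice22 η ξ, ?_⟩
  have := h η ξ
  rw [e] at this
  exact this

/-- In Δ̂(y) = ⟨η|₃V₁₃V₂₃|ξ⟩₃, the first mapping condition puts V|ξ⟩₂ξ' into [|α⟩₁α]. Then V₁₃
leaves the new second-leg vector ξ₁ alone, and |ξ₁⟩₂⟨η|₂V|ξ₂⟩₂ remains. Regularity is not needed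
here. -/
theorem comulHat_comp_ketTwo_mem (hV : IsPMU b α βh β V) {y : H →L[ℂ] H}
    (hy : y ∈ legHat α βh β V) (ξ' : α) :
    comulHat α βh β V y ∘L ketTwo βh α ξ' ∈
      opProd (ketsTwo βh α) (legHat α βh β V : Set (H →L[ℂ] H)) := by
  refine hV.comulHat_comp_mem _ (isClosed_opProd _ _) (fun η ξ => ?_) hy
  have hw : V ∘L ketTwo βh α ξ ∘L (ξ' : 𝔥 →L[ℂ] H) ∈ rightTri α β α :=
    hV.comp_mem_one (ketTwo_comp_mem ξ ξ'.2)
  rw [hV.comulHat_slice22, comp_assoc, legTwo_comp_ketTwo hV.linked_hat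
    hV.chain_αβαh.linked_rightTri.symm (hV.intw_V_ketTwo ξ) (η := ξ') (η' := ⟨_, hw⟩) rfl]
  refine comp_ketTwo_mem hV.chain_αβαh.linked_rightTri.symm
    (isClosed_opProd (ketsOne α β) (α : Set (𝔥 →L[ℂ] H))) _
    (isClosed_opProd (ketsTwo βh α) (legHat α βh β V : Set (H →L[ℂ] H))) ?_ hw hw
  rintro _ ⟨_, ⟨ξ₁, rfl⟩, ξ₂, hξ₂, rfl⟩
  refine ⟨ketOne_comp_mem ξ₁ hξ₂, ?_⟩
  have := legTwo_comp_ketTwo hV.linked_hat hV.chain_αβαh.linked_rightTri.symm (hV.intw_ketOne ξ₁)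
    (η := ⟨ξ₂, hξ₂⟩) (η' := ⟨_, ketOne_comp_mem ξ₁ hξ₂⟩) rfl
  have h2 : braThirteen α βh β V η ∘L ketTwo βh (rightTri α β α) ⟨_, ketOne_comp_mem ξ₁ hξ₂⟩ =
      ketTwo βh α ξ₁ ∘L slice22 α βh β V η ⟨ξ₂, hξ₂⟩ := by
    rw [← this, ← comp_assoc, hV.braThirteen_comp_legTwo, slice22]
    simp only [comp_assoc]
  have h3 : ketTwo βh α ξ₁ ∘L slice22 α βh β V η ⟨ξ₂, hξ₂⟩ ∈
      opProd (ketsTwo βh α) (legHat α βh β V : Set (H →L[ℂ] H)) :=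
    comp_mem_opProd ⟨_, rfl⟩ (slice22_mem _ _)
  rw [← h2] at h3
  exact h3

/-- The regularity condition `[⟨β|₂ V |β̂⟩₁] = [β̂ β*]`. -/
def Coregular (α βh β : OpSpace 𝔥 H) (V : RelTensor βh α →L[ℂ] RelTensor α β) : Prop :=
  opProd (adjSet (ketsTwo α β)) (leftMul V (ketsOne βh α)) =
    opProd (βh : Set (𝔥 →L[ℂ] H)) (adjSet (β : Set (𝔥 →L[ℂ] H)))

/-- Here Δ̂(y)|c⟩₁ = Σ(1 ⊗ ⟨η|₂V|c⟩₁)V|ξ⟩₂. Coregularity approximates the inner slice by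
combinations of c'η'*, and each such term becomes |c'⟩₁⟨η'|₂V|ξ⟩₂. -/
theorem comulHat_comp_ketOne_mem (hV : IsPMU b α βh β V) (hc : Coregular α βh β V)
    {y : H →L[ℂ] H} (hy : y ∈ legHat α βh β V) (c : βh) :
    comulHat α βh β V y ∘L ketOne βh α c ∈
      opProd (ketsOne βh α) (legHat α βh β V : Set (H →L[ℂ] H)) := by
  refine hV.comulHat_comp_mem _ (isClosed_opProd _ _) (fun η ξ => ?_) hy
  rw [hV.comulHat_slice22, comp_assoc, legTwo_comp_ketOne hV.linked_hat
    hV.chain_αβαh.linked_rightTri.symm (hV.intw_V_ketTwo ξ),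
    comp_comp_of_eq (hV.braThirteen_comp_ketOne η c), comp_assoc]
  have hk : slice21 α βh β V η c ∈
      opProd (βh : Set (𝔥 →L[ℂ] H)) (adjSet (β : Set (𝔥 →L[ℂ] H))) := by
    rw [← hc]
    exact comp_mem_opProd ⟨_, ⟨η, rfl⟩, rfl⟩ ⟨_, ⟨c, rfl⟩, rfl⟩
  refine comp_legTwo_comp_mem hV.linked hV.linked_hat.symm _ _ (isClosed_opProd _ _) ?_ hk
    (hV.intw_slice21 η c)
  rintro _ ⟨c', hc', _, ⟨η', hη', rfl⟩, rfl⟩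
  refine ⟨intw_ket_bra hV.linked hV.linked_hat.symm ⟨c', hc'⟩ ⟨η', hη'⟩, ?_⟩
  have h2 : flip α βh ∘L legTwo α β βh (c' ∘L adjoint η') ∘L (V ∘L ketTwo βh α ξ) =
      ketOne βh α ⟨c', hc'⟩ ∘L slice22 α βh β V ⟨η', hη'⟩ ξ := by
    rw [legTwo_ket_bra hV.linked hV.linked_hat.symm ⟨c', hc'⟩ ⟨η', hη'⟩, comp_assoc,
      comp_comp_of_eq (flip_comp_ketTwo hV.linked_hat.symm _), slice22]
  rw [h2]
  exact comp_mem_opProd ⟨_, rfl⟩ (slice22_mem _ _)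

theorem adjoint_comulHat (hV : IsPMU b α βh β V) {y : H →L[ℂ] H} (hy : Intw α β β y) :
    comulHat α βh β V (adjoint y) = adjoint (comulHat α βh β V y) := by
  rw [comulHat, comulHat, adjoint_comp, adjoint_comp, adjoint_adjoint,
    adjoint_legTwo hV.linked hV.linked hy, comp_assoc]

theorem isStarHomOn_comulHat (hV : IsPMU b α βh β V) (hr : IsRegular α βh β V)
    (hc : Coregular α βh β V) :
    IsStarHomOn (legHat α βh β V) (fiberProd (legHat α βh β V : Set (H →L[ℂ] H)) βh
      (legHat α βh β V : Set (H →L[ℂ] H)) α) (comulHat α βh β V) where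
  mapsTo y hy := by
    have hy' := hV.adjoint_mem_legHat hr hy
    have e := hV.adjoint_comulHat (hV.intw_of_mem_legHat hy)
    constructor
    · rintro _ ⟨c, rfl⟩
      rw [← e]
      exact ⟨hV.comulHat_comp_ketOne_mem hc hy c, hV.comulHat_comp_ketOne_mem hc hy' c⟩
    · rintro _ ⟨ξ, rfl⟩
      rw [← e]
      exact ⟨hV.comulHat_comp_ketTwo_mem hy ξ, hV.comulHat_comp_ketTwo_mem hy' ξ⟩
  map_add x hx y hy := by
    rw [comulHat, legTwo_add hV.linked hV.linked (hV.intw_of_mem_legHat hx)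
      (hV.intw_of_mem_legHat hy), add_comp, comp_add, comulHat, comulHat]
  map_smul c x hx := by
    rw [comulHat, legTwo_smul hV.linked hV.linked c (hV.intw_of_mem_legHat hx), smul_comp,
      comp_smul, comulHat]
  map_mul x hx y hy := by
    rw [comulHat, legTwo_comp hV.linked hV.linked hV.linked (hV.intw_of_mem_legHat hx)
      (hV.intw_of_mem_legHat hy), comulHat, comulHat, comp_assoc, comp_assoc, comp_assoc,
      comp_comp_of_eq hV.unitary.2, id_comp]
  map_adjoint x hx := hV.adjoint_comulHat (hV.intw_of_mem_legHat hx)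

/-- Since (1 ⊗ a)|ξ⟩₁ = |ξ⟩₁a and VV* = 1, one has Δ̂(a)V*|ξ⟩₁ = V*|ξ⟩₁a. -/
theorem adjoint_comp_ketOne_mem_intertwiners (hV : IsPMU b α βh β V) (ξ : α) :
    adjoint V ∘L ketOne α β ξ ∈ intertwiners (legHat α βh β V) (comulHat α βh β V) := by
  intro a ha
  rw [comulHat, comp_assoc, comp_assoc, comp_assoc, comp_comp_of_eq hV.unitary.2, id_comp,
    legTwo_comp_ketOne hV.linked hV.linked (hV.intw_of_mem_legHat ha)]

theorem adjoint_comp_mem {T : OpSpace 𝔥 (RelTensor βh α)} {R : OpSpace 𝔥 (RelTensor α β)}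
    (hV : IsPMU b α βh β V) (h : leftMul V (T : Set (𝔥 →L[ℂ] RelTensor βh α)) = R)
    {w : 𝔥 →L[ℂ] RelTensor α β} (hw : w ∈ R) : adjoint V ∘L w ∈ T := by
  rw [← SetLike.mem_coe, ← h] at hw
  obtain ⟨t, ht, rfl⟩ := hw
  rw [← comp_assoc, hV.unitary.1, id_comp]
  exact ht

theorem adjoint_comp_ketOne_mem_factHom (hV : IsPMU b α βh β V) {γ : OpSpace 𝔥 H}
    {T : OpSpace 𝔥 (RelTensor βh α)} (h : Acts α β γ) (hγ : IsClosed (γ : Set (𝔥 →L[ℂ] H)))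
    (hT : leftMul V (T : Set (𝔥 →L[ℂ] RelTensor βh α)) = rightTri α β γ) (ξ : α) :
    adjoint V ∘L ketOne α β ξ ∈ factHom γ T := by
  constructor
  · intro c hc
    rw [comp_assoc]
    exact hV.adjoint_comp_mem hT (ketOne_comp_mem ξ hc)
  · intro w hw
    rw [adjoint_comp, adjoint_adjoint, comp_assoc]
    refine h.bra_comp_mem_rightTri hγ ξ ?_
    rw [← SetLike.mem_coe, ← hT]
    exact ⟨w, hw, rfl⟩

/-- The intertwiners V*|ξ⟩₁ alone already fill T, since V*[|α⟩₁γ] = V*(α ▷ γ) = T. The mapping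
conditions for V supply the two pairs (γ, T) that are needed. -/
theorem opProd_intertwiners_comulHat (hV : IsPMU b α βh β V) {γ : OpSpace 𝔥 H}
    {T : OpSpace 𝔥 (RelTensor βh α)} (h : Acts α β γ) (hγ : IsClosed (γ : Set (𝔥 →L[ℂ] H)))
    (hTc : IsClosed (T : Set (𝔥 →L[ℂ] RelTensor βh α)))
    (hT : leftMul V (T : Set (𝔥 →L[ℂ] RelTensor βh α)) = rightTri α β γ) :
    opProd (factHom γ T ∩ intertwiners (legHat α βh β V) (comulHat α βh β V))
      (γ : Set (𝔥 →L[ℂ] H)) = T := by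
  refine le_antisymm (opProd_le hTc fun s hs t ht => hs.1.1 t ht) fun t ht => ?_
  have hw : V ∘L t ∈ rightTri α β γ := by
    rw [← SetLike.mem_coe, ← hT]
    exact ⟨t, ht, rfl⟩
  have e : t = adjoint V ∘L V ∘L t := by rw [← comp_assoc, hV.unitary.1, id_comp]
  rw [e]
  refine map_mem_of_mem_opProd (compL ℂ 𝔥 _ _ (adjoint V)) (isClosed_opProd _ _) ?_ hw
  rintro _ ⟨ξ, rfl⟩ c hc
  exact comp_mem_opProd (s := adjoint V ∘L ketOne α β ξ)
    ⟨hV.adjoint_comp_ketOne_mem_factHom h hγ hT ξ, hV.adjoint_comp_ketOne_mem_intertwiners ξ⟩ hc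

theorem isMorphism_comulHat_left (hV : IsPMU b α βh β V) (hr : IsRegular α βh β V)
    (hc : Coregular α βh β V) :
    IsMorphism (legHat α βh β V) βh (fiberProd (legHat α βh β V : Set (H →L[ℂ] H)) βh
      (legHat α βh β V : Set (H →L[ℂ] H)) α) (rightTri βh α βh) (comulHat α βh β V) :=
  ⟨hV.isStarHomOn_comulHat hr hc, hV.opProd_intertwiners_comulHat hV.chain_αβh.left
    hV.fact_βh.closed (isClosed_opProd _ _) hV.map_three⟩

theorem isMorphism_comulHat_right (hV : IsPMU b α βh β V) (hr : IsRegular α βh β V)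
    (hc : Coregular α βh β V) :
    IsMorphism (legHat α βh β V) α (fiberProd (legHat α βh β V : Set (H →L[ℂ] H)) βh
      (legHat α βh β V : Set (H →L[ℂ] H)) α) (leftTri βh α α) (comulHat α βh β V) :=
  ⟨hV.isStarHomOn_comulHat hr hc, hV.opProd_intertwiners_comulHat hV.chain_αβα.left
    hV.fact_α.closed (isClosed_opProd _ _) hV.map_one⟩

end IsPMU
end HopfHat

/-! ### Tensor products of intertwiners and elements of fiber products -/

section FiberMap

set_option linter.unusedSectionVars false

variable {𝔥 H K L M : Type*}
  [NormedAddCommGroup 𝔥] [InnerProductSpace ℂ 𝔥] [CompleteSpace 𝔥]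
  [NormedAddCommGroup H] [InnerProductSpace ℂ H] [CompleteSpace H]
  [NormedAddCommGroup K] [InnerProductSpace ℂ K] [CompleteSpace K]
  [NormedAddCommGroup L] [InnerProductSpace ℂ L] [CompleteSpace L]
  [NormedAddCommGroup M] [InnerProductSpace ℂ M] [CompleteSpace M]
  {α : OpSpace 𝔥 H} {β : OpSpace 𝔥 K} {γ : OpSpace 𝔥 L} {δ : OpSpace 𝔥 M}

theorem opOf_eq_zero_or {X Y : Type*} [NormedAddCommGroup X] [InnerProductSpace ℂ X]
    [NormedAddCommGroup Y] [InnerProductSpace ℂ Y] (G : Set (X × Y)) :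
    opOf G = 0 ∨ ∀ p ∈ G, opOf G p.1 = p.2 := by
  by_cases h : ∃ T : X →L[ℂ] Y, ∀ p ∈ G, T p.1 = p.2
  · exact Or.inr fun p hp => opOf_apply h.choose h.choose_spec hp
  · exact Or.inl (dif_neg h)

/-- This alternative makes it unnecessary to show that S ⊗ T exists: in the degenerate case it is 0
by default, and every relation required of it is trivial. -/
theorem tensorRight_eq_zero_or (S : H →L[ℂ] L) (T : K →L[ℂ] M) :
    tensorRight α β γ δ S T = 0 ∨ ∀ (η : β) (η' : δ),
      (η' : 𝔥 →L[ℂ] M) = T ∘L (η : 𝔥 →L[ℂ] K) →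
      tensorRight α β γ δ S T ∘L ketTwo α β η = ketTwo γ δ η' ∘L S := by
  refine (opOf_eq_zero_or _).imp id fun h η η' hη => ContinuousLinearMap.ext fun v => ?_
  exact h (ketTwo α β η v, ketTwo γ δ η' (S v)) ⟨η, η', v, hη, rfl⟩

theorem tensorLeft_eq_zero_or (S : H →L[ℂ] L) (T : K →L[ℂ] M) :
    tensorLeft α β γ δ S T = 0 ∨ ∀ (ξ : α) (ξ' : γ),
      (ξ' : 𝔥 →L[ℂ] L) = S ∘L (ξ : 𝔥 →L[ℂ] H) →
      tensorLeft α β γ δ S T ∘L ketOne α β ξ = ketOne γ δ ξ' ∘L T := by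
  refine (opOf_eq_zero_or _).imp id fun h ξ ξ' hξ => ContinuousLinearMap.ext fun v => ?_
  exact h (ketOne α β ξ v, ketOne γ δ ξ' (T v)) ⟨ξ, ξ', v, hξ, rfl⟩

/-- The value of `fiberMap` is a chosen solution of the intertwining relations, so identifying it
takes a solution together with uniqueness. -/
theorem fiberMap_eq {A : OpSpace H H} {B : OpSpace K K} {φ : (H →L[ℂ] H) → (L →L[ℂ] L)}
    {ψ : (K →L[ℂ] K) → (M →L[ℂ] M)} {T : RelTensor α β →L[ℂ] RelTensor α β}
    {R : RelTensor γ δ →L[ℂ] RelTensor γ δ}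
    (h1 : ∀ X ∈ intertwiners A φ, ∀ Y ∈ factHom β δ ∩ intertwiners B ψ,
      R ∘L tensorRight α β γ δ X Y = tensorRight α β γ δ X Y ∘L T)
    (h2 : ∀ X ∈ factHom α γ ∩ intertwiners A φ, ∀ Y ∈ intertwiners B ψ,
      R ∘L tensorLeft α β γ δ X Y = tensorLeft α β γ δ X Y ∘L T)
    (h3 : ∀ R' : RelTensor γ δ →L[ℂ] RelTensor γ δ,
      (∀ X ∈ intertwiners A φ, ∀ Y ∈ factHom β δ ∩ intertwiners B ψ,
        R' ∘L tensorRight α β γ δ X Y = tensorRight α β γ δ X Y ∘L T) →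
      (∀ X ∈ factHom α γ ∩ intertwiners A φ, ∀ Y ∈ intertwiners B ψ,
        R' ∘L tensorLeft α β γ δ X Y = tensorLeft α β γ δ X Y ∘L T) → R' = R) :
    fiberMap A α B β γ δ φ ψ T = R := by
  have h : ∃ R : RelTensor γ δ →L[ℂ] RelTensor γ δ,
      (∀ X ∈ intertwiners A φ, ∀ Y ∈ factHom β δ ∩ intertwiners B ψ,
        R ∘L tensorRight α β γ δ X Y = tensorRight α β γ δ X Y ∘L T) ∧
      (∀ X ∈ factHom α γ ∩ intertwiners A φ, ∀ Y ∈ intertwiners B ψ,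
        R ∘L tensorLeft α β γ δ X Y = tensorLeft α β γ δ X Y ∘L T) := ⟨R, h1, h2⟩
  rw [fiberMap, dif_pos h]
  exact h3 _ h.choose_spec.1 h.choose_spec.2

theorem id_mem_intertwiners (A : OpSpace H H) :
    ContinuousLinearMap.id ℂ H ∈ intertwiners A _root_.id :=
  fun a _ => by rw [id_comp, _root_.id, comp_id]

theorem id_mem_factHom (α : OpSpace 𝔥 H) : ContinuousLinearMap.id ℂ H ∈ factHom α α := by
  refine ⟨fun ξ hξ => by rwa [id_comp], fun ξ hξ => ?_⟩
  rwa [adjoint_id, id_comp]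

/-- Elements of a fiber product commute with `S ⊗ Y` for `S` and `Y` in the commutants. -/
theorem commute_fiber_right (h : Linked α β) {A : OpSpace H H} {B : OpSpace K K}
    {T : RelTensor α β →L[ℂ] RelTensor α β}
    (hT : T ∈ fiberProd (A : Set (H →L[ℂ] H)) α (B : Set (K →L[ℂ] K)) β)
    {S : H →L[ℂ] H} {Y : K →L[ℂ] K} (hS : ∀ a ∈ A, S ∘L a = a ∘L S)
    (hYB : ∀ b ∈ B, Y ∘L b = b ∘L Y) (hY : ∀ η ∈ β, Y ∘L η ∈ β)
    {W : RelTensor α β →L[ℂ] RelTensor α β}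
    (hW : ∀ η η' : β, (η' : 𝔥 →L[ℂ] K) = Y ∘L (η : 𝔥 →L[ℂ] K) →
      W ∘L ketTwo α β η = ketTwo α β η' ∘L S) : W ∘L T = T ∘L W := by
  have hi : Intw α β β Y := .of_maps h h hY
  -- T|ξ⟩₁ lies in [|α⟩₁B], and Y commutes with B.
  have h1 : legTwo α β β Y ∘L T = T ∘L legTwo α β β Y := by
    refine ext_ketOne h fun ξ => ?_
    have : ∀ c ∈ opProd (ketsOne α β) (B : Set (K →L[ℂ] K)), legTwo α β β Y ∘L c = c ∘L Y := by
      intro c hc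
      refine eq_of_mem_opProd (compL ℂ K (RelTensor α β) (RelTensor α β) (legTwo α β β Y))
        ((compL ℂ K K (RelTensor α β)).flip Y) ?_ hc
      rintro _ ⟨ξ', rfl⟩ b hb
      rw [compL_apply, flip_apply, compL_apply, comp_comp_of_eq (legTwo_comp_ketOne h h hi ξ'),
        comp_assoc, comp_assoc, hYB b hb]
    rw [comp_assoc, comp_assoc, this _ (hT.1 _ ⟨ξ, rfl⟩).1, legTwo_comp_ketOne h h hi, comp_assoc]
  -- S is not assumed to intertwine ρ_α, so S ⊗ 1 is not used. On [|β⟩₂A], which contains T|η⟩₂, the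
  -- operator W acts as 1 ⊗ Y from the left and S from the right.
  have h2 : ∀ c ∈ opProd (ketsTwo α β) (A : Set (H →L[ℂ] H)),
      W ∘L c = legTwo α β β Y ∘L c ∘L S := by
    intro c hc
    refine eq_of_mem_opProd (compL ℂ H (RelTensor α β) (RelTensor α β) W)
      (compL ℂ H (RelTensor α β) (RelTensor α β) (legTwo α β β Y) ∘L
        (compL ℂ H H (RelTensor α β)).flip S) ?_ hc
    rintro _ ⟨η, rfl⟩ a ha
    rw [compL_apply, comp_apply, compL_apply, flip_apply, compL_apply,
      comp_comp_of_eq (hW η ⟨_, hY _ η.2⟩ rfl), comp_assoc, comp_assoc,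
      comp_comp_of_eq (legTwo_comp_ketTwo h h hi (η' := ⟨_, hY _ η.2⟩) rfl), hS a ha]
  refine ext_ketTwo h fun η => ?_
  rw [comp_assoc, comp_assoc, h2 _ (hT.2 _ ⟨η, rfl⟩).1, hW η ⟨_, hY _ η.2⟩ rfl, comp_assoc,
    comp_comp_of_eq' h1, comp_comp_of_eq (legTwo_comp_ketTwo h h hi (η' := ⟨_, hY _ η.2⟩) rfl)]

/-- The mirror image of `commute_fiber_right`: S ⊗ 1 commutes with T, and on [|α⟩₁B] the operator W
acts as S ⊗ 1 from the left and Y from the right. -/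
theorem commute_fiber_left (h : Linked α β) {A : OpSpace H H} {B : OpSpace K K}
    {T : RelTensor α β →L[ℂ] RelTensor α β}
    (hT : T ∈ fiberProd (A : Set (H →L[ℂ] H)) α (B : Set (K →L[ℂ] K)) β)
    {S : H →L[ℂ] H} {Y : K →L[ℂ] K} (hSA : ∀ a ∈ A, S ∘L a = a ∘L S)
    (hY : ∀ b ∈ B, Y ∘L b = b ∘L Y) (hS : ∀ ξ ∈ α, S ∘L ξ ∈ α)
    {W : RelTensor α β →L[ℂ] RelTensor α β}
    (hW : ∀ ξ ξ' : α, (ξ' : 𝔥 →L[ℂ] H) = S ∘L (ξ : 𝔥 →L[ℂ] H) →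
      W ∘L ketOne α β ξ = ketOne α β ξ' ∘L Y) : W ∘L T = T ∘L W := by
  have hi : Intw β α α S := .of_maps h.symm h.symm hS
  have h1 : legOne α α β S ∘L T = T ∘L legOne α α β S := by
    refine ext_ketTwo h fun η => ?_
    have : ∀ c ∈ opProd (ketsTwo α β) (A : Set (H →L[ℂ] H)), legOne α α β S ∘L c = c ∘L S := by
      intro c hc
      refine eq_of_mem_opProd (compL ℂ H (RelTensor α β) (RelTensor α β) (legOne α α β S))
        ((compL ℂ H H (RelTensor α β)).flip S) ?_ hc
      rintro _ ⟨η', rfl⟩ a ha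
      rw [compL_apply, flip_apply, compL_apply, comp_comp_of_eq (legOne_comp_ketTwo h h hi η'),
        comp_assoc, comp_assoc, hSA a ha]
    rw [comp_assoc, comp_assoc, this _ (hT.2 _ ⟨η, rfl⟩).1, legOne_comp_ketTwo h h hi, comp_assoc]
  have h2 : ∀ c ∈ opProd (ketsOne α β) (B : Set (K →L[ℂ] K)),
      W ∘L c = legOne α α β S ∘L c ∘L Y := by
    intro c hc
    refine eq_of_mem_opProd (compL ℂ K (RelTensor α β) (RelTensor α β) W)
      (compL ℂ K (RelTensor α β) (RelTensor α β) (legOne α α β S) ∘L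
        (compL ℂ K K (RelTensor α β)).flip Y) ?_ hc
    rintro _ ⟨ξ, rfl⟩ b hb
    rw [compL_apply, comp_apply, compL_apply, flip_apply, compL_apply,
      comp_comp_of_eq (hW ξ ⟨_, hS _ ξ.2⟩ rfl), comp_assoc, comp_assoc,
      comp_comp_of_eq (legOne_comp_ketOne h h hi (η' := ⟨_, hS _ ξ.2⟩) rfl), hY b hb]
  refine ext_ketOne h fun ξ => ?_
  rw [comp_assoc, comp_assoc, h2 _ (hT.1 _ ⟨ξ, rfl⟩).1, hW ξ ⟨_, hS _ ξ.2⟩ rfl, comp_assoc,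
    comp_comp_of_eq' h1, comp_comp_of_eq (legOne_comp_ketOne h h hi (η' := ⟨_, hS _ ξ.2⟩) rfl)]

theorem legOne_comp_legTwo (h : Linked α β) (h' : Linked γ β) {S : H →L[ℂ] L}
    (hS : Intw β α γ S) {y : K →L[ℂ] K} (hy : ∀ η ∈ β, y ∘L η ∈ β) :
    legOne α γ β S ∘L legTwo α β β y = legTwo γ β β y ∘L legOne α γ β S := by
  refine ext_ketTwo h fun η => ?_
  rw [comp_assoc, comp_assoc, legTwo_comp_ketTwo h h (.of_maps h h hy) (η' := ⟨_, hy _ η.2⟩) rfl,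
    legOne_comp_ketTwo h h' hS, legOne_comp_ketTwo h h' hS,
    comp_comp_of_eq (legTwo_comp_ketTwo h' h' (.of_maps h' h' hy) (η' := ⟨_, hy _ η.2⟩) rfl)]

end FiberMap

/-! ### Identification of Δ̂ ∗ id and id ∗ Δ̂ by the intertwiners V*|ξ⟩₁ -/

section Coassoc

variable {𝔥 H : Type*}
  [NormedAddCommGroup 𝔥] [InnerProductSpace ℂ 𝔥] [CompleteSpace 𝔥]
  [NormedAddCommGroup H] [InnerProductSpace ℂ H] [CompleteSpace H]
  {b : CStarBase 𝔥} {α βh β : OpSpace 𝔥 H}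
  {V : RelTensor βh α →L[ℂ] RelTensor α β}

namespace IsPMU

/-- The intertwiner `V* |ξ⟩₁`. -/
def coket (α βh β : OpSpace 𝔥 H) (V : RelTensor βh α →L[ℂ] RelTensor α β) (ξ : α) :
    H →L[ℂ] RelTensor βh α := adjoint V ∘L ketOne α β ξ

theorem coket_mem_intertwiners (hV : IsPMU b α βh β V) (ξ : α) :
    coket α βh β V ξ ∈ intertwiners (legHat α βh β V) (comulHat α βh β V) :=
  hV.adjoint_comp_ketOne_mem_intertwiners ξ

theorem coket_mem_factHom_left (hV : IsPMU b α βh β V) (ξ : α) :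
    coket α βh β V ξ ∈ factHom βh (rightTri βh α βh) :=
  hV.adjoint_comp_ketOne_mem_factHom hV.chain_αβh.left hV.fact_βh.closed hV.map_three ξ

theorem coket_mem_factHom_right (hV : IsPMU b α βh β V) (ξ : α) :
    coket α βh β V ξ ∈ factHom α (leftTri βh α α) :=
  hV.adjoint_comp_ketOne_mem_factHom hV.chain_αβα.left hV.fact_α.closed hV.map_one ξ

theorem intw_coket_left (hV : IsPMU b α βh β V) (ξ : α) :
    Intw α βh (rightTri βh α βh) (coket α βh β V ξ) :=
  .of_maps hV.linked_hat.symm hV.chain_hhα.linked_rightTri.symm (hV.coket_mem_factHom_left ξ).1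

theorem intw_coket_right (hV : IsPMU b α βh β V) (ξ : α) :
    Intw βh α (leftTri βh α α) (coket α βh β V ξ) :=
  .of_maps hV.linked_hat hV.chain_hhα.linked_leftTri' (hV.coket_mem_factHom_right ξ).1

/-- `X_ξ* Δ̂(y) = y X_ξ*` for the intertwiners `X_ξ = V* |ξ⟩₁`. -/
theorem adjoint_coket_comp (hV : IsPMU b α βh β V) (hr : IsRegular α βh β V) (ξ : α)
    {y : H →L[ℂ] H} (hy : y ∈ legHat α βh β V) :
    adjoint (coket α βh β V ξ) ∘L comulHat α βh β V y =
      y ∘L adjoint (coket α βh β V ξ) := by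
  have := congrArg adjoint (hV.coket_mem_intertwiners ξ _ (hV.adjoint_mem_legHat hr hy))
  rw [adjoint_comp, adjoint_adjoint, hV.adjoint_comulHat (hV.intw_of_mem_legHat hy), adjoint_comp,
    adjoint_adjoint] at this
  exact this.symm

/-- Composing an arbitrary intertwiner X with X_ξ*, where X_ξ = V*|ξ⟩₁, gives an element of the
commutant of Â. In this way the known intertwiners X_ξ control all others. -/
theorem adjoint_coket_comp_commute (hV : IsPMU b α βh β V) (hr : IsRegular α βh β V) (ξ : α)
    {X : H →L[ℂ] RelTensor βh α} (hX : X ∈ intertwiners (legHat α βh β V) (comulHat α βh β V)) :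
    ∀ a ∈ legHat α βh β V, (adjoint (coket α βh β V ξ) ∘L X) ∘L a =
      a ∘L (adjoint (coket α βh β V ξ) ∘L X) := by
  intro a ha
  rw [comp_assoc, hX a ha, comp_comp_of_eq (hV.adjoint_coket_comp hr ξ ha), comp_assoc]

/-- `(Δ̂ ∗ id)(T)` for `T ∈ Â ∗ Â`, provided that some operator intertwines it with `T`. -/
theorem fiberMap_comulHat_id (hV : IsPMU b α βh β V) (hr : IsRegular α βh β V)
    {T : RelTensor βh α →L[ℂ] RelTensor βh α}
    (hT : T ∈ fiberProd (legHat α βh β V : Set (H →L[ℂ] H)) βh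
      (legHat α βh β V : Set (H →L[ℂ] H)) α)
    {R : RelTensor (rightTri βh α βh) α →L[ℂ] RelTensor (rightTri βh α βh) α}
    (htot : ∀ Φ Ψ : RelTensor (rightTri βh α βh) α →L[ℂ] RelTensor (rightTri βh α βh) α,
      (∀ ξ, Φ ∘L legOne βh (rightTri βh α βh) α (coket α βh β V ξ) =
        Ψ ∘L legOne βh (rightTri βh α βh) α (coket α βh β V ξ)) → Φ = Ψ)
    (hinj : ∀ Φ Ψ : RelTensor βh α →L[ℂ] RelTensor (rightTri βh α βh) α,
      (∀ ξ, adjoint (legOne βh (rightTri βh α βh) α (coket α βh β V ξ)) ∘L Φ =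
        adjoint (legOne βh (rightTri βh α βh) α (coket α βh β V ξ)) ∘L Ψ) → Φ = Ψ)
    (h1 : ∀ ξ, R ∘L legOne βh (rightTri βh α βh) α (coket α βh β V ξ) =
      legOne βh (rightTri βh α βh) α (coket α βh β V ξ) ∘L T)
    (h2 : ∀ ξ, adjoint (legOne βh (rightTri βh α βh) α (coket α βh β V ξ)) ∘L R =
      T ∘L adjoint (legOne βh (rightTri βh α βh) α (coket α βh β V ξ))) :
    fiberMap (legHat α βh β V) βh (legHat α βh β V) α (rightTri βh α βh) α
      (comulHat α βh β V) _root_.id T = R := by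
  have hl := hV.linked_hat
  have hl' := hV.chain_hhα.linked_rightTri
  have hi := fun ξ => (hV.intw_coket_left ξ).adjoint hl.symm hl'.symm
  refine fiberMap_eq (fun X hX Y hY => ?_) (fun X hX Y hY => ?_) (fun R' hR' _ => ?_)
  · obtain h0 | h0 := tensorRight_eq_zero_or (α := βh) (β := α) (γ := rightTri βh α βh) (δ := α) X Y
    · rw [h0, comp_zero, zero_comp]
    -- Applying X_ξ* ⊗ 1 turns the claim into the commutation of T ∈ Â ∗ Â with X_ξ*X ⊗ Y, whose
    -- factors lie in the commutants.
    refine hinj _ _ fun ξ => ?_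
    rw [comp_comp_of_eq (h2 ξ), ← comp_assoc, comp_assoc]
    refine (commute_fiber_right hl hT (hV.adjoint_coket_comp_commute hr ξ hX) hY.2 hY.1.1
      fun η η' hη => ?_).symm
    rw [comp_assoc, h0 η η' hη, adjoint_legOne hl hl' (hV.intw_coket_left ξ),
      comp_comp_of_eq (legOne_comp_ketTwo hl' hl (hi ξ) η'), comp_assoc]
  · obtain h0 | h0 := tensorLeft_eq_zero_or (α := βh) (β := α) (γ := rightTri βh α βh) (δ := α) X Y
    · rw [h0, comp_zero, zero_comp]
    refine hinj _ _ fun ξ => ?_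
    have hm : ∀ c ∈ βh, (adjoint (coket α βh β V ξ) ∘L X) ∘L c ∈ βh := fun c hc => by
      rw [comp_assoc]
      exact (hV.coket_mem_factHom_left ξ).2 _ (hX.1.1 c hc)
    rw [comp_comp_of_eq (h2 ξ), ← comp_assoc, comp_assoc]
    refine (commute_fiber_left hl hT (hV.adjoint_coket_comp_commute hr ξ hX.2) hY hm
      fun η η' hη => ?_).symm
    rw [comp_assoc, h0 η ⟨_, hX.1.1 _ η.2⟩ rfl, adjoint_legOne hl hl' (hV.intw_coket_left ξ),
      comp_comp_of_eq (legOne_comp_ketOne hl' hl (hi ξ) (η' := η') (by rw [hη, comp_assoc]))]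
  -- The pairs (X_ξ, 1) are among the pairs tested by `fiberMap`, and they already determine the
  -- operator.
  · refine htot _ _ fun ξ => ?_
    rw [h1]
    exact hR' _ (hV.coket_mem_intertwiners ξ) _ ⟨id_mem_factHom α, id_mem_intertwiners _⟩

theorem fiberMap_id_comulHat (hV : IsPMU b α βh β V) (hr : IsRegular α βh β V)
    {T : RelTensor βh α →L[ℂ] RelTensor βh α}
    (hT : T ∈ fiberProd (legHat α βh β V : Set (H →L[ℂ] H)) βh
      (legHat α βh β V : Set (H →L[ℂ] H)) α)
    {R : RelTensor βh (leftTri βh α α) →L[ℂ] RelTensor βh (leftTri βh α α)}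
    (htot : ∀ Φ Ψ : RelTensor βh (leftTri βh α α) →L[ℂ] RelTensor βh (leftTri βh α α),
      (∀ ξ, Φ ∘L legTwo βh α (leftTri βh α α) (coket α βh β V ξ) =
        Ψ ∘L legTwo βh α (leftTri βh α α) (coket α βh β V ξ)) → Φ = Ψ)
    (hinj : ∀ Φ Ψ : RelTensor βh α →L[ℂ] RelTensor βh (leftTri βh α α),
      (∀ ξ, adjoint (legTwo βh α (leftTri βh α α) (coket α βh β V ξ)) ∘L Φ =
        adjoint (legTwo βh α (leftTri βh α α) (coket α βh β V ξ)) ∘L Ψ) → Φ = Ψ)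
    (h1 : ∀ ξ, R ∘L legTwo βh α (leftTri βh α α) (coket α βh β V ξ) =
      legTwo βh α (leftTri βh α α) (coket α βh β V ξ) ∘L T)
    (h2 : ∀ ξ, adjoint (legTwo βh α (leftTri βh α α) (coket α βh β V ξ)) ∘L R =
      T ∘L adjoint (legTwo βh α (leftTri βh α α) (coket α βh β V ξ))) :
    fiberMap (legHat α βh β V) βh (legHat α βh β V) α βh (leftTri βh α α)
      _root_.id (comulHat α βh β V) T = R := by
  have hl := hV.linked_hat
  have hl' := hV.chain_hhα.linked_leftTri'
  have hi := fun ξ => (hV.intw_coket_right ξ).adjoint hl hl'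
  refine fiberMap_eq (fun X hX Y hY => ?_) (fun X hX Y hY => ?_) (fun R' _ hR' => ?_)
  · obtain h0 | h0 := tensorRight_eq_zero_or (α := βh) (β := α) (γ := βh) (δ := leftTri βh α α) X Y
    · rw [h0, comp_zero, zero_comp]
    refine hinj _ _ fun ξ => ?_
    have hm : ∀ c ∈ α, (adjoint (coket α βh β V ξ) ∘L Y) ∘L c ∈ α := fun c hc => by
      rw [comp_assoc]
      exact (hV.coket_mem_factHom_right ξ).2 _ (hY.1.1 c hc)
    rw [comp_comp_of_eq (h2 ξ), ← comp_assoc, comp_assoc]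
    refine (commute_fiber_right hl hT hX (hV.adjoint_coket_comp_commute hr ξ hY.2) hm
      fun η η' hη => ?_).symm
    rw [comp_assoc, h0 η ⟨_, hY.1.1 _ η.2⟩ rfl, adjoint_legTwo hl hl' (hV.intw_coket_right ξ),
      comp_comp_of_eq (legTwo_comp_ketTwo hl' hl (hi ξ) (η' := η') (by rw [hη, comp_assoc]))]
  · obtain h0 | h0 := tensorLeft_eq_zero_or (α := βh) (β := α) (γ := βh) (δ := leftTri βh α α) X Y
    · rw [h0, comp_zero, zero_comp]
    refine hinj _ _ fun ξ => ?_
    rw [comp_comp_of_eq (h2 ξ), ← comp_assoc, comp_assoc]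
    refine (commute_fiber_left hl hT hX.2 (hV.adjoint_coket_comp_commute hr ξ hY) hX.1.1
      fun η η' hη => ?_).symm
    rw [comp_assoc, h0 η η' hη, adjoint_legTwo hl hl' (hV.intw_coket_right ξ),
      comp_comp_of_eq (legTwo_comp_ketOne hl' hl (hi ξ) η'), comp_assoc]
  · refine htot _ _ fun ξ => ?_
    rw [h1]
    exact hR' _ ⟨id_mem_factHom βh, id_mem_intertwiners _⟩ _ (hV.coket_mem_intertwiners ξ)

end IsPMU
end Coassoc

/-! ### Coassociativity of the left leg -/

section Transport

set_option linter.unusedSectionVars false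

variable {X Y Z W W' L : Type*} [NormedAddCommGroup X] [InnerProductSpace ℂ X] [CompleteSpace X]
  [NormedAddCommGroup Y] [InnerProductSpace ℂ Y] [CompleteSpace Y]
  [NormedAddCommGroup Z] [InnerProductSpace ℂ Z] [CompleteSpace Z]
  [NormedAddCommGroup W] [InnerProductSpace ℂ W] [CompleteSpace W]
  [NormedAddCommGroup W'] [InnerProductSpace ℂ W'] [CompleteSpace W']
  [NormedAddCommGroup L] [InnerProductSpace ℂ L] [CompleteSpace L]

/-- The algebra behind coassociativity. In the application F is `frame`, P is V₂₃, N is V₁₂, G is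
V₁₃V₂₃, the maps A and E are reassociations, and t, t', t'' are copies of y on the last leg. The
hypothesis on P is the pentagon equation; A and N drop out because they only permute these copies.
-/
theorem comp_conj_eq_conj_comp {F : L →L[ℂ] X} {E : X →L[ℂ] Y} {G : Y →L[ℂ] Z} {N : Z →L[ℂ] W}
    {A : W →L[ℂ] W'} {P : L →L[ℂ] W'} {s : L →L[ℂ] L} {t : W' →L[ℂ] W'} {t' : W →L[ℂ] W}
    {t'' : Z →L[ℂ] Z} (hs : s = adjoint P ∘L t ∘L P) (h : P ∘L adjoint F = A ∘L N ∘L G ∘L E)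
    (hA : A ∘L t' = t ∘L A) (hN : N ∘L t'' = t' ∘L N) (hAu : adjoint A ∘L A = .id ℂ W)
    (hNu : adjoint N ∘L N = .id ℂ Z) (hE : E ∘L adjoint E = .id ℂ Y) :
    E ∘L F ∘L s ∘L adjoint F = (adjoint G ∘L t'' ∘L G) ∘L E := by
  have h1 := congrArg adjoint h
  rw [adjoint_comp, adjoint_adjoint, adjoint_comp, adjoint_comp, adjoint_comp] at h1
  rw [hs, comp_assoc, comp_assoc, h, comp_comp_of_eq h1]
  simp only [comp_assoc]
  rw [comp_comp_of_eq hE, id_comp, comp_comp_of_eq' hA.symm, comp_comp_of_eq hAu, id_comp,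
    comp_comp_of_eq' hN.symm, comp_comp_of_eq hNu, id_comp]

end Transport

section Coassoc

variable {𝔥 H : Type*}
  [NormedAddCommGroup 𝔥] [InnerProductSpace ℂ 𝔥] [CompleteSpace 𝔥]
  [NormedAddCommGroup H] [InnerProductSpace ℂ H] [CompleteSpace H]
  {b : CStarBase 𝔥} {α βh β : OpSpace 𝔥 H}
  {V : RelTensor βh α →L[ℂ] RelTensor α β}

namespace IsPMU

/-- The operator `V₁₂`. -/
def pmuTwelve (α βh β : OpSpace 𝔥 H) (V : RelTensor βh α →L[ℂ] RelTensor α β) :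
    RelTensor (rightTri βh α βh) α →L[ℂ] RelTensor (rightTri α β βh) α :=
  legOne (rightTri βh α βh) (rightTri α β βh) α V

/-- The operator `V₂₃`. -/
def pmuTwentyThree (α βh β : OpSpace 𝔥 H) (V : RelTensor βh α →L[ℂ] RelTensor α β) :
    RelTensor βh (leftTri βh α α) →L[ℂ] RelTensor βh (rightTri α β α) :=
  legTwo βh (leftTri βh α α) (rightTri α β α) V

theorem isUnitaryMap_twelve (hV : IsPMU b α βh β V) : IsUnitaryMap (pmuTwelve α βh β V) :=
  hV.unitary.legOne hV.chain_hhα.linked_rightTri hV.chain_αβh.linked_rightTri hV.intw_three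

theorem isUnitaryMap_twentyThree (hV : IsPMU b α βh β V) :
    IsUnitaryMap (pmuTwentyThree α βh β V) :=
  hV.unitary.legTwo hV.chain_hhα.linked_leftTri' hV.chain_αβαh.linked_rightTri.symm hV.intw_one'

/-- The unitary `V₁₂*`, reassociated. -/
def frame (α βh β : OpSpace 𝔥 H) (V : RelTensor βh α →L[ℂ] RelTensor α β) :
    RelTensor α (leftTri βh α β) →L[ℂ] RelTensor (rightTri βh α βh) α :=
  adjoint (pmuTwelve α βh β V) ∘L assocInv α β βh α

theorem isUnitaryMap_frame (hV : IsPMU b α βh β V) : IsUnitaryMap (frame α βh β V) :=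
  hV.isUnitaryMap_twelve.adjoint.comp hV.chain_αβh.isUnitaryMap_assocInv

theorem adjoint_frame (hV : IsPMU b α βh β V) :
    adjoint (frame α βh β V) = assoc α β βh α ∘L pmuTwelve α βh β V := by
  rw [frame, adjoint_comp, adjoint_adjoint, ← hV.chain_αβh.adjoint_assoc, adjoint_adjoint]

/-- The unitary `frame` carries the kets |ξ⟩₁ to the operators X_ξ ⊗ 1, which therefore inherit
totality and joint injectivity of adjoints; `coframe` does the same for 1 ⊗ X_ξ. -/
theorem frame_comp_ketOne (hV : IsPMU b α βh β V) (ξ : α) :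
    frame α βh β V ∘L ketOne α (leftTri βh α β) ξ =
      legOne βh (rightTri βh α βh) α (coket α βh β V ξ) := by
  rw [frame, comp_assoc, hV.chain_αβh.assocInv_comp_ketOne, pmuTwelve,
    adjoint_legOne hV.chain_hhα.linked_rightTri hV.chain_αβh.linked_rightTri hV.intw_three,
    ← legOne_comp hV.linked_hat hV.chain_αβh.linked_rightTri hV.chain_hhα.linked_rightTri
      (hV.intw_three.adjoint hV.chain_hhα.linked_rightTri.symm
        hV.chain_αβh.linked_rightTri.symm) (hV.chain_αβh.intw_ketOne ξ)]
  rfl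

theorem twentyThree_comp (hV : IsPMU b α βh β V) (ξ : α) :
    pmuTwentyThree α βh β V ∘L legTwo βh α (leftTri βh α α) (coket α βh β V ξ) =
      legTwo βh α (rightTri α β α) (ketOne α β ξ) := by
  rw [pmuTwentyThree, ← legTwo_comp hV.linked_hat hV.chain_hhα.linked_leftTri'
    hV.chain_αβαh.linked_rightTri.symm hV.intw_one' (hV.intw_coket_right ξ), coket,
    comp_comp_of_eq hV.unitary.2, id_comp]

/-- The unitary `V₂₃`, composed with a flip and reassociated. -/
def coframe (α βh β : OpSpace 𝔥 H) (V : RelTensor βh α →L[ℂ] RelTensor α β) :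
    RelTensor βh (leftTri βh α α) →L[ℂ] RelTensor (rightTri βh α β) α :=
  assocInv βh α β α ∘L legTwo βh (rightTri α β α) (leftTri β α α) (flip α β) ∘L
    pmuTwentyThree α βh β V

theorem isUnitaryMap_coframe (hV : IsPMU b α βh β V) : IsUnitaryMap (coframe α βh β V) :=
  hV.chain_hαβ.isUnitaryMap_assocInv.comp <|
    ((isUnitaryMap_flip hV.linked).legTwo hV.chain_αβαh.linked_rightTri.symm
      hV.chain_hαβ.linked_leftTri' hV.intw_flip).comp hV.isUnitaryMap_twentyThree

theorem coframe_comp (hV : IsPMU b α βh β V) (ξ : α) :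
    coframe α βh β V ∘L legTwo βh α (leftTri βh α α) (coket α βh β V ξ) =
      ketTwo (rightTri βh α β) α ξ := by
  rw [coframe, comp_assoc, comp_assoc, hV.twentyThree_comp,
    ← legTwo_comp hV.linked_hat hV.chain_αβαh.linked_rightTri.symm hV.chain_hαβ.linked_leftTri'
      hV.intw_flip (hV.intw_ketOne ξ), flip_comp_ketOne hV.linked,
    hV.chain_hαβ.assocInv_comp_legTwo]

theorem legTwo_coket (hV : IsPMU b α βh β V) (ξ : α) :
    legTwo βh α (leftTri βh α α) (coket α βh β V ξ) =
      adjoint (coframe α βh β V) ∘L ketTwo (rightTri βh α β) α ξ := by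
  rw [← hV.coframe_comp, ← comp_assoc, hV.isUnitaryMap_coframe.1, id_comp]

theorem comp_mem_leftTri {y : H →L[ℂ] H} (h : Linked α β) (hy : ∀ η ∈ β, y ∘L η ∈ β)
    {w : 𝔥 →L[ℂ] RelTensor α β} (hw : w ∈ leftTri α β β) : legTwo α β β y ∘L w ∈ leftTri α β β :=
  map_mem_of_mem_opProd (compL ℂ 𝔥 (RelTensor α β) (RelTensor α β) (legTwo α β β y))
    (isClosed_opProd _ _) (by
      rintro _ ⟨η, rfl⟩ c hc
      rw [compL_apply, comp_comp_of_eq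
        (legTwo_comp_ketTwo h h (.of_maps h h hy) (η' := ⟨_, hy _ η.2⟩) rfl)]
      exact ketTwo_comp_mem _ hc) hw

theorem intw_legTwo (hV : IsPMU b α βh β V) {y : H →L[ℂ] H} (hy : ∀ η ∈ β, y ∘L η ∈ β) :
    Intw α (leftTri α β β) (leftTri α β β) (legTwo α β β y) :=
  .of_maps hV.chain_αβα.linked_leftTri' hV.chain_αβα.linked_leftTri'
    fun _ hw => comp_mem_leftTri hV.linked hy hw

theorem intw_comulHat (hV : IsPMU b α βh β V) {y : H →L[ℂ] H} (hy : ∀ η ∈ β, y ∘L η ∈ β) :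
    Intw α (leftTri βh α β) (leftTri βh α β) (comulHat α βh β V y) :=
  (hV.intw_four.adjoint hV.chain_αβh.linked_leftTri' hV.chain_αβα.linked_leftTri').comp
    ((hV.intw_legTwo hy).comp hV.intw_four)

/-- The operator `(Δ̂ ∗ id)(Δ̂(y))`. -/
def doubleLeft (α βh β : OpSpace 𝔥 H) (V : RelTensor βh α →L[ℂ] RelTensor α β)
    (y : H →L[ℂ] H) : RelTensor (rightTri βh α βh) α →L[ℂ] RelTensor (rightTri βh α βh) α :=
  frame α βh β V ∘L legTwo α (leftTri βh α β) (leftTri βh α β) (comulHat α βh β V y) ∘L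
    adjoint (frame α βh β V)

theorem doubleLeft_comp (hV : IsPMU b α βh β V) {y : H →L[ℂ] H} (hy : ∀ η ∈ β, y ∘L η ∈ β)
    (ξ : α) : doubleLeft α βh β V y ∘L legOne βh (rightTri βh α βh) α (coket α βh β V ξ) =
      legOne βh (rightTri βh α βh) α (coket α βh β V ξ) ∘L comulHat α βh β V y := by
  have hl := hV.chain_αβh.linked_leftTri'
  rw [← hV.frame_comp_ketOne, doubleLeft, comp_assoc, comp_assoc,
    comp_comp_of_eq hV.isUnitaryMap_frame.1, id_comp,
    legTwo_comp_ketOne hl hl (hV.intw_comulHat hy), comp_assoc]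

theorem adjoint_comp_doubleLeft (hV : IsPMU b α βh β V) {y : H →L[ℂ] H}
    (hy : ∀ η ∈ β, y ∘L η ∈ β) (ξ : α) :
    adjoint (legOne βh (rightTri βh α βh) α (coket α βh β V ξ)) ∘L doubleLeft α βh β V y =
      comulHat α βh β V y ∘L adjoint (legOne βh (rightTri βh α βh) α (coket α βh β V ξ)) := by
  have hl := hV.chain_αβh.linked_leftTri'
  rw [← hV.frame_comp_ketOne, doubleLeft, adjoint_comp, comp_assoc,
    comp_comp_of_eq hV.isUnitaryMap_frame.1, id_comp,
    comp_comp_of_eq' (braOne_comp_legTwo hl hl (hV.intw_comulHat hy) ξ)]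

/-- The operator `V₁₃ V₂₃`. -/
def pmuProd (α βh β : OpSpace 𝔥 H) (V : RelTensor βh α →L[ℂ] RelTensor α β) :
    RelTensor βh (leftTri βh α α) →L[ℂ] RelTensor (leftTri βh α α) β :=
  pmuThirteen α βh β V ∘L pmuTwentyThree α βh β V

theorem isUnitaryMap_prod (hV : IsPMU b α βh β V) : IsUnitaryMap (pmuProd α βh β V) :=
  hV.isUnitaryMap_thirteen.comp hV.isUnitaryMap_twentyThree

theorem prod_comp (hV : IsPMU b α βh β V) (ξ : α) :
    pmuProd α βh β V ∘L legTwo βh α (leftTri βh α α) (coket α βh β V ξ) =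
      legOne α (leftTri βh α α) β (ketTwo βh α ξ) ∘L V := by
  rw [pmuProd, comp_assoc, hV.twentyThree_comp, hV.thirteen_comp]

/-- The operator `(id ∗ Δ̂)(Δ̂(y))`. -/
def doubleRight (α βh β : OpSpace 𝔥 H) (V : RelTensor βh α →L[ℂ] RelTensor α β)
    (y : H →L[ℂ] H) : RelTensor βh (leftTri βh α α) →L[ℂ] RelTensor βh (leftTri βh α α) :=
  adjoint (pmuProd α βh β V) ∘L legTwo (leftTri βh α α) β β y ∘L pmuProd α βh β V

theorem doubleRight_comp (hV : IsPMU b α βh β V) {y : H →L[ℂ] H} (hy : ∀ η ∈ β, y ∘L η ∈ β)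
    (ξ : α) : doubleRight α βh β V y ∘L legTwo βh α (leftTri βh α α) (coket α βh β V ξ) =
      legTwo βh α (leftTri βh α α) (coket α βh β V ξ) ∘L comulHat α βh β V y := by
  refine hV.isUnitaryMap_prod.cancel_left ?_
  rw [doubleRight, comp_comp_of_eq (hV.prod_comp ξ), comp_assoc, comp_assoc, hV.prod_comp,
    comp_comp_of_eq hV.isUnitaryMap_prod.2, id_comp, ← comp_assoc,
    ← legOne_comp_legTwo hV.linked hV.chain_βαh.symm.linked_leftTri (hV.intw_ketTwo ξ) hy,
    comulHat, comp_assoc, comp_assoc, comp_comp_of_eq hV.unitary.2, id_comp]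

/-- This is the adjoint of `doubleRight_comp` for y*, which is available because regularity makes Â
self-adjoint. -/
theorem adjoint_comp_doubleRight (hV : IsPMU b α βh β V) (hr : IsRegular α βh β V)
    {y : H →L[ℂ] H} (hy : y ∈ legHat α βh β V) (ξ : α) :
    adjoint (legTwo βh α (leftTri βh α α) (coket α βh β V ξ)) ∘L doubleRight α βh β V y =
      comulHat α βh β V y ∘L adjoint (legTwo βh α (leftTri βh α α) (coket α βh β V ξ)) := by
  have hy' := hV.adjoint_mem_legHat hr hy
  have hl := hV.chain_βαh.symm.linked_leftTri
  have hm : ∀ η ∈ β, adjoint y ∘L η ∈ β := fun η hη => hV.comp_mem_of_mem_legHat hy' hη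
  have h := congrArg adjoint (hV.doubleRight_comp hm ξ)
  have e : adjoint (doubleRight α βh β V (adjoint y)) = doubleRight α βh β V y := by
    rw [doubleRight, adjoint_comp, adjoint_comp, adjoint_adjoint,
      adjoint_legTwo hl hl (.of_maps hl hl hm), adjoint_adjoint, comp_assoc, doubleRight]
  rw [adjoint_comp, adjoint_comp, e, hV.adjoint_comulHat (hV.intw_of_mem_legHat hy),
    adjoint_adjoint] at h
  exact h

theorem pentagon_prod (hV : IsPMU b α βh β V) :
    legTwo α (leftTri βh α β) (leftTri α β β) V ∘L adjoint (frame α βh β V) =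
      assoc α β α β ∘L legOne (leftTri βh α α) (rightTri α β α) β V ∘L pmuProd α βh β V ∘L
        assoc βh α βh α := by
  rw [hV.adjoint_frame, pmuTwelve, hV.pentagon', pmuProd, pmuTwentyThree, comp_assoc]

theorem assoc_comp_legTwo (hV : IsPMU b α βh β V) {y : H →L[ℂ] H} (hy : ∀ η ∈ β, y ∘L η ∈ β) :
    assoc α β α β ∘L legTwo (rightTri α β α) β β y =
      legTwo α (leftTri α β β) (leftTri α β β) (legTwo α β β y) ∘L assoc α β α β := by
  have hl := hV.chain_αβα.linked_rightTri
  have hl' := hV.chain_αβα.linked_leftTri'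
  refine ext_ketTwo hl fun η => ?_
  have h1 := legTwo_comp_ketTwo hl hl (.of_maps hl hl hy) (η := η) (η' := ⟨_, hy _ η.2⟩) rfl
  have h2 := legTwo_comp_ketTwo hV.linked hV.linked (.of_maps hV.linked hV.linked hy) (η := η)
    (η' := ⟨_, hy _ η.2⟩) rfl
  rw [comp_assoc, h1, hV.chain_αβα.assoc_comp_ketTwo, comp_assoc, hV.chain_αβα.assoc_comp_ketTwo,
    ← legTwo_comp hV.linked hl' hl' (hV.intw_legTwo hy) (hV.chain_αβα.intw_ketTwo η), h2]

/-- Unwinding Δ̂(y) inside (Δ̂ ∗ id)(Δ̂(y)) gives a conjugate of y on the last leg by V₂₃V₁₂. The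
pentagon equation replaces this by V₁₂V₁₃V₂₃, and V₁₂ commutes with y on the last leg. -/
theorem assoc_comp_doubleLeft (hV : IsPMU b α βh β V) {y : H →L[ℂ] H}
    (hy : ∀ η ∈ β, y ∘L η ∈ β) :
    assoc βh α βh α ∘L doubleLeft α βh β V y = doubleRight α βh β V y ∘L assoc βh α βh α := by
  have hl := hV.chain_αβh.linked_leftTri'
  have hl' := hV.chain_αβα.linked_leftTri'
  have hs : legTwo α (leftTri βh α β) (leftTri βh α β) (comulHat α βh β V y) =
      adjoint (legTwo α (leftTri βh α β) (leftTri α β β) V) ∘L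
        legTwo α (leftTri α β β) (leftTri α β β) (legTwo α β β y) ∘L
        legTwo α (leftTri βh α β) (leftTri α β β) V := by
    rw [comulHat, legTwo_comp hl hl' hl (hV.intw_four.adjoint hl hl')
      ((hV.intw_legTwo hy).comp hV.intw_four), legTwo_comp hl hl' hl' (hV.intw_legTwo hy)
      hV.intw_four, adjoint_legTwo hl hl' hV.intw_four]
  exact comp_conj_eq_conj_comp hs hV.pentagon_prod (hV.assoc_comp_legTwo hy)
    (legOne_comp_legTwo hV.chain_βαh.symm.linked_leftTri hV.chain_αβα.linked_rightTri
      hV.intw_one hy)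
    (by rw [hV.chain_αβα.adjoint_assoc, hV.chain_αβα.assocInv_comp_assoc])
    (hV.unitary.legOne hV.chain_βαh.symm.linked_leftTri hV.chain_αβα.linked_rightTri
      hV.intw_one).1
    (by rw [hV.chain_hhα.adjoint_assoc, hV.chain_hhα.assoc_comp_assocInv])

theorem coassoc_comulHat (hV : IsPMU b α βh β V) (hr : IsRegular α βh β V)
    (hc : Coregular α βh β V) {y : H →L[ℂ] H} (hy : y ∈ legHat α βh β V) :
    assoc βh α βh α ∘L fiberMap (legHat α βh β V) βh (legHat α βh β V) α (rightTri βh α βh) α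
        (comulHat α βh β V) _root_.id (comulHat α βh β V y) =
      fiberMap (legHat α βh β V) βh (legHat α βh β V) α βh (leftTri βh α α)
        _root_.id (comulHat α βh β V) (comulHat α βh β V y) ∘L assoc βh α βh α := by
  have hT := (hV.isStarHomOn_comulHat hr hc).mapsTo y hy
  have hm : ∀ η ∈ β, y ∘L η ∈ β := fun η hη => hV.comp_mem_of_mem_legHat hy hη
  have hl := hV.chain_αβh.linked_leftTri'
  have hl' := hV.chain_hαβ.linked_rightTri
  rw [hV.fiberMap_comulHat_id hr hT (R := doubleLeft α βh β V y) ?_ ?_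
    (hV.doubleLeft_comp hm) (hV.adjoint_comp_doubleLeft hm),
    hV.fiberMap_id_comulHat hr hT (R := doubleRight α βh β V y) ?_ ?_
    (hV.doubleRight_comp hm) (hV.adjoint_comp_doubleRight hr hy), hV.assoc_comp_doubleLeft hm]
  -- The remaining conditions say that the operators 1 ⊗ X_ξ and X_ξ ⊗ 1 are total and their
  -- adjoints jointly injective. Both hold for kets and are transported by `coframe` and `frame`.
  · intro Φ Ψ h
    refine hV.isUnitaryMap_coframe.adjoint.cancel_right (ext_ketTwo hl' fun ξ => ?_)
    have := h ξ
    rwa [hV.legTwo_coket, ← comp_assoc, ← comp_assoc] at this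
  · intro Φ Ψ h
    refine hV.isUnitaryMap_coframe.cancel_left (ext_braTwo hl' fun ξ => ?_)
    have := h ξ
    rwa [hV.legTwo_coket, adjoint_comp, adjoint_adjoint, comp_assoc, comp_assoc] at this
  · intro Φ Ψ h
    refine hV.isUnitaryMap_frame.cancel_right (ext_ketOne hl fun ξ => ?_)
    have := h ξ
    rwa [← hV.frame_comp_ketOne, ← comp_assoc, ← comp_assoc] at this
  · intro Φ Ψ h
    refine hV.isUnitaryMap_frame.adjoint.cancel_left (ext_braOne hl fun ξ => ?_)
    have := h ξ
    rwa [← hV.frame_comp_ketOne, adjoint_comp, comp_assoc, comp_assoc] at this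

theorem isConcreteHopf_legHat (hV : IsPMU b α βh β V) (hr : IsRegular α βh β V)
    (hc : Coregular α βh β V) :
    IsConcreteHopf b.op (legHat α βh β V) βh α (comulHat α βh β V) where
  alg_left := hV.isConcreteAlg_legHat_left hr
  alg_right := hV.isConcreteAlg_legHat_right hr
  compatible := hV.compat_α_βh.symm
  mor_left := hV.isMorphism_comulHat_left hr hc
  mor_right := hV.isMorphism_comulHat_right hr hc
  coassoc _ hy := hV.coassoc_comulHat hr hc hy

end IsPMU
end Coassoc

/-! ### Flips twisted by the symmetry U -/

section Swaps

set_option linter.unusedSectionVars false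

variable {𝔥 H : Type*}
  [NormedAddCommGroup 𝔥] [InnerProductSpace ℂ 𝔥] [CompleteSpace 𝔥]
  [NormedAddCommGroup H] [InnerProductSpace ℂ H] [CompleteSpace H]
  {α αh β βh γ γ' : OpSpace 𝔥 H} {U : H →L[ℂ] H}

/-- `U` is a self-adjoint unitary that exchanges `α` and `α̂`. -/
def Swaps (U : H →L[ℂ] H) (α αh : OpSpace 𝔥 H) : Prop :=
  (adjoint U = U ∧ U ∘L U = ContinuousLinearMap.id ℂ H) ∧
    (∀ ξ ∈ α, U ∘L ξ ∈ αh) ∧ ∀ ξ ∈ αh, U ∘L ξ ∈ α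

namespace Swaps

theorem symm (h : Swaps U α αh) : Swaps U αh α := ⟨h.1, h.2.2, h.2.1⟩

/-- The element `U ξ` of `α̂`, for `ξ ∈ α`. -/
def img (h : Swaps U α αh) (ξ : α) : αh := ⟨U ∘L (ξ : 𝔥 →L[ℂ] H), h.2.1 _ ξ.2⟩

theorem coe_img (h : Swaps U α αh) (ξ : α) :
    (h.img ξ : 𝔥 →L[ℂ] H) = U ∘L (ξ : 𝔥 →L[ℂ] H) := rfl

theorem img_img (h : Swaps U α αh) (ξ : α) : h.symm.img (h.img ξ) = ξ :=
  Subtype.ext (by rw [coe_img, coe_img, comp_comp_of_eq h.1.2, id_comp])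

theorem intw (h : Swaps U α αh) (h1 : Linked γ α) (h2 : Linked γ αh) : Intw γ α αh U :=
  .of_maps h1 h2 h.2.1

/-- Inner products of `α` and of `α̂` are the same. -/
theorem intw_of_intw {K L : Type*} [NormedAddCommGroup K] [InnerProductSpace ℂ K]
    [CompleteSpace K] [NormedAddCommGroup L] [InnerProductSpace ℂ L] [CompleteSpace L]
    {δ : OpSpace 𝔥 K} {δ' : OpSpace 𝔥 L} {T : K →L[ℂ] L} (h : Swaps U α αh)
    (hT : Intw α δ δ' T) : Intw αh δ δ' T := by
  intro ξ ξ'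
  have e : adjoint (h.symm.img ξ : 𝔥 →L[ℂ] H) ∘L (h.symm.img ξ' : 𝔥 →L[ℂ] H) =
      adjoint (ξ : 𝔥 →L[ℂ] H) ∘L (ξ' : 𝔥 →L[ℂ] H) := by
    rw [coe_img, coe_img, adjoint_comp, h.1.1, comp_assoc, comp_comp_of_eq h.1.2, id_comp]
  have := hT (h.symm.img ξ) (h.symm.img ξ')
  rwa [e] at this

end Swaps

/-- The map `x ⊗ y ↦ U y ⊗ x`. -/
def swapL (α β βh : OpSpace 𝔥 H) (U : H →L[ℂ] H) : RelTensor α β →L[ℂ] RelTensor βh α :=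
  flip α βh ∘L legTwo α β βh U

/-- The map `x ⊗ y ↦ y ⊗ U x`. -/
def swapR (α αh β : OpSpace 𝔥 H) (U : H →L[ℂ] H) : RelTensor α β →L[ℂ] RelTensor β αh :=
  legTwo β α αh U ∘L flip α β

theorem swapL_comp_ketOne (h : Linked α β) (hU : Swaps U β βh) (h' : Linked α βh) (ξ : α) :
    swapL α β βh U ∘L ketOne α β ξ = ketTwo βh α ξ ∘L U := by
  rw [swapL, comp_assoc, legTwo_comp_ketOne h h' (hU.intw h h'),
    comp_comp_of_eq (flip_comp_ketOne h' ξ)]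

theorem swapL_comp_ketTwo (h : Linked α β) (hU : Swaps U β βh) (h' : Linked α βh) (η : β) :
    swapL α β βh U ∘L ketTwo α β η = ketOne βh α (hU.img η) := by
  rw [swapL, comp_assoc, legTwo_comp_ketTwo h h' (hU.intw h h') (hU.coe_img η),
    flip_comp_ketTwo h']

theorem swapR_comp_ketOne (h : Linked α β) (hU : Swaps U α αh) (h' : Linked αh β) (ξ : α) :
    swapR α αh β U ∘L ketOne α β ξ = ketTwo β αh (hU.img ξ) := by
  rw [swapR, comp_assoc, flip_comp_ketOne h,
    legTwo_comp_ketTwo h.symm h'.symm (hU.intw h.symm h'.symm) (hU.coe_img ξ)]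

theorem swapR_comp_ketTwo (h : Linked α β) (hU : Swaps U α αh) (h' : Linked αh β) (η : β) :
    swapR α αh β U ∘L ketTwo α β η = ketOne β αh η ∘L U := by
  rw [swapR, comp_assoc, flip_comp_ketTwo h,
    legTwo_comp_ketOne h.symm h'.symm (hU.intw h.symm h'.symm)]

theorem adjoint_swapL (h : Linked α β) (hU : Swaps U β βh) (h' : Linked α βh) :
    adjoint (swapL α β βh U) = swapR βh β α U := by
  rw [swapL, adjoint_comp, adjoint_legTwo h h' (hU.intw h h'), adjoint_flip h', hU.1.1, swapR]

theorem swapR_comp_swapL (h : Linked α β) (hU : Swaps U β βh) (h' : Linked α βh) :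
    swapR βh β α U ∘L swapL α β βh U = ContinuousLinearMap.id ℂ _ :=
  ext_ketOne h fun ξ => by
    rw [comp_assoc, swapL_comp_ketOne h hU h',
      comp_comp_of_eq (swapR_comp_ketTwo h'.symm hU.symm h.symm ξ), comp_assoc, hU.1.2, comp_id,
      id_comp]

theorem swapL_comp_swapR (h : Linked α β) (hU : Swaps U α αh) (h' : Linked αh β) :
    swapL β αh α U ∘L swapR α αh β U = ContinuousLinearMap.id ℂ _ :=
  ext_ketTwo h fun η => by
    rw [comp_assoc, swapR_comp_ketTwo h hU h',
      comp_comp_of_eq (swapL_comp_ketOne h'.symm hU.symm h.symm η), comp_assoc, hU.1.2, comp_id,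
      id_comp]

theorem braTwo_comp_swapR (h : Linked α β) (hU : Swaps U α αh) (h' : Linked αh β) (ξ : αh) :
    adjoint (ketTwo β αh ξ) ∘L swapR α αh β U = adjoint (ketOne α β (hU.symm.img ξ)) := by
  rw [← swapL_comp_ketTwo h'.symm hU.symm h.symm, adjoint_comp, adjoint_swapL h'.symm hU.symm
    h.symm]

theorem braOne_comp_swapR (h : Linked α β) (hU : Swaps U α αh) (h' : Linked αh β) (η : β) :
    adjoint (ketOne β αh η) ∘L swapR α αh β U = U ∘L adjoint (ketTwo α β η) := by
  have := congrArg adjoint (swapL_comp_ketOne h'.symm hU.symm h.symm η)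
  rwa [adjoint_comp, adjoint_swapL h'.symm hU.symm h.symm, adjoint_comp, hU.1.1] at this

theorem swapL_comp_mem_leftTri (h : Linked α β) (hU : Swaps U β βh) (h' : Linked α βh)
    (hγ : ∀ c ∈ γ, U ∘L c ∈ γ') {w : 𝔥 →L[ℂ] RelTensor α β} (hw : w ∈ rightTri α β γ) :
    swapL α β βh U ∘L w ∈ leftTri βh α γ' :=
  map_mem_of_mem_opProd (compL ℂ 𝔥 (RelTensor α β) (RelTensor βh α) (swapL α β βh U))
    (isClosed_opProd _ _) (by
      rintro _ ⟨ξ, rfl⟩ c hc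
      rw [compL_apply, comp_comp_of_eq (swapL_comp_ketOne h hU h' ξ), comp_assoc]
      exact ketTwo_comp_mem _ (hγ c hc)) hw

theorem swapR_comp_mem_rightTri (h : Linked α β) (hU : Swaps U α αh) (h' : Linked αh β)
    (hγ : ∀ c ∈ γ, U ∘L c ∈ γ') {w : 𝔥 →L[ℂ] RelTensor α β} (hw : w ∈ leftTri α β γ) :
    swapR α αh β U ∘L w ∈ rightTri β αh γ' :=
  map_mem_of_mem_opProd (compL ℂ 𝔥 (RelTensor α β) (RelTensor β αh) (swapR α αh β U))
    (isClosed_opProd _ _) (by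
      rintro _ ⟨η, rfl⟩ c hc
      rw [compL_apply, comp_comp_of_eq (swapR_comp_ketTwo h hU h' η), comp_assoc]
      exact ketOne_comp_mem _ (hγ c hc)) hw

end Swaps

/-! ### The passage from V to V̂ -/

section Hat

variable {𝔥 H : Type*}
  [NormedAddCommGroup 𝔥] [InnerProductSpace ℂ 𝔥] [CompleteSpace 𝔥]
  [NormedAddCommGroup H] [InnerProductSpace ℂ H] [CompleteSpace H]
  {b : CStarBase 𝔥} {α αh β βh : OpSpace 𝔥 H} {U : H →L[ℂ] H}
  {V : RelTensor βh α →L[ℂ] RelTensor α β}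

/-- In this form V̂ and V̌ are conjugates of V by mutually inverse pairs of swaps, and kets and bras
pass the swaps by simple rules. -/
theorem hat_eq (h : Linked α β) (h₁ : Linked α βh) (h₂ : Linked αh β) (hα : Swaps U α αh)
    (hβ : Swaps U β βh) :
    hat α αh β βh U V = swapR α αh β U ∘L V ∘L swapL α β βh U := by
  rw [hat, legOne_eq_flip h.symm h₁.symm (hβ.intw h h₁), legOne_eq_flip h h₂
    (hα.intw h.symm h₂.symm), swapR, swapL]
  simp only [comp_assoc]
  rw [comp_comp_of_eq (flip_flip h₂.symm), id_comp, flip_flip h, comp_id]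

theorem check_eq : check α αh β βh U V = swapL α β βh U ∘L V ∘L swapR αh α βh U := by
  rw [check, swapL, swapR, comp_assoc]

/-- `V` and `V̂` are pseudo-multiplicative unitaries. -/
def HatPair (b : CStarBase 𝔥) (α αh β βh : OpSpace 𝔥 H) (U : H →L[ℂ] H)
    (V : RelTensor βh α →L[ℂ] RelTensor α β) : Prop :=
  (Swaps U α αh ∧ Swaps U β βh) ∧ IsPMU b α βh β V ∧ IsPMU b.op β α αh (hat α αh β βh U V)

namespace HatPair

theorem swaps_α (h : HatPair b α αh β βh U V) : Swaps U α αh := h.1.1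

theorem swaps_β (h : HatPair b α αh β βh U V) : Swaps U β βh := h.1.2

theorem pmu (h : HatPair b α αh β βh U V) : IsPMU b α βh β V := h.2.1

theorem pmu_hat (h : HatPair b α αh β βh U V) : IsPMU b.op β α αh (hat α αh β βh U V) := h.2.2

theorem linked (h : HatPair b α αh β βh U V) : Linked α β := h.pmu.linked

theorem linked_h (h : HatPair b α αh β βh U V) : Linked α βh := h.pmu.linked_hat.symm

theorem linked_hβ (h : HatPair b α αh β βh U V) : Linked αh β := h.pmu_hat.linked.symm

theorem hat_eq (h : HatPair b α αh β βh U V) :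
    hat α αh β βh U V = swapR α αh β U ∘L V ∘L swapL α β βh U :=
  PseudoKac.hat_eq h.linked h.linked_h h.linked_hβ h.swaps_α h.swaps_β

theorem braTwo_comp_hat (h : HatPair b α αh β βh U V) (a : αh) :
    adjoint (ketTwo β αh a) ∘L hat α αh β βh U V =
      adjoint (ketOne α β (h.swaps_α.symm.img a)) ∘L V ∘L swapL α β βh U := by
  rw [h.hat_eq, comp_comp_of_eq (braTwo_comp_swapR h.linked h.swaps_α h.linked_hβ a)]

/-- The swaps turn second-leg bras and kets into first-leg ones with U applied to the vectors, so
the left leg of V̂ is the right leg of V. -/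
theorem slice22_hat (h : HatPair b α αh β βh U V) (a : αh) (η : β) :
    IsPMU.slice22 β α αh (hat α αh β βh U V) a η =
      IsPMU.slice11 α βh β V (h.swaps_α.symm.img a) (h.swaps_β.img η) := by
  rw [IsPMU.slice22, comp_comp_of_eq (h.braTwo_comp_hat a), comp_assoc, comp_assoc,
    swapL_comp_ketTwo h.linked h.swaps_β h.linked_h, IsPMU.slice11]

/-- On mixed slices the passage to V̂ costs one factor U. This formula and `slice12_hat` turn
regularity of one of V, V̂ into coregularity of the other. -/
theorem slice21_hat (h : HatPair b α αh β βh U V) (a : αh) (c : α) :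
    IsPMU.slice21 β α αh (hat α αh β βh U V) a c =
      IsPMU.slice12 α βh β V (h.swaps_α.symm.img a) c ∘L U := by
  rw [IsPMU.slice21, comp_comp_of_eq (h.braTwo_comp_hat a), comp_assoc, comp_assoc,
    swapL_comp_ketOne h.linked h.swaps_β h.linked_h, IsPMU.slice12]
  simp only [comp_assoc]

theorem slice12_hat (h : HatPair b α αh β βh U V) (η η' : β) :
    IsPMU.slice12 β α αh (hat α αh β βh U V) η η' =
      U ∘L IsPMU.slice21 α βh β V η (h.swaps_β.img η') := by
  rw [IsPMU.slice12, h.hat_eq, comp_assoc, comp_assoc,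
    swapL_comp_ketTwo h.linked h.swaps_β h.linked_h,
    comp_comp_of_eq (braOne_comp_swapR h.linked h.swaps_α h.linked_hβ η), comp_assoc,
    IsPMU.slice21]

theorem leg_eq (h : HatPair b α αh β βh U V) :
    leg α βh β V = legHat β α αh (hat α αh β βh U V) := by
  refine le_antisymm (opProd_le (isClosed_opProd _ _) ?_) (legHat_le (isClosed_opProd _ _) ?_)
  · rintro _ ⟨_, ⟨a, rfl⟩, rfl⟩ _ ⟨_, ⟨c, rfl⟩, rfl⟩
    have := h.slice22_hat (h.swaps_α.img a) (h.swaps_β.symm.img c)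
    have h1 := slice22_mem (V := hat α αh β βh U V) (h.swaps_α.img a) (h.swaps_β.symm.img c)
    rw [this, h.swaps_α.img_img, h.swaps_β.symm.img_img] at h1
    exact h1
  · intro a η
    rw [h.slice22_hat]
    exact comp_mem_opProd ⟨_, ⟨_, rfl⟩, rfl⟩ ⟨_, ⟨_, rfl⟩, rfl⟩

/-- After applying ⟨η|₂, the sliced pentagon equations of V and of V̂ both give ⟨a|₁VΣ(1 ⊗
⟨η|₂V|c⟩₁). The identity is V(z ⊗ 1)V* = V̂*(1 ⊗ z)V̂ for z = ⟨a|₁V|c⟩₁, and it is used both for the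
right leg and for the commutation relations. -/
theorem comul_slice11 (h : HatPair b α αh β βh U V) (a : α) (c : βh) :
    comul α βh β V (IsPMU.slice11 α βh β V a c) =
      comulHat β α αh (hat α αh β βh U V) (IsPMU.slice11 α βh β V a c) := by
  refine ext_braTwo h.linked fun η => ?_
  have h1 := h.slice22_hat (h.swaps_α.img a) (h.swaps_β.symm.img c)
  rw [h.swaps_α.img_img, h.swaps_β.symm.img_img] at h1
  have h2 := h.pmu_hat.bra_comp_comulHat (h.swaps_α.img a) (h.swaps_β.symm.img c) η
  have h3 := h.slice12_hat η (h.swaps_β.symm.img c)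
  rw [h.swaps_β.symm.img_img] at h3
  have i1 := h.pmu.intw_slice21 η c
  have i2 := h.swaps_β.symm.intw h.linked_h h.linked
  -- The factor U from `slice12_hat` cancels against the one contained in `swapL`.
  rw [h1, h3, ← comp_assoc, h.braTwo_comp_hat, h.swaps_α.img_img, swapL, comp_assoc, comp_assoc,
    comp_assoc, ← legTwo_comp h.linked h.linked h.linked_h (h.swaps_β.intw h.linked h.linked_h)
      (i2.comp i1), comp_comp_of_eq h.swaps_β.1.2, id_comp] at h2
  rw [h2, h.pmu.bra_comp_comul]

end HatPair
end Hat

/-! ### Hopf C*-bimodules depend on Δ only through its values on A -/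

section Congr

set_option linter.unusedSectionVars false

variable {𝔥 H K L M : Type*}
  [NormedAddCommGroup 𝔥] [InnerProductSpace ℂ 𝔥] [CompleteSpace 𝔥]
  [NormedAddCommGroup H] [InnerProductSpace ℂ H] [CompleteSpace H]
  [NormedAddCommGroup K] [InnerProductSpace ℂ K] [CompleteSpace K]
  [NormedAddCommGroup L] [InnerProductSpace ℂ L] [CompleteSpace L]
  [NormedAddCommGroup M] [InnerProductSpace ℂ M] [CompleteSpace M]

theorem intertwiners_congr {A : OpSpace H H} {π π' : (H →L[ℂ] H) → (K →L[ℂ] K)}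
    (e : ∀ a ∈ A, π a = π' a) : intertwiners A π = intertwiners A π' := by
  ext T
  exact forall₂_congr fun a ha => by rw [e a ha]

theorem IsStarHomOn.congr {A : OpSpace H H} {B : Set (K →L[ℂ] K)}
    {π π' : (H →L[ℂ] H) → (K →L[ℂ] K)} (h : IsStarHomOn A B π) (hA : IsNondegCStarAlg A)
    (e : ∀ a ∈ A, π a = π' a) : IsStarHomOn A B π' where
  mapsTo x hx := e x hx ▸ h.mapsTo x hx
  map_add x hx y hy := by
    rw [← e _ (add_mem hx hy), ← e x hx, ← e y hy, h.map_add x hx y hy]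
  map_smul c x hx := by rw [← e _ (A.smul_mem c hx), ← e x hx, h.map_smul c x hx]
  map_mul x hx y hy := by
    rw [← e _ (hA.mul_mem x hx y hy), ← e x hx, ← e y hy, h.map_mul x hx y hy]
  map_adjoint x hx := by rw [← e _ (hA.adjoint_mem x hx), ← e x hx, h.map_adjoint x hx]

theorem IsMorphism.congr {A : OpSpace H H} {α : OpSpace 𝔥 H} {B : Set (K →L[ℂ] K)}
    {β : OpSpace 𝔥 K} {π π' : (H →L[ℂ] H) → (K →L[ℂ] K)} (h : IsMorphism A α B β π)
    (hA : IsNondegCStarAlg A) (e : ∀ a ∈ A, π a = π' a) : IsMorphism A α B β π' :=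
  ⟨h.1.congr hA e, by rw [← intertwiners_congr e]; exact h.2⟩

/-- The maps φ and ψ enter the defining relations of `fiberMap` only through their intertwiner
spaces. -/
theorem fiberMap_congr {A : OpSpace H H} {B : OpSpace K K} {α : OpSpace 𝔥 H} {β : OpSpace 𝔥 K}
    {γ : OpSpace 𝔥 L} {δ : OpSpace 𝔥 M} {φ φ' : (H →L[ℂ] H) → (L →L[ℂ] L)}
    {ψ ψ' : (K →L[ℂ] K) → (M →L[ℂ] M)} (hφ : intertwiners A φ = intertwiners A φ')
    (hψ : intertwiners B ψ = intertwiners B ψ') (T : RelTensor α β →L[ℂ] RelTensor α β) :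
    fiberMap A α B β γ δ φ ψ T = fiberMap A α B β γ δ φ' ψ' T := by
  unfold fiberMap
  rw [hφ, hψ]

theorem IsConcreteHopf.congr {b : CStarBase 𝔥} {A : OpSpace H H} {α β : OpSpace 𝔥 H}
    {Δ Δ' : (H →L[ℂ] H) → (RelTensor α β →L[ℂ] RelTensor α β)} (h : IsConcreteHopf b A α β Δ)
    (e : ∀ a ∈ A, Δ a = Δ' a) : IsConcreteHopf b A α β Δ' where
  alg_left := h.alg_left
  alg_right := h.alg_right
  compatible := h.compatible
  mor_left := h.mor_left.congr h.alg_left.alg e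
  mor_right := h.mor_right.congr h.alg_left.alg e
  coassoc a ha := by
    have h1 := h.coassoc a ha
    rwa [e a ha, fiberMap_congr (intertwiners_congr e) rfl,
      fiberMap_congr rfl (intertwiners_congr e)] at h1

end Congr

/-! ### Cancellation in the relation TVC = G -/

section Abstract

variable {X Y Z W : Type*} [NormedAddCommGroup X] [InnerProductSpace ℂ X] [CompleteSpace X]
  [NormedAddCommGroup Y] [InnerProductSpace ℂ Y] [CompleteSpace Y]
  [NormedAddCommGroup Z] [InnerProductSpace ℂ Z] [CompleteSpace Z]
  [NormedAddCommGroup W] [InnerProductSpace ℂ W] [CompleteSpace W]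
  {C : X →L[ℂ] Y} {V : Y →L[ℂ] Z} {T : Z →L[ℂ] W} {G : X →L[ℂ] W}

/-- The first relation gives TVs = tTV, hence TVCr = Gr = tG = tTVC = TVsC, and the unitaries T and
V cancel. In the application C, V, T are V̌, V, V̂. -/
theorem comp_eq_comp_of_conj_right (hV : IsUnitaryMap V) (hT : IsUnitaryMap T)
    (hG : T ∘L V ∘L C = G) {s : Y →L[ℂ] Y} {t : W →L[ℂ] W} {r : X →L[ℂ] X}
    (h1 : V ∘L s ∘L adjoint V = adjoint T ∘L t ∘L T) (h2 : G ∘L r = t ∘L G) :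
    C ∘L r = s ∘L C := by
  have h3 : T ∘L V ∘L s = t ∘L T ∘L V := by
    refine hV.adjoint.cancel_right ?_
    rw [comp_assoc, comp_assoc, h1, comp_assoc, comp_assoc, hV.2, comp_id, ← comp_assoc, hT.2,
      id_comp]
  refine hV.cancel_left (hT.cancel_left ?_)
  have h4 : T ∘L V ∘L s ∘L C = (T ∘L V ∘L s) ∘L C := by simp only [comp_assoc]
  have h5 : T ∘L V ∘L C ∘L r = (T ∘L V ∘L C) ∘L r := by simp only [comp_assoc]
  rw [h4, h3, h5, hG, h2, ← hG]
  simp only [comp_assoc]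

/-- The companion argument on the other end of TVC: from VCs = tVC one gets TtVC = TVCs = Gs = rG =
rTVC, and the unitaries V and C cancel on the right. -/
theorem comp_eq_comp_of_conj_left (hC : IsUnitaryMap C) (hV : IsUnitaryMap V)
    (hG : T ∘L V ∘L C = G) {s : X →L[ℂ] X} {t : Z →L[ℂ] Z} {r : W →L[ℂ] W}
    (h1 : C ∘L s ∘L adjoint C = adjoint V ∘L t ∘L V) (h2 : G ∘L s = r ∘L G) :
    T ∘L t = r ∘L T := by
  have h3 : V ∘L C ∘L s = t ∘L V ∘L C := by
    refine hC.adjoint.cancel_right ?_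
    rw [comp_assoc, comp_assoc, h1, comp_assoc, comp_assoc, hC.2, comp_id, ← comp_assoc, hV.2,
      id_comp]
  refine hV.cancel_right (hC.cancel_right ?_)
  simp only [comp_assoc]
  have h5 : T ∘L V ∘L C ∘L s = (T ∘L V ∘L C) ∘L s := by simp only [comp_assoc]
  rw [← h3, h5, hG, h2]

end Abstract

/-! ### Both legs are concrete Hopf C*-bimodules -/

section Hopf

variable {𝔥 H : Type*}
  [NormedAddCommGroup 𝔥] [InnerProductSpace ℂ 𝔥] [CompleteSpace 𝔥]
  [NormedAddCommGroup H] [InnerProductSpace ℂ H] [CompleteSpace H]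
  {b : CStarBase 𝔥} {α αh β βh : OpSpace 𝔥 H} {U : H →L[ℂ] H}
  {V : RelTensor βh α →L[ℂ] RelTensor α β}

namespace HatPair

theorem intw_slice11 (h : HatPair b α αh β βh U V) (a : α) (c : βh) :
    Intw β αh αh (IsPMU.slice11 α βh β V a c) := by
  have h1 := h.slice22_hat (h.swaps_α.img a) (h.swaps_β.symm.img c)
  rw [h.swaps_α.img_img, h.swaps_β.symm.img_img] at h1
  have h2 := h.pmu_hat.intw_slice22 (h.swaps_α.img a) (h.swaps_β.symm.img c)
  rwa [h1] at h2

theorem comul_eq (h : HatPair b α αh β βh U V) {z : H →L[ℂ] H} (hz : z ∈ leg α βh β V) :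
    comul α βh β V z = comulHat β α αh (hat α αh β βh U V) z := by
  set W := hat α αh β βh U V with hW
  -- On D both z ⊗ 1 and 1 ⊗ z are well defined and depend continuously on z, so the equality
  -- extends from slices to their closed span.
  let D := intwSub α βh βh ⊓ intwSub β αh αh
  have hD : IsClosed (D : Set (H →L[ℂ] H)) :=
    (isClosed_intwSub α βh βh).inter (isClosed_intwSub β αh αh)
  have hl := h.linked_h
  have hl' := h.pmu_hat.linked
  let g₁ : D →L[ℂ] (RelTensor α β →L[ℂ] RelTensor α β) :=
    compL ℂ (RelTensor α β) (RelTensor α βh) (RelTensor α β) (V ∘L flip α βh) ∘L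
      (compL ℂ (RelTensor α β) (RelTensor α βh) (RelTensor α βh)).flip (flip βh α ∘L adjoint V) ∘L
      legTwoL hl hl ∘L D.subtypeL.codRestrict (intwSub α βh βh) fun x => x.2.1
  let g₂ : D →L[ℂ] (RelTensor α β →L[ℂ] RelTensor α β) :=
    compL ℂ (RelTensor α β) (RelTensor β αh) (RelTensor α β) (adjoint W) ∘L
      (compL ℂ (RelTensor α β) (RelTensor β αh) (RelTensor β αh)).flip W ∘L
      legTwoL hl' hl' ∘L D.subtypeL.codRestrict (intwSub β αh αh) fun x => x.2.2
  have e₁ : ∀ x (hx : x ∈ D), g₁ ⟨x, hx⟩ = comul α βh β V x := by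
    intro x hx
    rw [comul, legOne_eq_flip hl.symm hl.symm hx.1]
    simp only [comp_assoc]
    rfl
  have e₂ : ∀ x (hx : x ∈ D), g₂ ⟨x, hx⟩ = comulHat β α αh W x := fun x hx => rfl
  have hm : ∀ a c, IsPMU.slice11 α βh β V a c ∈ D := fun a c =>
    ⟨h.pmu.intw_slice11 a c, h.intw_slice11 a c⟩
  have hzD : z ∈ D := by
    refine opProd_le hD ?_ hz
    rintro _ ⟨_, ⟨a, rfl⟩, rfl⟩ _ ⟨_, ⟨c, rfl⟩, rfl⟩
    exact hm a c
  have key := mem_of_mem_cspan_subtype hD (g₁ - g₂) (P := ⊥) isClosed_singleton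
    (S := Set.image2 (fun s t => s ∘L t) (adjSet (ketsOne α β)) (leftMul V (ketsOne βh α))) (by
      rintro _ ⟨_, ⟨_, ⟨a, rfl⟩, rfl⟩, _, ⟨_, ⟨c, rfl⟩, rfl⟩, rfl⟩
      have h0 : (g₁ - g₂) ⟨IsPMU.slice11 α βh β V a c, hm a c⟩ ∈
          (⊥ : Submodule ℂ (RelTensor α β →L[ℂ] RelTensor α β)) := by
        rw [Submodule.mem_bot, sub_apply, sub_eq_zero, e₁, e₂]
        exact h.comul_slice11 a c
      exact ⟨hm a c, h0⟩) hz hzD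
  rw [Submodule.mem_bot, sub_apply, sub_eq_zero, e₁, e₂] at key
  exact key

/-- [⟨α̂|₂V̂|α⟩₁] = [⟨α|₁V|α⟩₂]U = [αα*]U = [αα̂*], since α*U = (Uα)* = α̂*. -/
theorem coregular_hat (h : HatPair b α αh β βh U V) (hr : IsRegular α βh β V) :
    IsPMU.Coregular β α αh (hat α αh β βh U V) := by
  refine le_antisymm (opProd_le (isClosed_opProd _ _) ?_) (opProd_le (isClosed_opProd _ _) ?_)
  · rintro _ ⟨_, ⟨a, rfl⟩, rfl⟩ _ ⟨_, ⟨c, rfl⟩, rfl⟩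
    have h1 : IsPMU.slice12 α βh β V (h.swaps_α.symm.img a) c ∈
        opProd (α : Set (𝔥 →L[ℂ] H)) (adjSet (α : Set (𝔥 →L[ℂ] H))) := by
      rw [← hr]
      exact comp_mem_opProd ⟨_, ⟨_, rfl⟩, rfl⟩ ⟨_, ⟨c, rfl⟩, rfl⟩
    have h2 := h.slice21_hat a c
    have h3 := map_mem_of_mem_opProd ((compL ℂ H H H).flip U)
      (P := opProd (α : Set (𝔥 →L[ℂ] H)) (adjSet (αh : Set (𝔥 →L[ℂ] H)))) (isClosed_opProd _ _) (by
        rintro ξ hξ _ ⟨ξ', hξ', rfl⟩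
        have : ξ ∘L adjoint (U ∘L ξ') ∈
            opProd (α : Set (𝔥 →L[ℂ] H)) (adjSet (αh : Set (𝔥 →L[ℂ] H))) :=
          comp_mem_opProd hξ ⟨_, h.swaps_α.2.1 ξ' hξ', rfl⟩
        rw [adjoint_comp, h.swaps_α.1.1, ← comp_assoc] at this
        exact this) h1
    rw [flip_apply, compL_apply, ← h2] at h3
    exact h3
  · rintro ξ hξ _ ⟨a, ha, rfl⟩
    have h1 : ξ ∘L adjoint (U ∘L a) ∈
        opProd (α : Set (𝔥 →L[ℂ] H)) (adjSet (α : Set (𝔥 →L[ℂ] H))) :=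
      comp_mem_opProd hξ ⟨_, h.swaps_α.2.2 a ha, rfl⟩
    rw [← hr] at h1
    have h2 := map_mem_of_mem_opProd ((compL ℂ H H H).flip U)
      (P := opProd (adjSet (ketsTwo β αh)) (leftMul (hat α αh β βh U V) (ketsOne α β)))
      (isClosed_opProd _ _) (by
        rintro _ ⟨_, ⟨x, rfl⟩, rfl⟩ _ ⟨_, ⟨c, rfl⟩, rfl⟩
        have h3 := h.slice21_hat (h.swaps_α.img x) c
        rw [h.swaps_α.img_img] at h3
        have h4 : IsPMU.slice21 β α αh (hat α αh β βh U V) (h.swaps_α.img x) c ∈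
            opProd (adjSet (ketsTwo β αh)) (leftMul (hat α αh β βh U V) (ketsOne α β)) :=
          comp_mem_opProd ⟨_, ⟨_, rfl⟩, rfl⟩ ⟨_, ⟨c, rfl⟩, rfl⟩
        rw [h3] at h4
        exact h4) h1
    rw [flip_apply, compL_apply, adjoint_comp, h.swaps_α.1.1, comp_assoc, comp_assoc,
      h.swaps_α.1.2, comp_id] at h2
    exact h2

/-- [⟨β|₂V|β̂⟩₁] = U[⟨β|₁V̂|β⟩₂] = U[ββ*] = [β̂β*]. -/
theorem coregular (h : HatPair b α αh β βh U V)
    (hr : IsRegular β α αh (hat α αh β βh U V)) : IsPMU.Coregular α βh β V := by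
  refine le_antisymm (opProd_le (isClosed_opProd _ _) ?_) (opProd_le (isClosed_opProd _ _) ?_)
  · rintro _ ⟨_, ⟨η, rfl⟩, rfl⟩ _ ⟨_, ⟨c, rfl⟩, rfl⟩
    have h1 : IsPMU.slice12 β α αh (hat α αh β βh U V) η (h.swaps_β.symm.img c) ∈
        opProd (β : Set (𝔥 →L[ℂ] H)) (adjSet (β : Set (𝔥 →L[ℂ] H))) := by
      rw [← hr]
      exact comp_mem_opProd ⟨_, ⟨_, rfl⟩, rfl⟩ ⟨_, ⟨_, rfl⟩, rfl⟩
    rw [h.slice12_hat, h.swaps_β.symm.img_img] at h1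
    have h3 := map_mem_of_mem_opProd (compL ℂ H H H U)
      (P := opProd (βh : Set (𝔥 →L[ℂ] H)) (adjSet (β : Set (𝔥 →L[ℂ] H)))) (isClosed_opProd _ _) (by
        intro η₁ hη₁ t ht
        rw [compL_apply, ← comp_assoc]
        exact comp_mem_opProd (h.swaps_β.2.1 η₁ hη₁) ht) h1
    rw [compL_apply, ← comp_assoc, h.swaps_β.1.2, id_comp] at h3
    exact h3
  · rintro c hc _ ⟨η, hη, rfl⟩
    have h1 : (U ∘L c) ∘L adjoint η ∈
        opProd (β : Set (𝔥 →L[ℂ] H)) (adjSet (β : Set (𝔥 →L[ℂ] H))) :=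
      comp_mem_opProd (h.swaps_β.2.2 c hc) ⟨η, hη, rfl⟩
    rw [← hr] at h1
    have h2 := map_mem_of_mem_opProd (compL ℂ H H H U)
      (P := opProd (adjSet (ketsTwo α β)) (leftMul V (ketsOne βh α)))
      (isClosed_opProd _ _) (by
        rintro _ ⟨_, ⟨x, rfl⟩, rfl⟩ _ ⟨_, ⟨y, rfl⟩, rfl⟩
        have h3 := h.slice12_hat x y
        have h4 : IsPMU.slice21 α βh β V x (h.swaps_β.img y) ∈
            opProd (adjSet (ketsTwo α β)) (leftMul V (ketsOne βh α)) :=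
          comp_mem_opProd ⟨_, ⟨_, rfl⟩, rfl⟩ ⟨_, ⟨_, rfl⟩, rfl⟩
        have h5 : U ∘L IsPMU.slice12 β α αh (hat α αh β βh U V) x y =
            IsPMU.slice21 α βh β V x (h.swaps_β.img y) := by
          rw [h3, ← comp_assoc, h.swaps_β.1.2, id_comp]
        rw [← h5] at h4
        exact h4) h1
    rw [compL_apply, ← comp_assoc, ← comp_assoc, h.swaps_β.1.2, id_comp] at h2
    exact h2

/-- The result on left legs is applied to V and to V̂; the latter has the right leg of V as its left
leg, with the same comultiplication on it. -/
theorem isWellBehaved (h : HatPair b α αh β βh U V) (hr : IsRegular α βh β V)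
    (hr' : IsRegular β α αh (hat α αh β βh U V)) : IsWellBehaved b α βh β V := by
  refine ⟨h.pmu.isConcreteHopf_legHat hr (h.coregular hr'), ?_⟩
  have h1 := h.pmu_hat.isConcreteHopf_legHat hr' (h.coregular_hat hr)
  have h2 : ∀ z ∈ legHat β α αh (hat α αh β βh U V),
      comulHat β α αh (hat α αh β βh U V) z = comul α βh β V z := fun z hz =>
    (h.comul_eq (h.leg_eq ▸ hz)).symm
  have h3 := h1.congr h2
  rw [← h.leg_eq] at h3
  exact h3

end HatPair
end Hopf

/-! ### Commutation of legs tested on slices -/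

section Slices

variable {𝔥 𝔨 H K L X : Type*}
  [NormedAddCommGroup 𝔥] [InnerProductSpace ℂ 𝔥] [CompleteSpace 𝔥]
  [NormedAddCommGroup 𝔨] [InnerProductSpace ℂ 𝔨] [CompleteSpace 𝔨]
  [NormedAddCommGroup H] [InnerProductSpace ℂ H] [CompleteSpace H]
  [NormedAddCommGroup K] [InnerProductSpace ℂ K] [CompleteSpace K]
  [NormedAddCommGroup L] [InnerProductSpace ℂ L] [CompleteSpace L]
  [NormedAddCommGroup X] [InnerProductSpace ℂ X] [CompleteSpace X]
  {α : OpSpace 𝔥 H} {β : OpSpace 𝔥 K} {γ : OpSpace 𝔨 K} {δ : OpSpace 𝔨 L}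

theorem Chain.braTwo_comp_assocInv (h : Chain α β γ δ) (η : δ) :
    adjoint (ketTwo (rightTri α β γ) δ η) ∘L assocInv α β γ δ =
      adjoint (legTwo α β (leftTri γ δ β) (ketTwo γ δ η)) := by
  rw [← h.assoc_comp_ketTwo, adjoint_comp, h.adjoint_assoc]

theorem Chain.ext_bra_legTwo (h : Chain α β γ δ) {S T : X →L[ℂ] RelTensor α (leftTri γ δ β)}
    (e : ∀ η, adjoint (legTwo α β (leftTri γ δ β) (ketTwo γ δ η)) ∘L S =
      adjoint (legTwo α β (leftTri γ δ β) (ketTwo γ δ η)) ∘L T) : S = T := by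
  refine h.isUnitaryMap_assocInv.cancel_left (ext_braTwo h.linked_rightTri fun η => ?_)
  rw [comp_comp_of_eq (h.braTwo_comp_assocInv η), comp_comp_of_eq (h.braTwo_comp_assocInv η), e]

theorem Chain.ext_ket_legOne (h : Chain α β γ δ) {S T : RelTensor (rightTri α β γ) δ →L[ℂ] X}
    (e : ∀ ξ, S ∘L legOne γ (rightTri α β γ) δ (ketOne α β ξ) =
      T ∘L legOne γ (rightTri α β γ) δ (ketOne α β ξ)) : S = T := by
  refine h.isUnitaryMap_assocInv.cancel_right (ext_ketOne h.linked_leftTri' fun ξ => ?_)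
  rw [comp_assoc, comp_assoc, h.assocInv_comp_ketOne, e]

end Slices

section Commute

variable {𝔥 H : Type*}
  [NormedAddCommGroup 𝔥] [InnerProductSpace ℂ 𝔥] [CompleteSpace 𝔥]
  [NormedAddCommGroup H] [InnerProductSpace ℂ H] [CompleteSpace H]
  {α αh β βh : OpSpace 𝔥 H} {V : RelTensor βh α →L[ℂ] RelTensor α β}

/-- Apply |ξ⟩ and ⟨η| in the third leg. Both pass W₁₂, and V₂₃ becomes 1 ⊗ y with y = ⟨η|₂V|ξ⟩₂, so
the diagram reduces to the hypothesis on slices. -/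
theorem legTwo_comm_legOne_of_slice22 {W : RelTensor α β →L[ℂ] RelTensor β αh}
    (c₁ : Chain β αh βh α) (c₂ : Chain β αh α β) (c₃ : Chain α β βh α) (c₄ : Chain α β α β)
    (i₁ : Intw α (rightTri α β βh) (rightTri β αh βh) W)
    (i₂ : Intw β (rightTri α β α) (rightTri β αh α) W)
    (i₃ : Intw β (leftTri βh α αh) (leftTri α β αh) V)
    (i₄ : Intw α (leftTri βh α β) (leftTri α β β) V)
    (h : ∀ η ξ, W ∘L legTwo α β β (IsPMU.slice22 α βh β V η ξ) =
      legTwo β αh αh (IsPMU.slice22 α βh β V η ξ) ∘L W) :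
    legTwo β (leftTri βh α αh) (leftTri α β αh) V ∘L assoc β αh βh α ∘L
      legOne (rightTri α β βh) (rightTri β αh βh) α W =
    assoc β αh α β ∘L legOne (rightTri α β α) (rightTri β αh α) β W ∘L assocInv α β α β ∘L
      legTwo α (leftTri βh α β) (leftTri α β β) V ∘L assoc α β βh α := by
  refine ext_ketTwo c₃.linked_rightTri fun ξ => c₂.ext_bra_legTwo fun η => ?_
  have l₁ := c₁.left.linked
  have l₃ := c₃.left.linked
  have j₁ := (c₂.intw_ketTwo η).adjoint l₁ c₂.linked_leftTri'
  have j₂ := i₃.comp (c₁.intw_ketTwo ξ)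
  have k₁ := (c₄.intw_ketTwo η).adjoint l₃ c₄.linked_leftTri'
  have k₂ := i₄.comp (c₃.intw_ketTwo ξ)
  have e₁ : legTwo β αh αh (IsPMU.slice22 α βh β V η ξ) =
      adjoint (legTwo β αh (leftTri α β αh) (ketTwo α β η)) ∘L
        legTwo β (leftTri βh α αh) (leftTri α β αh) V ∘L
        legTwo β αh (leftTri βh α αh) (ketTwo βh α ξ) := by
    rw [IsPMU.slice22, legTwo_comp l₁ c₂.linked_leftTri' l₁ j₁ j₂,
      legTwo_comp l₁ c₁.linked_leftTri' c₂.linked_leftTri' i₃ (c₁.intw_ketTwo ξ),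
      adjoint_legTwo l₁ c₂.linked_leftTri' (c₂.intw_ketTwo η)]
  have e₂ : legTwo α β β (IsPMU.slice22 α βh β V η ξ) =
      adjoint (legTwo α β (leftTri α β β) (ketTwo α β η)) ∘L
        legTwo α (leftTri βh α β) (leftTri α β β) V ∘L
        legTwo α β (leftTri βh α β) (ketTwo βh α ξ) := by
    rw [IsPMU.slice22, legTwo_comp l₃ c₄.linked_leftTri' l₃ k₁ k₂,
      legTwo_comp l₃ c₃.linked_leftTri' c₄.linked_leftTri' i₄ (c₃.intw_ketTwo ξ),
      adjoint_legTwo l₃ c₄.linked_leftTri' (c₄.intw_ketTwo η)]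
  have h₁ := h η ξ
  rw [e₁, e₂, comp_assoc, comp_assoc] at h₁
  rw [comp_assoc, comp_assoc, legOne_comp_ketTwo c₃.linked_rightTri c₁.linked_rightTri i₁,
    comp_comp_of_eq (c₁.assoc_comp_ketTwo ξ), ← h₁, comp_assoc, comp_assoc, comp_assoc, comp_assoc,
    c₃.assoc_comp_ketTwo, comp_comp_of_eq (c₂.braTwo_comp_assoc η),
    comp_comp_of_eq' (braTwo_comp_legOne c₄.linked_rightTri c₂.linked_rightTri i₂ η),
    comp_comp_of_eq (c₄.braTwo_comp_assocInv η)]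

/-- Here the first leg is sliced by |c⟩₁ and ⟨a|₁. Both pass C₂₃, and V₁₂ becomes z ⊗ 1 with z =
⟨a|₁V|c⟩₁. -/
theorem legTwo_comm_legOne_of_slice11 {C : RelTensor αh βh →L[ℂ] RelTensor βh α}
    (c₁ : Chain α β αh βh) (c₂ : Chain βh α αh βh) (c₃ : Chain α β βh α) (c₄ : Chain βh α βh α)
    (i₁ : Intw βh (rightTri βh α αh) (rightTri α β αh) V)
    (i₂ : Intw α (rightTri βh α βh) (rightTri α β βh) V)
    (i₃ : Intw α (leftTri αh βh β) (leftTri βh α β) C)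
    (i₄ : Intw βh (leftTri αh βh α) (leftTri βh α α) C)
    (h : ∀ a c, C ∘L legOne αh αh βh (IsPMU.slice11 α βh β V a c) =
      legOne βh βh α (IsPMU.slice11 α βh β V a c) ∘L C) :
    legTwo α (leftTri αh βh β) (leftTri βh α β) C ∘L assoc α β αh βh ∘L
      legOne (rightTri βh α αh) (rightTri α β αh) βh V =
    assoc α β βh α ∘L legOne (rightTri βh α βh) (rightTri α β βh) α V ∘L assocInv βh α βh α ∘L
      legTwo βh (leftTri αh βh α) (leftTri βh α α) C ∘L assoc βh α αh βh := by
  refine c₂.ext_ket_legOne fun c => ext_braOne c₃.linked_leftTri' fun a => ?_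
  have l₁ := c₁.right.linked.symm
  have l₃ := c₃.right.linked.symm
  have j₁ := (c₁.intw_ketOne a).adjoint l₁.symm c₁.linked_rightTri.symm
  have j₂ := i₁.comp (c₂.intw_ketOne c)
  have k₁ := (c₃.intw_ketOne a).adjoint l₃.symm c₃.linked_rightTri.symm
  have k₂ := i₂.comp (c₄.intw_ketOne c)
  have e₁ : legOne αh αh βh (IsPMU.slice11 α βh β V a c) =
      adjoint (legOne αh (rightTri α β αh) βh (ketOne α β a)) ∘L
        legOne (rightTri βh α αh) (rightTri α β αh) βh V ∘L
        legOne αh (rightTri βh α αh) βh (ketOne βh α c) := by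
    rw [IsPMU.slice11, legOne_comp l₁ c₁.linked_rightTri l₁ j₁ j₂,
      legOne_comp l₁ c₂.linked_rightTri c₁.linked_rightTri i₁ (c₂.intw_ketOne c),
      adjoint_legOne l₁ c₁.linked_rightTri (c₁.intw_ketOne a)]
  have e₂ : legOne βh βh α (IsPMU.slice11 α βh β V a c) =
      adjoint (legOne βh (rightTri α β βh) α (ketOne α β a)) ∘L
        legOne (rightTri βh α βh) (rightTri α β βh) α V ∘L
        legOne βh (rightTri βh α βh) α (ketOne βh α c) := by
    rw [IsPMU.slice11, legOne_comp l₃ c₃.linked_rightTri l₃ k₁ k₂,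
      legOne_comp l₃ c₄.linked_rightTri c₃.linked_rightTri i₂ (c₄.intw_ketOne c),
      adjoint_legOne l₃ c₃.linked_rightTri (c₃.intw_ketOne a)]
  have h₁ := h a c
  rw [e₁, e₂, comp_assoc, comp_assoc] at h₁
  rw [comp_assoc, comp_assoc,
    comp_comp_of_eq' (braOne_comp_legTwo c₁.linked_leftTri' c₃.linked_leftTri' i₃ a),
    comp_comp_of_eq (c₁.braOne_comp_assoc a), h₁, comp_assoc, comp_assoc, comp_assoc, comp_assoc,
    c₂.assoc_comp_legOne, legTwo_comp_ketOne c₂.linked_leftTri' c₄.linked_leftTri' i₄,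
    comp_comp_of_eq (c₄.assocInv_comp_ketOne c), comp_comp_of_eq (c₃.braOne_comp_assoc a)]

end Commute

/-! ### The cube relation and the two commutation diagrams -/

section Kac

variable {𝔥 H : Type*}
  [NormedAddCommGroup 𝔥] [InnerProductSpace ℂ 𝔥] [CompleteSpace 𝔥]
  [NormedAddCommGroup H] [InnerProductSpace ℂ H] [CompleteSpace H]
  {b : CStarBase 𝔥} {α αh β βh : OpSpace 𝔥 H} {U : H →L[ℂ] H}
  {V : RelTensor βh α →L[ℂ] RelTensor α β}

theorem Swaps.of_leftMul {γ γh : OpSpace 𝔥 H} (hs : IsSelfAdjoint U) (hu : IsUnitaryMap U)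
    (h : leftMul U (γ : Set (𝔥 →L[ℂ] H)) = γh) : Swaps U γ γh := by
  have h1 : adjoint U = U := hs.adjoint_eq
  have h2 : U ∘L U = ContinuousLinearMap.id ℂ H := by simpa only [h1] using hu.1
  refine ⟨⟨h1, h2⟩, fun ξ hξ => ?_, fun ξ hξ => ?_⟩
  · rw [← SetLike.mem_coe, ← h]
    exact ⟨ξ, hξ, rfl⟩
  · rw [← SetLike.mem_coe, ← h] at hξ
    obtain ⟨ξ', hξ', rfl⟩ := hξ
    have : U ∘L U ∘L ξ' = ξ' := by rw [comp_comp_of_eq h2, id_comp]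
    exact this.symm ▸ hξ'

namespace HatPair

/-- V̂₁₂ in the diagram needs V̂ to map α ▷ β̂ into β ▷ β̂, which is not among the mapping
conditions for V̂. It follows by conjugating the fourth condition for V by the swaps. -/
theorem intw_hat (h : HatPair b α αh β βh U V) (l : Linked α (rightTri β αh βh)) :
    Intw α (rightTri α β βh) (rightTri β αh βh) (hat α αh β βh U V) := by
  refine .of_maps h.pmu.chain_αβh.linked_rightTri.symm l fun w hw => ?_
  rw [h.hat_eq, comp_assoc, comp_assoc]
  exact swapR_comp_mem_rightTri h.linked h.swaps_α h.linked_hβ h.swaps_β.2.1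
    (h.pmu.comp_mem_four
      (swapL_comp_mem_leftTri h.linked h.swaps_β h.linked_h h.swaps_β.2.2 hw))

theorem eq_swapL_comp (h : HatPair b α αh β βh U V) :
    V = swapL β αh α U ∘L hat α αh β βh U V ∘L swapR βh β α U := by
  rw [h.hat_eq, comp_assoc, comp_assoc,
    swapL_comp_swapR h.linked_h.symm h.swaps_β.symm h.linked.symm, comp_id,
    comp_comp_of_eq (swapL_comp_swapR h.linked h.swaps_α h.linked_hβ), id_comp]

/-- The analogous extra condition for V, obtained from the third mapping condition for V̂ by
recovering V from V̂. -/
theorem intw_leftTri (h : HatPair b α αh β βh U V) (l : Linked β (leftTri βh α αh))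
    (l' : Linked β (leftTri α β αh)) : Intw β (leftTri βh α αh) (leftTri α β αh) V := by
  refine .of_maps l l' fun w hw => ?_
  rw [h.eq_swapL_comp, comp_assoc, comp_assoc]
  exact swapL_comp_mem_leftTri h.linked_hβ.symm h.swaps_α.symm h.linked.symm h.swaps_α.2.1
    (h.pmu_hat.comp_mem_three
      (swapR_comp_mem_rightTri h.linked_h.symm h.swaps_β.symm h.linked.symm h.swaps_α.2.2 hw))

end HatPair

namespace IsBalanced

theorem swaps_α (h : IsBalanced b α αh β βh U V) : Swaps U α αh :=
  .of_leftMul h.selfAdjoint h.unitary h.map_α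

theorem swaps_β (h : IsBalanced b α αh β βh U V) : Swaps U β βh :=
  .of_leftMul h.selfAdjoint h.unitary h.map_β

theorem hatPair (h : IsBalanced b α αh β βh U V) : HatPair b α αh β βh U V :=
  ⟨⟨h.swaps_α, h.swaps_β⟩, h.pmu, h.pmu_hat⟩

theorem linked_hh (h : IsBalanced b α αh β βh U V) : Linked αh βh :=
  h.pmu_check.linked_hat

theorem hat_check (h : IsBalanced b α αh β βh U V) :
    hat βh β α αh U (check α αh β βh U V) = V := by
  rw [PseudoKac.hat_eq h.hatPair.linked_h.symm h.linked_hh.symm h.hatPair.linked.symm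
    h.swaps_β.symm h.swaps_α, check_eq, comp_assoc, comp_assoc,
    swapR_comp_swapL h.hatPair.linked_h.symm h.swaps_α h.linked_hh.symm, comp_id,
    comp_comp_of_eq (swapR_comp_swapL h.hatPair.linked h.swaps_β h.hatPair.linked_h), id_comp]

/-- As V is the hat of V̌, everything proved for the pair (V, V̂) also holds for (V̌, V). This gives
the second half of the commutation relations. -/
theorem checkPair (h : IsBalanced b α αh β βh U V) :
    HatPair b.op βh β α αh U (check α αh β βh U V) :=
  ⟨⟨h.swaps_β.symm, h.swaps_α⟩, h.pmu_check, by rw [h.hat_check]; exact h.pmu⟩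

theorem chain_βαhβhα (h : IsBalanced b α αh β βh U V) : Chain β αh βh α :=
  h.fact_β.chain (b := b.op) (c := b.op) h.fact_αh h.fact_βh h.fact_α h.compat_αh_βh

theorem chain_βαhαβ (h : IsBalanced b α αh β βh U V) : Chain β αh α β :=
  h.fact_β.chain (b := b.op) (c := b) h.fact_αh h.fact_α h.fact_β h.compat_α_αh.symm

theorem chain_αβαhβh (h : IsBalanced b α αh β βh U V) : Chain α β αh βh :=
  h.fact_α.chain (c := b) h.fact_β h.fact_αh h.fact_βh h.compat_αh_β.symm

theorem chain_βhααhβh (h : IsBalanced b α αh β βh U V) : Chain βh α αh βh :=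
  h.fact_βh.chain (b := b.op) (c := b) h.fact_α h.fact_αh h.fact_βh h.compat_α_αh

end IsBalanced

namespace IsPseudoKac

/-- By the cube relation, `V̂ V V̌` is the map `x ⊗ y ↦ U y ⊗ x`. -/
theorem hat_comp_check (h : IsPseudoKac b α αh β βh U V) :
    hat α αh β βh U V ∘L V ∘L check α αh β βh U V =
      swapR α αh β U ∘L swapR βh β α U ∘L swapR αh α βh U := by
  have hb := h.balanced
  have hp := hb.hatPair
  have h1 : (swapL α β βh U ∘L V) ∘L (swapL α β βh U ∘L V) ∘L (swapL α β βh U ∘L V) =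
      ContinuousLinearMap.id ℂ _ := by
    have := h.cube
    rw [← comp_assoc, ← swapL, pow_three] at this
    exact this
  -- In the cube relation the leftmost swap is moved to the other side, where it appears as its
  -- inverse.
  have h2 : V ∘L swapL α β βh U ∘L V ∘L swapL α β βh U ∘L V = swapR βh β α U := by
    rw [comp_assoc, comp_assoc] at h1
    have h3 := congrArg (fun T => swapR βh β α U ∘L T) h1
    rwa [comp_comp_of_eq (swapR_comp_swapL hp.linked hp.swaps_β hp.linked_h), id_comp, comp_id]
      at h3
  rw [hp.hat_eq, check_eq, ← h2]
  simp only [comp_assoc]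

/-- The composite x ⊗ y ↦ Uy ⊗ x moves the first leg to the second place unchanged, because U acts
on it twice; it therefore carries z ⊗ 1 to 1 ⊗ z. -/
theorem hat_comp_check_comp_legOne (h : IsPseudoKac b α αh β βh U V) {z : H →L[ℂ] H}
    (hz : Intw β αh αh z) :
    (swapR α αh β U ∘L swapR βh β α U ∘L swapR αh α βh U) ∘L legOne αh αh βh z =
      legTwo β αh αh z ∘L swapR α αh β U ∘L swapR βh β α U ∘L swapR αh α βh U := by
  have hb := h.balanced
  have hp := hb.hatPair
  have l := hb.linked_hh
  have e : ∀ c : βh, (swapR α αh β U ∘L swapR βh β α U ∘L swapR αh α βh U) ∘L ketTwo αh βh c =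
      ketOne β αh (hp.swaps_β.symm.img c) := fun c => by
    rw [comp_assoc, comp_assoc, swapR_comp_ketTwo l hp.swaps_α.symm hp.linked_h,
      comp_comp_of_eq (swapR_comp_ketOne hp.linked_h.symm hp.swaps_β.symm hp.linked.symm c),
      comp_comp_of_eq (swapR_comp_ketTwo hp.linked hp.swaps_α hp.linked_hβ _), comp_assoc,
      hp.swaps_α.1.2, comp_id]
  refine ext_ketTwo l fun c => ?_
  rw [comp_assoc, legOne_comp_ketTwo l l (hp.swaps_β.intw_of_intw hz), comp_comp_of_eq (e c),
    comp_assoc, e c, legTwo_comp_ketOne hp.linked_hβ.symm hp.linked_hβ.symm hz]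

/-- V̂V carries z ⊗ 1 to 1 ⊗ z because Δ_V(z) = Δ̂_V̂(z), and V̂VV̌ does so by the cube relation;
hence V̌ commutes with z ⊗ 1. -/
theorem check_comp_legOne (h : IsPseudoKac b α αh β βh U V) (a : α) (c : βh) :
    check α αh β βh U V ∘L legOne αh αh βh (IsPMU.slice11 α βh β V a c) =
      legOne βh βh α (IsPMU.slice11 α βh β V a c) ∘L check α αh β βh U V :=
  comp_eq_comp_of_conj_right h.balanced.pmu.unitary h.balanced.pmu_hat.unitary h.hat_comp_check
    (h.balanced.hatPair.comul_slice11 a c)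
    (h.hat_comp_check_comp_legOne (h.balanced.hatPair.intw_slice11 a c))

/-- The slice y = ⟨η|₂V|ξ⟩₂ is a first-leg slice of V̌, so V̌(y ⊗ 1)V̌* = V*(1 ⊗ y)V. Thus VV̌
carries y ⊗ 1 to 1 ⊗ y, as does V̂VV̌, and V̂ has to commute with 1 ⊗ y. -/
theorem hat_comp_legTwo (h : IsPseudoKac b α αh β βh U V) (η : β) (ξ : α) :
    hat α αh β βh U V ∘L legTwo α β β (IsPMU.slice22 α βh β V η ξ) =
      legTwo β αh αh (IsPMU.slice22 α βh β V η ξ) ∘L hat α αh β βh U V := by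
  have hc := h.balanced.checkPair
  have h1 := hc.slice22_hat η ξ
  rw [h.balanced.hat_check] at h1
  rw [h1]
  have h2 := hc.comul_slice11 (hc.swaps_α.symm.img η) (hc.swaps_β.img ξ)
  rw [h.balanced.hat_check] at h2
  exact comp_eq_comp_of_conj_left h.balanced.pmu_check.unitary h.balanced.pmu.unitary
    h.hat_comp_check h2 (h.hat_comp_check_comp_legOne
      (h.balanced.swaps_β.symm.intw_of_intw (hc.pmu.intw_slice11 _ _)))

theorem hatCommutes (h : IsPseudoKac b α αh β βh U V) : HatCommutes α αh β βh U V :=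
  have hb := h.balanced
  legTwo_comm_legOne_of_slice22 hb.chain_βαhβhα hb.chain_βαhαβ hb.pmu.chain_αβh hb.pmu.chain_αβα
    (hb.hatPair.intw_hat hb.chain_βαhβhα.linked_rightTri.symm) hb.pmu_hat.intw_three
    (hb.hatPair.intw_leftTri hb.chain_βαhβhα.linked_leftTri' hb.chain_βαhαβ.linked_leftTri')
    hb.pmu.intw_four h.hat_comp_legTwo

theorem checkCommutes (h : IsPseudoKac b α αh β βh U V) : CheckCommutes α αh β βh U V := by
  have hb := h.balanced
  have i₁ := hb.checkPair.intw_hat hb.chain_αβαhβh.linked_rightTri.symm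
  rw [hb.hat_check] at i₁
  exact legTwo_comm_legOne_of_slice11 hb.chain_αβαhβh hb.chain_βhααhβh hb.pmu.chain_αβh
    hb.pmu.chain_hhα i₁ hb.pmu.intw_three
    (hb.checkPair.intw_leftTri hb.chain_αβαhβh.linked_leftTri' hb.pmu.chain_αβh.linked_leftTri')
    hb.pmu_check.intw_four h.check_comp_legOne

end IsPseudoKac
end Kac

end PseudoKac

end

theorem mainTheorem5 {𝔥 H : Type*}
    [NormedAddCommGroup 𝔥] [InnerProductSpace ℂ 𝔥] [CompleteSpace 𝔥]
    [NormedAddCommGroup H] [InnerProductSpace ℂ H] [CompleteSpace H]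
    (b : PseudoKac.CStarBase 𝔥) (α αh β βh : Submodule ℂ (𝔥 →L[ℂ] H)) (U : H →L[ℂ] H)
    (V : PseudoKac.RelTensor βh α →L[ℂ] PseudoKac.RelTensor α β)
    (hV : PseudoKac.IsPseudoKac b α αh β βh U V) :
    PseudoKac.IsWeakPseudoKac b α αh β βh U V :=
  ⟨hV.balanced, hV.balanced.hatPair.isWellBehaved hV.regular hV.regular_hat, hV.hatCommutes,
    hV.checkCommutes⟩
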